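/- Let $q$ be a power of an odd prime, $K=\overline{\mathbb F}_q$, and for $n\ge 0$ let $\mathbf U_n$ denote $\mathrm{GL}_n$ over $K$ with the Frobenius endomorphism $\mathrm{Fr}(g)=\big((g^{(q)})^{\mathsf T}\big)^{-1}$, where $g^{(q)}$ is obtained from $g$ by raising the entries to the $q$-th power; its group of rational points is the finite unitary group $\mathrm U_n(q)$, and $\mathbf U_n$ is its own Langlands dual. A pair of groups is called a unitary dual pair if it can be identified with a pair $(\mathrm U_a(q),\mathrm U_b(q))$, where $\mathrm U_a(q)$ and $\mathrm U_b(q)$ act on the symplectic $\mathbb F_q$-space $W=\mathbb F_{q^2}^a\otimes_{\mathbb F_{q^2}}\mathbb F_{q^2}^b$ of dimension $2ab$ and their images in $\mathrm{Sp}(W)\cong \mathrm{Sp}_{2ab}(q)$ are the centralizers of one another. Let $(G,G')=(\mathrm U_n(q),\mathrm U_{n'}(q))$ be a unitary dual pair and let $s\in \mathbf G^*=\mathbf U_n$, $s'\in\mathbf G'^*=\mathbf U_{n'}$ be rational semisimple elements which are Howe-related: there are $l\le\min(n,n')$ and $t=(t_1,\dots,t_l)\in (K^\times)^l$ with all $t_i\ne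 1$ such that $s$ is conjugate to $\mathrm{diag}(t,1,\dots,1)$ in $\mathrm{GL}_n(K)$ and $s'$ is conjugate to $\mathrm{diag}(t,1,\dots,1)$ in $\mathrm{GL}_{n'}(K)$. For an eigenvalue $\lambda$ of $s$ let $[\lambda]$ be the set of eigenvalues of $s$ in the orbit of $\lambda$ under $x\mapsto x^{-q}$, and let $\mathbf G_{[\lambda]}(s)$ be the group of those $g\in C_{\mathbf G^*}(s)$ that are the identity on the eigenspaces of $s$ for all eigenvalues outside $[\lambda]$; thus $C_{\mathbf G^*}(s)=\prod_{[\lambda]}\mathbf G_{[\lambda]}(s)$. (If $1$ is not an eigenvalue of $s$, then $\mathbf G_{[1]}(s)$ is trivial.) Let $\mathbf G_\#=\prod_{[\lambda]\neq[1]}\mathbf G_{[\lambda]}(s)$, let $\mathbf G_{(1)}$ be the Langlands dual of $\mathbf G_{[1]}(s)$, and let $G_\#$, $G_{(1)}$ be their groups of rational points; define $G'_\#$ and $G'_{(1)}$ in the same way from $s'$. Then $G_\#$ and $G'_\#$ are isomorphic. Moreover, there are $a,b\ge 0$ such that the Langlands duals $\mathbf G_{(1)}$ and $\mathbf G'_{(1)}$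 are $\mathbf U_a$ and $\mathbf U_b$, so that $(G_{(1)},G'_{(1)})=(\mathrm U_a(q),\mathrm U_b(q))$, and this pair is a unitary dual pair. -/

import Mathlib

/-! Throughout, `F` is a finite field with `q` elements and `K` an algebraic closure of `F`.
A linear algebraic group over `K` is given by its group of `K`-points, a subgroup of some
`GL (Fin n) K`, and a rational structure by a Frobenius endomorphism of `GL (Fin n) K`. -/

namespace HowePan

noncomputable section

open Matrix

/-! ### Unitary groups -/

section Unitary

variable (F : Type*) [Field F] [Fintype F] (K : Type*) [Field K] [Algebra F K]

/-- The automorphism `g ↦ (gᵀ)⁻¹` of `GL n K`. -/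
def transposeInv (n : ℕ) : GL (Fin n) K →* GL (Fin n) K where
  toFun g := ⟨(g⁻¹ : GL (Fin n) K).1ᵀ, g.1ᵀ,
    by rw [← Matrix.transpose_mul, Units.mul_inv, Matrix.transpose_one],
    by rw [← Matrix.transpose_mul, Units.inv_mul, Matrix.transpose_one]⟩
  map_one' := by
    apply Units.ext
    change ((1 : GL (Fin n) K)⁻¹ : GL (Fin n) K).1ᵀ = 1
    rw [inv_one, Units.val_one, Matrix.transpose_one]
  map_mul' g h := by
    apply Units.ext
    change ((g * h)⁻¹ : GL (Fin n) K).1ᵀ = (g⁻¹ : GL (Fin n) K).1ᵀ * (h⁻¹ : GL (Fin n) K).1ᵀ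
    rw [← Matrix.transpose_mul, _root_.mul_inv_rev, Units.val_mul]

/-- The Frobenius endomorphism `(gᵢⱼ) ↦ ((gᵢⱼ ^ q)ᵀ)⁻¹` of `GL n` defining the unitary group. -/
def unitaryFrob (n : ℕ) : GL (Fin n) K →* GL (Fin n) K :=
  (transposeInv K n).comp
    (Matrix.GeneralLinearGroup.map (FiniteField.frobeniusAlgHom F K : K →+* K))

/-- The group of rational points (Frobenius fixed points) of a subgroup of `GL n`. -/
def rationalPoints {K : Type*} [Field K] {n : ℕ} (Fr : GL (Fin n) K →* GL (Fin n) K)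
    (H : Subgroup (GL (Fin n) K)) : Subgroup (GL (Fin n) K) where
  carrier := {g | g ∈ H ∧ Fr g = g}
  one_mem' := ⟨H.one_mem, map_one Fr⟩
  mul_mem' := fun ⟨ha, ha'⟩ ⟨hb, hb'⟩ => ⟨H.mul_mem ha hb, by rw [map_mul, ha', hb']⟩
  inv_mem' := fun ⟨ha, ha'⟩ => ⟨H.inv_mem ha, by rw [map_inv, ha']⟩

/-- The finite unitary group `U_n(q)`, that is `{g ∈ GL_n(K) | (g^{(q)})ᵀ g = 1}`. -/
abbrev U (n : ℕ) : Subgroup (GL (Fin n) K) := rationalPoints (unitaryFrob F K n) ⊤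

/-- `(A, B)` is a unitary dual pair over `F`: there are identifications `A ≃ U_a(q)`,
`B ≃ U_b(q)` such that, in the symplectic group of the `F`-vector space
`W = V ⊗ V'` (`V = 𝔽_{q²}^a`, `V' = 𝔽_{q²}^b`, so that `W` is the space of `a × b` matrices over
`𝔽_{q²}`), `A` acting by `X ↦ g X` and `B` acting by `X ↦ X hᵀ` are the centralizers of
one another. The map `j` is a coordinate system of `W` in which the symplectic form on `W` is the
standard one of `Sp_{2N}(F)`. (For `a = 0` or `b = 0` one has `W = 0`.) -/
def IsUnitaryDualPair (A B : Type*) [Group A] [Group B] : Prop :=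
  ∃ (a b N : ℕ) (e : A ≃* U F K a) (e' : B ≃* U F K b)
    (j : (Fin N ⊕ Fin N → F) →ₗ[F] Matrix (Fin a) (Fin b) K)
    (ι : A →* symplecticGroup (Fin N) F) (ι' : B →* symplecticGroup (Fin N) F),
    Function.Injective j ∧
    Set.range j = {X | ∀ i k, X i k ^ (Fintype.card F ^ 2) = X i k} ∧
    (∀ g v, j ((ι g).1 *ᵥ v) = (e g).1.1 * j v) ∧
    (∀ h v, j ((ι' h).1 *ᵥ v) = j v * ((e' h).1.1)ᵀ) ∧
    Subgroup.centralizer (ι.range : Set (symplecticGroup (Fin N) F)) = ι'.range ∧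
    Subgroup.centralizer (ι'.range : Set (symplecticGroup (Fin N) F)) = ι.range

end Unitary

/-! ### Centralizers of semisimple elements -/

section Centralizers

variable (F : Type*) [Field F] [Fintype F] {K : Type*} [Field K] [Algebra F K] {n : ℕ}

/-- The set of eigenvalues of `s`. -/
def eigenvalueSet (s : GL (Fin n) K) : Set K :=
  {x | Module.End.HasEigenvalue (Matrix.toLin' s.1) x}

/-- `[x]`: the orbit of `x` under the Frobenius `y ↦ y ^ (-q)` (the action of the unitary Frobenius
on diagonal matrices), intersected with the set of eigenvalues of `s`. -/
def frobClass (s : GL (Fin n) K) (x : K) : Set K :=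
  {y | y ∈ eigenvalueSet s ∧ ∃ i : ℕ, (fun z : K => (z ^ Fintype.card F)⁻¹)^[i] x = y}

/-- For a set `c` of eigenvalues of the semisimple element `s`, the factor of the centralizer of
`s` belonging to `c`: all `g` that commute with `s` and are the identity on the eigenspaces of
`s` for the eigenvalues outside `c`. -/
def centralizerFactor (s : GL (Fin n) K) (c : Set K) : Subgroup (GL (Fin n) K) where
  carrier := {g | g * s = s * g ∧ ∀ x ∉ c, ∀ v : Fin n → K, s.1 *ᵥ v = x • v → g.1 *ᵥ v = v}
  one_mem' := ⟨by simp, fun _ _ _ _ => by simp⟩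
  mul_mem' := by
    rintro g h ⟨hg, hg'⟩ ⟨hh, hh'⟩
    refine ⟨by rw [mul_assoc, hh, ← mul_assoc, hg, mul_assoc], fun x hx v hv => ?_⟩
    rw [Units.val_mul, ← Matrix.mulVec_mulVec, hh' x hx v hv, hg' x hx v hv]
  inv_mem' := by
    rintro g ⟨hg, hg'⟩
    refine ⟨by rw [inv_mul_eq_iff_eq_mul, ← mul_assoc, hg, mul_assoc, mul_inv_cancel, mul_one],
      fun x hx v hv => ?_⟩
    conv_lhs => rw [← hg' x hx v hv]
    rw [Matrix.mulVec_mulVec, Units.inv_mul, Matrix.one_mulVec]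

/-- The index set of `G_#`: the classes `[x]` of the eigenvalues `x ≠ 1` of `s`. -/
abbrev SharpIndex (s : GL (Fin n) K) : Type _ :=
  {c : Set K // ∃ x ∈ eigenvalueSet s, x ≠ 1 ∧ c = frobClass F s x}

/-- The finite group `G_#`: the product of the groups of rational points of the centralizer factors
`G_[x](s)` over the classes `[x]` of the eigenvalues `x ≠ 1` of `s`. -/
abbrev GSharp (s : GL (Fin n) K) : Type _ :=
  (c : SharpIndex F s) → rationalPoints (unitaryFrob F K n) (centralizerFactor s c.1)

/-- The diagonal matrix `(t, 1)` of size `n` for `t = (t₁, …, t_l)`. -/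
def torusElement (n : ℕ) {l : ℕ} (t : Fin l → Kˣ) : GL (Fin n) K :=
  let d : Fin n → Kˣ := fun i => if h : (i : ℕ) < l then t ⟨i, h⟩ else 1
  ⟨Matrix.diagonal fun i => (d i : K), Matrix.diagonal fun i => ((d i)⁻¹ : Kˣ),
    by simp [Matrix.diagonal_mul_diagonal], by simp [Matrix.diagonal_mul_diagonal]⟩

/-- `s` and `s'` are Howe-related: for some `l ≤ min n n'` and some `t = (t₁, …, t_l)` with all
`tᵢ ≠ 1`, the element `s` is conjugate to `(t, 1)` and `s'` is conjugate to `(t, 1)`. -/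
def HoweRelated {n n' : ℕ} (s : GL (Fin n) K) (s' : GL (Fin n') K) : Prop :=
  ∃ (l : ℕ) (t : Fin l → Kˣ), l ≤ min n n' ∧ (∀ i, t i ≠ 1) ∧
    IsConj s (torusElement n t) ∧ IsConj s' (torusElement n' t)

end Centralizers

/-! ### Langlands duality of connected reductive groups with a Frobenius endomorphism -/

section Duality

variable {K : Type*} [Field K] {n n' : ℕ}

/-- `T` is a torus: the image of a homomorphism of algebraic groups `(Kˣ)^r → GL_n`. -/
def IsTorus (T : Subgroup (GL (Fin n) K)) : Prop :=
  ∃ (r k : ℕ) (f : (Fin r → Kˣ) →* GL (Fin n) K)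
    (P : Fin n → Fin n → MvPolynomial (Fin r) K),
    (∀ c i j, (f c).1 i j * (∏ m, (c m : K)) ^ k = MvPolynomial.eval (fun m => (c m : K)) (P i j)) ∧
    f.range = T

/-- `T` is a maximal torus of `H`. -/
def IsMaximalTorus (H T : Subgroup (GL (Fin n) K)) : Prop :=
  T ≤ H ∧ IsTorus T ∧ ∀ S, IsTorus S → S ≤ H → T ≤ S → S = T

/-- The character group `X(T)`: the homomorphisms `T → Kˣ` given by a regular function. -/
def algChar (T : Subgroup (GL (Fin n) K)) : Set (T →* Kˣ) :=
  {χ | ∃ (k : ℕ) (P : MvPolynomial (Fin n × Fin n) K),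
    ∀ t : T, (χ t : K) * t.1.1.det ^ k = MvPolynomial.eval (fun m => t.1.1 m.1 m.2) P}

/-- The cocharacter group `Y(T)`: the homomorphisms of algebraic groups `Kˣ → T`. -/
def algCochar (T : Subgroup (GL (Fin n) K)) : Set (Kˣ →* T) :=
  {γ | ∃ (k : ℕ) (P : Fin n → Fin n → Polynomial K),
    ∀ (c : Kˣ) (i j : Fin n), (γ c).1.1 i j * (c : K) ^ k = (P i j).eval (c : K)}

/-- The matrix `(1 x; 0 1)` in `SL₂`. -/
def upperSL (x : K) : SpecialLinearGroup (Fin 2) K := ⟨!![1, x; 0, 1], by simp⟩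

/-- The matrix `(1 0; x 1)` in `SL₂`. -/
def lowerSL (x : K) : SpecialLinearGroup (Fin 2) K := ⟨!![1, 0; x, 1], by simp⟩

/-- The matrix `diag(c, c⁻¹)` in `SL₂`. -/
def diagSL (c : Kˣ) : SpecialLinearGroup (Fin 2) K :=
  ⟨!![(c : K), 0; 0, ((c⁻¹ : Kˣ) : K)], by simp⟩

/-- `α` is a root of `H` with respect to the maximal torus `T` and `αv` is its coroot: there is a
homomorphism of algebraic groups `φ : SL₂ → H` such that `φ (1 x; 0 1)` and `φ (1 0; x 1)`
parametrize the root subgroups of `α` and `-α`, with nonzero differential, and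
`αv c = φ (diag(c, c⁻¹))`. -/
def IsRootWithCoroot (H T : Subgroup (GL (Fin n) K)) (α : T →* Kˣ) (αv : Kˣ →* T) : Prop :=
  α ∈ algChar T ∧ αv ∈ algCochar T ∧
  ∃ φ : SpecialLinearGroup (Fin 2) K →* GL (Fin n) K,
    (∀ x, φ x ∈ H) ∧
    (∃ P : Fin n → Fin n → MvPolynomial (Fin 2 × Fin 2) K,
      ∀ x i j, (φ x).1 i j = MvPolynomial.eval (fun m => x.1 m.1 m.2) (P i j)) ∧
    (∃ Q : Fin n → Fin n → Polynomial K,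
      (∀ x i j, (φ (upperSL x)).1 i j = (Q i j).eval x) ∧ ∃ i j, (Q i j).coeff 1 ≠ 0) ∧
    (∀ (t : T) (x : K), t.1 * φ (upperSL x) * t.1⁻¹ = φ (upperSL ((α t : K) * x))) ∧
    (∀ (t : T) (x : K), t.1 * φ (lowerSL x) * t.1⁻¹ = φ (lowerSL (((α t)⁻¹ : Kˣ) * x))) ∧
    ∀ c : Kˣ, (αv c).1 = φ (diagSL c)

/-- The connected reductive groups `(H, Fr)` and `(H', Fr')` are Langlands dual: there are Frobenius
stable maximal tori `T` of `H` and `T'` of `H'` and a group isomorphism `δ : X(T) ≃ Y(T')` which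
carries the action of `Fr` to that of `Fr'` and such that `δ` and its transpose `Y(T) ≃ X(T')`
carry the roots and coroots of `(H, T)` to the coroots and roots of `(H', T')`. -/
def IsLanglandsDual (H : Subgroup (GL (Fin n) K)) (Fr : GL (Fin n) K →* GL (Fin n) K)
    (H' : Subgroup (GL (Fin n') K)) (Fr' : GL (Fin n') K →* GL (Fin n') K) : Prop :=
  (∀ g ∈ H, Fr g ∈ H) ∧ (∀ g ∈ H', Fr' g ∈ H') ∧
  ∃ (T : Subgroup (GL (Fin n) K)) (T' : Subgroup (GL (Fin n') K))
    (hT : ∀ t : T, Fr t.1 ∈ T) (_ : ∀ t : T', Fr' t.1 ∈ T') (δ : algChar T ≃ algCochar T'),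
    IsMaximalTorus H T ∧ IsMaximalTorus H' T' ∧
    (∀ χ₁ χ₂ χ₃ : algChar T, χ₃.1 = χ₁.1 * χ₂.1 →
      ∀ c, (δ χ₃).1 c = (δ χ₁).1 c * (δ χ₂).1 c) ∧
    (∀ χ ψ : algChar T, ψ.1 = χ.1.comp ((Fr.comp T.subtype).codRestrict T hT) →
      ∀ c, ((δ ψ).1 c).1 = Fr' ((δ χ).1 c).1) ∧
    (∀ (α : algChar T) (αv : Kˣ →* T), IsRootWithCoroot H T α.1 αv →
      ∃ β : T' →* Kˣ, IsRootWithCoroot H' T' β (δ α).1 ∧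
        ∀ (χ : algChar T) (c : Kˣ), χ.1 (αv c) = β ((δ χ).1 c)) ∧
    (∀ (β : T' →* Kˣ) (βv : algCochar T'), IsRootWithCoroot H' T' β βv.1 →
      ∃ αv : Kˣ →* T, IsRootWithCoroot H T (δ.symm βv).1 αv ∧
        ∀ (χ : algChar T) (c : Kˣ), χ.1 (αv c) = β ((δ χ).1 c))

end Duality

end

end HowePan

/-!
Write `q = |F|`, let `m^*` be the transpose of the matrix obtained from `m` by raising the entries
to the power `q` (`qstar`), so that `U_n(q)` is the group of all `g` with `g^* g = 1`, and let
`s ∼ (t, 1)` and `s' ∼ (t, 1)` with `t = (t₁, …, t_l)`, `tᵢ ≠ 1`. The sizes of the two general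
linear groups in the theorem are `a = n - l` and `b = n' - l`.

The main tool is that semisimple elements of `U_n(q)` that are conjugate in `GL_n(K)` are conjugate
in `U_n(q)` (`exists_mem_U_conj`). They are conjugate over the field of `q²` elements, since a
finite module over a polynomial ring killed by a squarefree polynomial is determined by the sizes of
its torsion submodules (`nonempty_linearEquiv_of_card_torsionBy`). If `h` conjugates `s` into `s'`,
then `z = h^* h` is hermitian and commutes with `s`; it can be written `z = c^* c` with `c`
commuting with everything that commutes with `z` (`exists_qstar_mul_self_eq`), because norms from
the commutative ring generated by `z` are surjective on units (`exists_sq_sub_mul_sq`). Then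
`h c⁻¹` is unitary and still conjugates `s` into `s'`.

For the first assertion, say with `n ≤ n'`, this shows that `s'` is conjugate in `U_{n'}(q)` to
`(s, 1)`, and a centralizer factor for a class not containing `1` does not see the added
eigenvalues `1`. For the other assertions, let `c` be the projection onto the sum of the eigenspaces
of `s` for the eigenvalues `≠ 1`, along the eigenspace for `1`. It is hermitian, because `c` and
`c^*` are both multiples of `s - 1` (`qstar_conj_coordProj`). Applying the main tool to the unitary
reflection `1 - 2c` gives `u ∈ U_n(q)` with `G_[1](s) = u (GL_a, 1) u⁻¹`
(`exists_centralizerFactor_one_eq`).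

The root datum of such a block is computed with respect to its diagonal torus. By the linear
independence of characters, the characters and cocharacters of the torus are the monomials
(`algChar_conjTorus`, `algCochar_conjTorus`). The roots are the `e_i - e_j`
(`isRootWithCoroot_iff`): equivariance under the torus forces the images of the unipotent matrices
of `SL₂` to be transvections, and the relation between the two expressions for the Weyl element
determines the coroot. The root datum is self-dual and Frobenius acts on it by `-q`.

The pair of unitary groups is a dual pair (`isUnitaryDualPair_U`) as the elements of `U_a(q)`
span the matrix algebra over the field of `q²` elements. Here `q` odd gives an element `η` with
`η ^ q = -η` such that `1, η` is a basis of that field over `F`.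
-/

namespace HowePan

open Matrix Polynomial

/-! ### Descent of conjugacy for semisimple matrices -/

section Descent

lemma card_torsionBy_congr {R V V' : Type*} [CommRing R] [AddCommGroup V] [AddCommGroup V']
    [Module R V] [Module R V'] (e : V ≃ₗ[R] V') (f : R) :
    Nat.card (Submodule.torsionBy R V f) = Nat.card (Submodule.torsionBy R V' f) := by
  refine Nat.card_congr (e.toEquiv.subtypeEquiv fun v => ?_)
  simp only [Submodule.mem_torsionBy_iff, LinearEquiv.coe_toEquiv]
  rw [← map_smul, LinearEquiv.map_eq_zero_iff]

lemma card_torsionBy_prod {R V V' : Type*} [CommRing R] [AddCommGroup V] [AddCommGroup V']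
    [Module R V] [Module R V'] (f : R) :
    Nat.card (Submodule.torsionBy R (V × V') f) =
      Nat.card (Submodule.torsionBy R V f) * Nat.card (Submodule.torsionBy R V' f) := by
  rw [← Nat.card_prod]
  refine Nat.card_congr ⟨fun v => (⟨v.1.1, ?_⟩, ⟨v.1.2, ?_⟩), fun v => ⟨(v.1.1, v.2.1), ?_⟩,
    fun _ => rfl, fun _ => rfl⟩
  · have := v.2
    simp only [Submodule.mem_torsionBy_iff, Prod.ext_iff] at this
    exact this.1
  · have := v.2
    simp only [Submodule.mem_torsionBy_iff, Prod.ext_iff] at this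
    exact this.2
  · have h1 := v.1.2
    have h2 := v.2.2
    simp only [Submodule.mem_torsionBy_iff, Prod.ext_iff] at *
    exact ⟨h1, h2⟩

/-- A finite semisimple module over a principal ideal ring is determined by the sizes of its
torsion submodules: a simple submodule of one module also embeds in the other, and the
complements have torsion submodules of the same sizes. -/
theorem nonempty_linearEquiv_of_card_torsionBy {R : Type*} [CommRing R] [IsPrincipalIdealRing R]
    (k : ℕ) : ∀ {V V' : Type*} [AddCommGroup V] [AddCommGroup V'] [Module R V] [Module R V']
    [Finite V] [Finite V'] [IsSemisimpleModule R V] [IsSemisimpleModule R V'],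
    Nat.card V = k →
    (∀ f : R, Nat.card (Submodule.torsionBy R V f) = Nat.card (Submodule.torsionBy R V' f)) →
    Nonempty (V ≃ₗ[R] V') := by
  induction k using Nat.strong_induction_on with
  | _ k ih =>
    intro V V' _ _ _ _ _ _ _ _ hk h
    rcases subsingleton_or_nontrivial V with hV | hV
    · have h0 := h 0
      have e1 : Submodule.torsionBy R V (0 : R) = ⊤ := by ext; simp
      have e2 : Submodule.torsionBy R V' (0 : R) = ⊤ := by ext; simp
      rw [e1, e2, Nat.card_congr (Submodule.topEquiv (R := R) (M := V)).toEquiv,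
        Nat.card_congr (Submodule.topEquiv (R := R) (M := V')).toEquiv, Nat.card_unique,
        eq_comm, Nat.card_eq_one_iff_unique] at h0
      have := h0.1
      exact ⟨⟨⟨⟨fun _ => 0, fun _ _ => Subsingleton.elim _ _⟩, fun _ _ => Subsingleton.elim _ _⟩,
        fun _ => 0, fun _ => Subsingleton.elim _ _, fun _ => Subsingleton.elim _ _⟩⟩
    · obtain ⟨S, hS⟩ := IsSemisimpleModule.exists_simple_submodule R V
      have := IsSimpleModule.nontrivial R S
      obtain ⟨⟨w, hwS⟩, hw⟩ := exists_ne (0 : S)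
      have hw0 : w ≠ 0 := fun h0 => hw (Subtype.ext h0)
      -- `S` is `R ⧸ (f)` for a maximal ideal `(f)`, and `V'` also has nonzero `f`-torsion
      have hker : LinearMap.ker (LinearMap.toSpanSingleton R V w) =
          LinearMap.ker (LinearMap.toSpanSingleton R S ⟨w, hwS⟩) := by
        ext r
        simp [LinearMap.mem_ker, LinearMap.toSpanSingleton_apply, Subtype.ext_iff]
      have hmax : Ideal.IsMaximal (LinearMap.ker (LinearMap.toSpanSingleton R V w)) := by
        rw [hker]; exact IsSimpleModule.ker_toSpanSingleton_isMaximal R hw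
      obtain ⟨f, hf⟩ := IsPrincipalIdealRing.principal
        (LinearMap.ker (LinearMap.toSpanSingleton R V w))
      have hfw : f • w = 0 := by
        have : f ∈ LinearMap.ker (LinearMap.toSpanSingleton R V w) := by
          rw [hf]; exact Submodule.mem_span_singleton_self f
        simpa using this
      obtain ⟨w', hw'0, hfw'⟩ : ∃ w' : V', w' ≠ 0 ∧ f • w' = 0 := by
        have h1 : 1 < Nat.card (Submodule.torsionBy R V f) := by
          rw [Finite.one_lt_card_iff_nontrivial]
          exact ⟨⟨w, by simpa using hfw⟩, 0, fun h0 => hw0 (congrArg Subtype.val h0)⟩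
        rw [h f, Finite.one_lt_card_iff_nontrivial] at h1
        obtain ⟨⟨w', hw'⟩, hne⟩ := exists_ne (0 : Submodule.torsionBy R V' f)
        exact ⟨w', fun h0 => hne (Subtype.ext h0), by simpa using hw'⟩
      have hker' : LinearMap.ker (LinearMap.toSpanSingleton R V w) =
          LinearMap.ker (LinearMap.toSpanSingleton R V' w') := by
        refine hmax.eq_of_le ?_ ?_
        · rw [Ne, Ideal.eq_top_iff_one]; simpa using hw'0
        · rw [hf, Submodule.span_singleton_le_iff_mem]; simpa using hfw'
      let p := LinearMap.range (LinearMap.toSpanSingleton R V w)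
      let p' := LinearMap.range (LinearMap.toSpanSingleton R V' w')
      let e : p ≃ₗ[R] p' := (LinearMap.quotKerEquivRange _).symm.trans
        ((Submodule.quotEquivOfEq _ _ hker').trans (LinearMap.quotKerEquivRange _))
      obtain ⟨C, hC⟩ := exists_isCompl p
      obtain ⟨C', hC'⟩ := exists_isCompl p'
      let a := Submodule.prodEquivOfIsCompl p C hC
      let a' := Submodule.prodEquivOfIsCompl p' C' hC'
      have hcard : Nat.card C < k := by
        rw [← hk, ← Nat.card_congr a.toEquiv, Nat.card_prod]
        have hp : 1 < Nat.card p := by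
          rw [Finite.one_lt_card_iff_nontrivial]
          exact ⟨⟨w, 1, by simp⟩, 0, fun h0 => hw0 (congrArg Subtype.val h0)⟩
        have hc : 0 < Nat.card C := Nat.card_pos
        nlinarith
      obtain ⟨e'⟩ := ih _ hcard (V := C) (V' := C') rfl fun g => by
        have h1 := h g
        rw [← card_torsionBy_congr a, ← card_torsionBy_congr a', card_torsionBy_prod,
          card_torsionBy_prod, card_torsionBy_congr e] at h1
        exact Nat.eq_of_mul_eq_mul_left Nat.card_pos h1
      exact ⟨a.symm.trans ((LinearEquiv.prodCongr e e').trans a')⟩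

/-- The rank of a matrix does not change under an extension of fields. -/
lemma rank_map_algebraMap {E K : Type*} [Field E] [Field K] [Algebra E K] {n : ℕ}
    (M : Matrix (Fin n) (Fin n) E) : (M.map (algebraMap E K)).rank = M.rank := by
  obtain ⟨V, U, e, hV, hU, h⟩ := exists_rank_normal_form M
  have h' : V.map (algebraMap E K) * M.map (algebraMap E K) * U.map (algebraMap E K) =
      (fromBlocks 1 0 0 0).submatrix e e := by
    rw [← Matrix.map_mul, ← Matrix.map_mul, h, ← submatrix_map, fromBlocks_map]
    simp
  have hV' : IsUnit (V.map (algebraMap E K)).det :=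
    (isUnit_iff_isUnit_det _).1 (hV.map (algebraMap E K).mapMatrix)
  have hU' : IsUnit (U.map (algebraMap E K)).det :=
    (isUnit_iff_isUnit_det _).1 (hU.map (algebraMap E K).mapMatrix)
  rw [← rank_mul_eq_left_of_isUnit_det _ _ hU', ← rank_mul_eq_right_of_isUnit_det _ _ hV',
    ← mul_assoc, h', rank_submatrix]
  have hd : (fromBlocks 1 0 0 0 : Matrix (Fin M.rank ⊕ Fin (Fintype.card (Fin n) - M.rank)) _ K) =
      diagonal (Sum.elim (fun _ => 1) (fun _ => 0)) := by
    rw [← diagonal_one, ← diagonal_zero, fromBlocks_diagonal]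
  classical
  rw [hd, rank_diagonal, Fintype.card_subtype, Finset.card_filter, Fintype.sum_sum_type]
  simp

/-- On the module defined by a matrix `s`, the `f`-torsion is the kernel of `f(s)`. -/
lemma card_torsionBy_AEval {E : Type*} [Field E] [Finite E] {n : ℕ}
    (s : Matrix (Fin n) (Fin n) E) (f : E[X]) :
    Nat.card (Submodule.torsionBy E[X] (Module.AEval' (toLin' s)) f) =
      Nat.card E ^ (n - (aeval s f).rank) := by
  have h1 : Nat.card (Submodule.torsionBy E[X] (Module.AEval' (toLin' s)) f) =
      Nat.card (LinearMap.ker (mulVecLin (aeval s f))) := by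
    refine (Nat.card_congr ((Module.AEval'.of (toLin' s)).toEquiv.subtypeEquiv fun v => ?_)).symm
    have h2 : aeval (toLin' s) f = toLin' (aeval s f) :=
      aeval_algHom_apply (toLinAlgEquiv' (R := E) (n := Fin n)).toAlgHom s f
    rw [LinearEquiv.coe_toEquiv, Submodule.mem_torsionBy_iff, Module.AEval'.of,
      ← Module.AEval.of_aeval_smul, LinearEquiv.map_eq_zero_iff, h2]
    rfl
  rw [h1, Module.natCard_eq_pow_finrank (K := E)]
  congr 1
  have := LinearMap.finrank_range_add_finrank_ker (mulVecLin (aeval s f))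
  rw [Module.finrank_fin_fun] at this
  rw [Matrix.rank]
  omega

/-- Two matrices over a finite field which are killed by a squarefree polynomial and become
conjugate over a larger field are conjugate. -/
theorem exists_conj_of_conj_map {E K : Type*} [Field E] [Finite E] [Field K] [Algebra E K] {n : ℕ}
    {s s' : Matrix (Fin n) (Fin n) E} {f : E[X]} (hf : Squarefree f) (hs : aeval s f = 0)
    (hs' : aeval s' f = 0) (g : GL (Fin n) K)
    (hg : g.1 * s.map (algebraMap E K) = s'.map (algebraMap E K) * g.1) :
    ∃ h : GL (Fin n) E, h.1 * s = s' * h.1 := by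
  -- the ranks of polynomials in the matrices do not depend on the field and determine the torsion
  have hrank (p : E[X]) : (aeval s p).rank = (aeval s' p).rank := by
    rw [← rank_map_algebraMap (K := K), ← rank_map_algebraMap (K := K) (aeval s' p)]
    have key (t : Matrix (Fin n) (Fin n) E) : (aeval t p).map (algebraMap E K) =
        aeval (t.map (algebraMap E K)) p :=
      (aeval_algHom_apply (Algebra.ofId E K).mapMatrix t p).symm
    have hc : SemiconjBy g.1 (s.map (algebraMap E K)) (s'.map (algebraMap E K)) := hg
    rw [key, key]
    clear key
    have hp : g.1 * aeval (s.map (algebraMap E K)) p =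
        aeval (s'.map (algebraMap E K)) p * g.1 := by
      induction p using Polynomial.induction_on' with
      | add p q h1 h2 => rw [map_add, map_add, mul_add, add_mul, h1, h2]
      | monomial k c =>
        rw [aeval_monomial, aeval_monomial, ← mul_assoc, ← Algebra.commutes c g.1, mul_assoc,
          (hc.pow_right k).eq, mul_assoc]
    have hgd : IsUnit g.1.det := (isUnit_iff_isUnit_det _).1 g.isUnit
    rw [← rank_mul_eq_right_of_isUnit_det _ _ hgd, hp, rank_mul_eq_left_of_isUnit_det _ _ hgd]
  have hss (t : Matrix (Fin n) (Fin n) E) (ht : aeval t f = 0) :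
      IsSemisimpleModule E[X] (Module.AEval' (toLin' t)) := by
    refine Module.End.isSemisimple_of_squarefree_aeval_eq_zero hf ?_
    have h2 : aeval (toLin' t) f = toLin' (aeval t f) :=
      aeval_algHom_apply (toLinAlgEquiv' (R := E) (n := Fin n)).toAlgHom t f
    rw [h2, ht, map_zero]
  have := hss s hs
  have := hss s' hs'
  have : Finite (Module.AEval' (toLin' s)) := .of_equiv _ (Module.AEval'.of (toLin' s)).toEquiv
  have : Finite (Module.AEval' (toLin' s')) := .of_equiv _ (Module.AEval'.of (toLin' s')).toEquiv
  obtain ⟨e⟩ := nonempty_linearEquiv_of_card_torsionBy (R := E[X]) _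
    (V := Module.AEval' (toLin' s)) (V' := Module.AEval' (toLin' s')) rfl
    fun p => by rw [card_torsionBy_AEval, card_torsionBy_AEval, hrank]
  let e' : (Fin n → E) ≃ₗ[E] (Fin n → E) := (Module.AEval'.of (toLin' s)).trans
    ((e.restrictScalars E).trans (Module.AEval'.of (toLin' s')).symm)
  have he' (v : Fin n → E) : e' (s *ᵥ v) = s' *ᵥ e' v := by
    apply (Module.AEval'.of (toLin' s')).injective
    have h1 := Module.AEval'.X_smul_of (toLin' s) v
    have h2 := Module.AEval'.X_smul_of (toLin' s') (e' v)
    rw [toLin'_apply] at h1 h2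
    rw [← h2]
    change e _ = X • e _
    rw [← map_smul]
    exact congrArg e h1.symm
  refine ⟨GeneralLinearGroup.toLin.symm (LinearMap.GeneralLinearGroup.ofLinearEquiv e'), ?_⟩
  have h3 : (GeneralLinearGroup.toLin.symm (LinearMap.GeneralLinearGroup.ofLinearEquiv e')).1 =
    LinearMap.toMatrix' e'.toLinearMap := rfl
  rw [h3]
  apply toLin'.injective
  rw [toLin'_mul, toLin'_mul, toLin'_toMatrix']
  exact LinearMap.ext he'

end Descent

/-! ### Norms and hermitian matrices -/

section Norm

lemma exists_sq_eq_of_isNilpotent_sub_one {B : Type*} [CommRing B] (p : ℕ) [Fact p.Prime]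
    [CharP B p] (hp : Odd p) {w : B} (hw : IsNilpotent (w - 1)) : ∃ r, r ^ 2 = w ∧ IsUnit r := by
  obtain ⟨k, hk⟩ := hw
  have h1 : w ^ p ^ k = 1 := by
    have h2 : (w - 1) ^ p ^ k = 0 :=
      pow_eq_zero_of_le (Nat.lt_pow_self (Fact.out (p := p.Prime)).one_lt).le hk
    rw [sub_pow_char_pow, one_pow, sub_eq_zero] at h2
    exact h2
  -- `w` has odd order, so a power of `w` is a square root of `w`
  obtain ⟨m, hm⟩ := hp.pow (n := k)
  have hwu : IsUnit w := IsUnit.of_pow_eq_one h1 (pow_ne_zero _ (Fact.out (p := p.Prime)).ne_zero)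
  refine ⟨w ^ (m + 1), ?_, hwu.pow _⟩
  rw [← pow_mul, show (m + 1) * 2 = (2 * m + 1) + 1 by ring, ← hm, pow_succ, h1, one_mul]

/-- In a finite commutative ring of odd characteristic every unit is a value of the form
`x² - d y²` for `d` a unit. Modulo the nilradical the ring is a product of finite fields; the error
is a unipotent unit, hence a square. -/
theorem exists_sq_sub_mul_sq {B : Type*} [CommRing B] [Finite B] (p : ℕ) [Fact p.Prime]
    [CharP B p] (hp : Odd p) {b d : B} (hb : IsUnit b) (hd : IsUnit d) :
    ∃ x y : B, x ^ 2 - d * y ^ 2 = b := by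
  have hfield (I : MaximalSpectrum B) : ∃ xy : B × B,
      xy.1 ^ 2 - d * xy.2 ^ 2 - b ∈ I.asIdeal := by
    have := I.2
    let k := B ⧸ I.asIdeal
    let _ : Field k := Ideal.Quotient.field I.asIdeal
    have : CharP k p := by
      refine (CharP.charP_iff_prime_eq_zero Fact.out).2 ?_
      rw [← map_natCast (Ideal.Quotient.mk I.asIdeal), CharP.cast_eq_zero, map_zero]
    have : Finite k := Finite.of_surjective _ Ideal.Quotient.mk_surjective
    let _ : Fintype k := Fintype.ofFinite k
    have hcard : Fintype.card k % 2 = 1 := by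
      refine FiniteField.odd_card_of_char_ne_two ?_
      rw [ringChar.eq k p]
      rintro rfl
      exact absurd hp (by decide)
    have hd0 : Ideal.Quotient.mk I.asIdeal d ≠ 0 := (hd.map (Ideal.Quotient.mk I.asIdeal)).ne_zero
    obtain ⟨x, y, hxy⟩ := FiniteField.exists_root_sum_quadratic (R := k)
      (f := X ^ 2 - C (Ideal.Quotient.mk I.asIdeal b))
      (g := C (-Ideal.Quotient.mk I.asIdeal d) * X ^ 2)
      (degree_X_pow_sub_C (by norm_num) _)
      (degree_C_mul_X_pow 2 (neg_ne_zero.2 hd0)) hcard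
    obtain ⟨x, rfl⟩ := Ideal.Quotient.mk_surjective x
    obtain ⟨y, rfl⟩ := Ideal.Quotient.mk_surjective y
    refine ⟨(x, y), ?_⟩
    rw [← Ideal.Quotient.eq_zero_iff_mem, ← hxy]
    simp
    ring
  choose xy hxy using hfield
  -- glue the solutions by the Chinese remainder theorem
  have hcop : Pairwise fun I J : MaximalSpectrum B => IsCoprime I.asIdeal J.asIdeal := by
    intro I J hIJ
    exact Ideal.isCoprime_of_isMaximal (fun h => hIJ (MaximalSpectrum.ext h))
  have : Finite (MaximalSpectrum B) := inferInstance
  obtain ⟨x, hx⟩ := Ideal.exists_forall_sub_mem_ideal hcop (fun I => (xy I).1)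
  obtain ⟨y, hy⟩ := Ideal.exists_forall_sub_mem_ideal hcop (fun I => (xy I).2)
  have hmem (I : MaximalSpectrum B) : x ^ 2 - d * y ^ 2 - b ∈ I.asIdeal := by
    have h1 := hx I
    have h2 := hy I
    have h3 : x ^ 2 - d * y ^ 2 - b = (x + (xy I).1) * (x - (xy I).1)
        - d * (y + (xy I).2) * (y - (xy I).2) + ((xy I).1 ^ 2 - d * (xy I).2 ^ 2 - b) := by ring
    rw [h3]
    exact add_mem (sub_mem (Ideal.mul_mem_left _ _ h1) (Ideal.mul_mem_left _ _ h2)) (hxy I)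
  have hnil : IsNilpotent (x ^ 2 - d * y ^ 2 - b) := by
    rw [← mem_nilradical, nilradical_eq_sInf, Ideal.mem_sInf]
    intro J (hJ : J.IsPrime)
    exact hmem ⟨J, Ideal.isMaximal_of_isPrime J⟩
  obtain ⟨u, rfl⟩ := hb
  have hw : IsNilpotent ((u⁻¹ : Bˣ) * (x ^ 2 - d * y ^ 2) - 1) := by
    have : ((u⁻¹ : Bˣ) * (x ^ 2 - d * y ^ 2) - 1 : B) = (u⁻¹ : Bˣ) * (x ^ 2 - d * y ^ 2 - u) := by
      rw [mul_sub _ _ (u : B), Units.inv_mul]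
    rw [this]
    exact (Commute.all _ _).isNilpotent_mul_left hnil
  obtain ⟨r, hr, v, rfl⟩ := exists_sq_eq_of_isNilpotent_sub_one p hp hw
  refine ⟨(v⁻¹ : Bˣ) * x, (v⁻¹ : Bˣ) * y, ?_⟩
  have h4 : x ^ 2 - d * y ^ 2 = u * (v : B) ^ 2 := by rw [hr, Units.mul_inv_cancel_left]
  calc ((v⁻¹ : Bˣ) * x) ^ 2 - d * ((v⁻¹ : Bˣ) * y) ^ 2
      = ((v⁻¹ : Bˣ) : B) ^ 2 * (x ^ 2 - d * y ^ 2) := by ring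
    _ = u * (((v⁻¹ : Bˣ) : B) * v) ^ 2 := by rw [h4]; ring
    _ = u := by rw [Units.inv_mul]; ring

end Norm

section QStar

variable (F : Type*) [Field F] [Fintype F] {K : Type*} [Field K] [Algebra F K]

/-- The semilinear adjoint `((mᵢⱼ) ^ q)ᵀ` of a matrix `m`. It reverses products, and applying it
twice raises the entries to the power `q²`. -/
def qstar {ι κ : Type*} (m : Matrix ι κ K) : Matrix κ ι K :=
  (m.map (FiniteField.frobeniusAlgHom F K))ᵀ

variable {F} {ι κ μ : Type*}

@[simp] lemma qstar_apply (m : Matrix ι κ K) (i : κ) (j : ι) :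
    qstar F m i j = m j i ^ Fintype.card F := rfl

lemma qstar_mul [Fintype κ] (m : Matrix ι κ K) (m' : Matrix κ μ K) :
    qstar F (m * m') = qstar F m' * qstar F m := by
  rw [qstar, qstar, qstar, ← transpose_mul]
  congr 1
  exact Matrix.map_mul (f := (FiniteField.frobeniusAlgHom F K : K →+* K))

@[simp] lemma qstar_one [DecidableEq ι] : qstar F (1 : Matrix ι ι K) = 1 := by
  rw [qstar, Matrix.map_one _ (map_zero _) (map_one _), transpose_one]

lemma qstar_add (m m' : Matrix ι κ K) : qstar F (m + m') = qstar F m + qstar F m' := by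
  ext i j
  exact map_add (FiniteField.frobeniusAlgHom F K) _ _

lemma qstar_sub (m m' : Matrix ι κ K) : qstar F (m - m') = qstar F m - qstar F m' := by
  ext i j
  exact map_sub (FiniteField.frobeniusAlgHom F K) _ _

lemma qstar_smul (c : K) (m : Matrix ι κ K) :
    qstar F (c • m) = c ^ Fintype.card F • qstar F m := by
  ext i j
  simp [mul_pow]

variable {n : ℕ}

lemma mem_U_iff {g : GL (Fin n) K} : g ∈ U F K n ↔ qstar F g.1 * g.1 = 1 := by
  have h1 : g ∈ U F K n ↔ unitaryFrob F K n g = g := ⟨fun h => h.2, fun h => ⟨trivial, h⟩⟩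
  have h2 : ((unitaryFrob F K n g)⁻¹ : GL (Fin n) K).1 = qstar F g.1 := rfl
  rw [h1, ← _root_.inv_inj, Units.ext_iff, h2]
  constructor
  · intro h; rw [h, Units.inv_mul]
  · intro h; rw [← Units.mul_left_inj g, h, Units.inv_mul]

lemma qstar_eq_inv {g : GL (Fin n) K} (hg : g ∈ U F K n) :
    qstar F g.1 = (g⁻¹ : GL (Fin n) K).1 := by
  rw [← Units.mul_left_inj g, mem_U_iff.1 hg, Units.inv_mul]

end QStar

/-! ### Conjugacy in the finite unitary groups -/

section Conjugacy

variable {F : Type*} [Field F] [Fintype F] {K : Type*} [Field K] [Algebra F K]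

lemma exists_algebraMap_eq_of_pow_card_eq {x : K} (hx : x ^ Fintype.card F = x) :
    ∃ y : F, algebraMap F K y = x := by
  have h0 : (X ^ Fintype.card F - X : F[X]) ≠ 0 :=
    FiniteField.X_pow_card_sub_X_ne_zero F Fintype.one_lt_card
  have hs : (X ^ Fintype.card F - X : F[X]).Splits := by
    rw [splits_iff_card_roots, FiniteField.roots_X_pow_card_sub_X,
      FiniteField.X_pow_card_sub_X_natDegree_eq F Fintype.one_lt_card]
    rfl
  have h1 : x ∈ ((X ^ Fintype.card F - X : F[X]).map (algebraMap F K)).roots := by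
    rw [mem_roots (Polynomial.map_ne_zero h0)]
    simp [hx]
  rw [hs.roots_map, Multiset.mem_map] at h1
  obtain ⟨y, -, hy⟩ := h1
  exact ⟨y, hy⟩

lemma two_ne_zero_of_odd_card (hq : Odd (Fintype.card F)) : (2 : K) ≠ 0 := by
  have h2 : (2 : F) ≠ 0 := by
    intro h
    have h3 := FiniteField.cast_card_eq_zero F
    obtain ⟨m, hm⟩ := hq
    rw [hm] at h3
    push_cast at h3
    rw [h, zero_mul, zero_add] at h3
    exact one_ne_zero h3
  have := (map_ne_zero (algebraMap F K)).2 h2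
  rwa [map_ofNat] at this

lemma exists_pow_card_eq_neg (F K : Type*) [Field F] [Fintype F] [Field K] [IsAlgClosed K] :
    ∃ η : K, η ≠ 0 ∧ η ^ Fintype.card F = -η := by
  have h1 := Fintype.one_lt_card (α := F)
  obtain ⟨η, hη⟩ := IsAlgClosed.exists_pow_nat_eq (-1 : K) (n := Fintype.card F - 1) (by omega)
  refine ⟨η, ?_, ?_⟩
  · rintro rfl
    rw [zero_pow (by omega)] at hη
    exact one_ne_zero (neg_eq_zero.1 hη.symm)
  · rw [show Fintype.card F = (Fintype.card F - 1) + 1 by omega, pow_succ, hη, neg_one_mul]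

lemma finite_pow_eq_self {m : ℕ} (hm : 1 < m) : {x : K | x ^ m = x}.Finite := by
  classical
  refine ((X ^ m - X : K[X]).roots.toFinset.finite_toSet).subset fun x hx => ?_
  have h0 : (X ^ m - X : K[X]) ≠ 0 := FiniteField.X_pow_card_sub_X_ne_zero K hm
  simpa [mem_roots h0, sub_eq_zero] using hx

lemma one_lt_card_sq : 1 < Fintype.card F ^ 2 :=
  Nat.one_lt_pow (by norm_num) Fintype.one_lt_card

lemma pow_card_sq {F K : Type*} [Fintype F] [Field K] (x : K) :
    (x ^ Fintype.card F) ^ Fintype.card F = x ^ (Fintype.card F ^ 2) := by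
  rw [← pow_mul, sq]

lemma finite_setOf_qstar_eq_self (n : ℕ) :
    {m : Matrix (Fin n) (Fin n) K | qstar F m = m}.Finite := by
  have h1 := Set.Finite.pi' fun _ : Fin n => Set.Finite.pi' fun _ : Fin n =>
    finite_pow_eq_self (K := K) (one_lt_card_sq (F := F))
  refine h1.subset fun m hm i j => ?_
  have h2 : qstar F (qstar F m) = m := by rw [show qstar F m = m from hm, show qstar F m = m from hm]
  change m i j ^ _ = m i j
  rw [← pow_card_sq]
  exact congrFun (congrFun h2 i) j

/-- A nondegenerate hermitian matrix `z` is `c^* c` for a matrix `c` which commutes with the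
centralizer of `z`: the matrix `c = x + η y` is found in the algebra generated by `z`, where the
equation becomes `x² - η² y² = z`. -/
theorem exists_qstar_mul_self_eq [IsAlgClosed K] (hq : Odd (Fintype.card F)) {n : ℕ}
    (z : GL (Fin n) K) (hz : qstar F z.1 = z.1) :
    ∃ c : GL (Fin n) K, qstar F c.1 * c.1 = z.1 ∧
      ∀ s : Matrix (Fin n) (Fin n) K, Commute s z.1 → Commute s c.1 := by
  rcases Nat.eq_zero_or_pos n with rfl | hn
  · exact ⟨1, Subsingleton.elim _ _, fun _ _ => Commute.one_right _⟩
  have : Nonempty (Fin n) := ⟨⟨0, hn⟩⟩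
  obtain ⟨η, hη0, hη⟩ := exists_pow_card_eq_neg F K
  obtain ⟨d, hd⟩ : ∃ d : F, algebraMap F K d = η ^ 2 :=
    exists_algebraMap_eq_of_pow_card_eq (by rw [← pow_mul, mul_comm, pow_mul, hη, neg_sq])
  have hd0 : d ≠ 0 := by
    rintro rfl
    rw [map_zero] at hd
    exact hη0 (pow_eq_zero_iff two_ne_zero |>.1 hd.symm)
  -- a finite commutative ring of hermitian matrices, in which `z` is a unit
  let B := Algebra.adjoin F {z.1}
  have : IsMulCommutative B := Algebra.isMulCommutative_adjoin F (by simp)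
  have hstar (m : Matrix (Fin n) (Fin n) K) (hm : m ∈ B) : qstar F m = m := by
    induction hm using Algebra.adjoin_induction with
    | mem x hx => rw [Set.mem_singleton_iff.1 hx, hz]
    | algebraMap r =>
      ext i j
      rw [qstar_apply, algebraMap_matrix_apply, algebraMap_matrix_apply]
      by_cases hij : i = j
      · simp [hij, ← map_pow, FiniteField.pow_card]
      · simp [hij, Ne.symm hij, Fintype.card_ne_zero]
    | add x y _ _ hx hy => rw [qstar_add, hx, hy]
    | mul x y hx' hy' hx hy =>
      rw [qstar_mul, hx, hy]
      exact congrArg Subtype.val (mul_comm (⟨y, hy'⟩ : B) ⟨x, hx'⟩)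
  have : Finite B := ((finite_setOf_qstar_eq_self (F := F) (K := K) n).subset hstar).to_subtype
  have hzu : IsUnit (⟨z.1, Algebra.self_mem_adjoin_singleton F z.1⟩ : B) := by
    refine IsArtinianRing.isUnit_of_mem_nonZeroDivisors (mem_nonZeroDivisors_iff_right.2 ?_)
    intro x hx
    have h1 : x.1 * z.1 = 0 := congrArg Subtype.val hx
    exact Subtype.ext ((Units.mul_left_eq_zero z).1 h1)
  obtain ⟨p, hp⟩ := CharP.exists F
  have hpp : Fact p.Prime := ⟨CharP.char_is_prime F p⟩
  have hinj : Function.Injective (algebraMap F B) := (algebraMap F B).injective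
  have : CharP B p := charP_of_injective_algebraMap hinj p
  have hpo : Odd p := by
    obtain ⟨k, -, hk⟩ := FiniteField.card F p
    rw [hk] at hq
    exact (Nat.odd_pow_iff k.ne_zero).1 hq
  obtain ⟨x, y, hxy⟩ := exists_sq_sub_mul_sq p hpo hzu
    ((isUnit_iff_ne_zero.2 hd0).map (algebraMap F B))
  have hcomm (x y : B) : x.1 * y.1 = y.1 * x.1 := congrArg Subtype.val (mul_comm x y)
  let c : Matrix (Fin n) (Fin n) K := x.1 + η • y.1
  have hc : qstar F c * c = z.1 := by
    have h1 : x.1 ^ 2 - algebraMap F (Matrix (Fin n) (Fin n) K) d * y.1 ^ 2 = z.1 :=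
      congrArg Subtype.val hxy
    have h2 : algebraMap F (Matrix (Fin n) (Fin n) K) d * y.1 ^ 2 = η ^ 2 • y.1 ^ 2 := by
      rw [← hd, algebraMap_smul, Algebra.smul_def]
    rw [← h1, h2, qstar_add, qstar_smul, hstar _ x.2, hstar _ y.2, hη, add_mul, mul_add, mul_add,
      smul_mul_smul_comm, neg_mul, smul_mul_assoc, mul_smul_comm, hcomm y x, neg_smul, neg_smul,
      sq, sq, sq]
    abel
  have hcu : IsUnit c.det := by
    have h1 : IsUnit (qstar F c * c).det := by rw [hc]; exact (isUnit_iff_isUnit_det _).1 z.isUnit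
    rw [det_mul] at h1
    exact isUnit_of_mul_isUnit_right h1
  refine ⟨GeneralLinearGroup.mk'' c hcu, hc, fun s hs => ?_⟩
  have hB (m : Matrix (Fin n) (Fin n) K) (hm : m ∈ B) : Commute s m := by
    induction hm using Algebra.adjoin_induction with
    | mem x hx => rwa [Set.mem_singleton_iff.1 hx]
    | algebraMap r => exact (Algebra.commutes r s).symm
    | add x y _ _ hx hy => exact hx.add_right hy
    | mul x y _ _ hx hy => exact hx.mul_right hy
  exact (hB _ x.2).add_right ((hB _ y.2).smul_right η)

/-- Unitary elements that are conjugate in `GL_n` and are killed by a separable polynomial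
`X ^ N - X` are conjugate in the finite unitary group. -/
theorem exists_mem_U_conj [IsAlgClosed K] (hq : Odd (Fintype.card F)) {n : ℕ}
    {s s' : GL (Fin n) K} (hs : s ∈ U F K n) (hs' : s' ∈ U F K n) (hconj : IsConj s s')
    {N : ℕ} (hN : (N : K) = 0) (hsN : s.1 ^ N = s.1) :
    ∃ u ∈ U F K n, u * s = s' * u := by
  let E : Subfield K :=
    { carrier := {x | x ^ (Fintype.card F ^ 2) = x}
      mul_mem' := fun {x y} (hx : _ = _) (hy : _ = _) => by
        change _ = _; rw [mul_pow, hx, hy]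
      one_mem' := one_pow _
      add_mem' := fun {x y} (hx : _ = _) (hy : _ = _) => by
        change _ = _
        rw [← pow_card_sq] at hx hy ⊢
        have h1 (a b : K) : (a + b) ^ Fintype.card F = a ^ Fintype.card F + b ^ Fintype.card F :=
          map_add (FiniteField.frobeniusAlgHom F K) a b
        rw [h1, h1, hx, hy]
      zero_mem' := zero_pow (by have := one_lt_card_sq (F := F); omega)
      neg_mem' := fun {x} (hx : _ = _) => by
        change _ = _
        rw [← pow_card_sq] at hx ⊢
        have h1 (a : K) : (-a) ^ Fintype.card F = -a ^ Fintype.card F :=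
          map_neg (FiniteField.frobeniusAlgHom F K) a
        rw [h1, h1, hx]
      inv_mem' := fun x (hx : _ = _) => by
        change _ = _; rw [inv_pow, hx] }
  have hfin : Finite E := (finite_pow_eq_self (K := K) (one_lt_card_sq (F := F))).to_subtype
  -- a unitary matrix has its entries in the field with `q²` elements
  have hentry {g : GL (Fin n) K} (hg : g ∈ U F K n) (i j : Fin n) : g.1 i j ∈ E := by
    have h1 : qstar F (qstar F g.1) = g.1 := by
      rw [qstar_eq_inv hg, qstar_eq_inv ((U F K n).inv_mem hg), inv_inv]
    change _ = _
    rw [← pow_card_sq]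
    exact congrFun (congrFun h1 i) j
  let t : Matrix (Fin n) (Fin n) E := fun i j => ⟨s.1 i j, hentry hs i j⟩
  let t' : Matrix (Fin n) (Fin n) E := fun i j => ⟨s'.1 i j, hentry hs' i j⟩
  have ht : t.map (algebraMap E K) = s.1 := rfl
  have ht' : t'.map (algebraMap E K) = s'.1 := rfl
  obtain ⟨g, hg⟩ := isConj_iff.1 hconj
  have hg' : g * s = s' * g := by rw [← hg]; group
  have hzero {r : Matrix (Fin n) (Fin n) E} {r' : Matrix (Fin n) (Fin n) K}
      (hr : r.map (algebraMap E K) = r') (hr' : r' ^ N = r') :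
      aeval r (X ^ N - X : E[X]) = 0 := by
    apply map_injective (algebraMap E K).injective
    change (algebraMap E K).mapMatrix _ = (algebraMap E K).mapMatrix _
    have h1 : (algebraMap E K).mapMatrix r = r' := hr
    rw [map_sub, map_pow, aeval_X, map_sub, map_pow, h1, hr', sub_self, map_zero]
  have hs'N : s'.1 ^ N = s'.1 := by
    have h1 : s ^ N = s := Units.ext hsN
    have h2 : s' ^ N = s' := by rw [← hg, conj_pow, h1]
    exact congrArg Units.val h2
  have hsep : Squarefree (X ^ N - X : E[X]) := by
    obtain ⟨p, hp⟩ := CharP.exists E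
    refine (galois_poly_separable p N ((CharP.cast_eq_zero_iff E p N).1 ?_)).squarefree
    exact Subtype.ext (by simpa using hN)
  obtain ⟨h, hh⟩ := exists_conj_of_conj_map hsep (hzero ht hsN) (hzero ht' hs'N) g
    (by rw [ht, ht']; exact congrArg Units.val hg')
  let k : GL (Fin n) K := GeneralLinearGroup.map (algebraMap E K) h
  have hk : k * s = s' * k := by
    have h1 := congrArg (algebraMap E K).mapMatrix hh
    rw [map_mul, map_mul] at h1
    exact Units.ext h1
  have hkE (i j) : k.1 i j ^ (Fintype.card F ^ 2) = k.1 i j := (h.1 i j).2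
  have hkk : qstar F (qstar F k.1) = k.1 := by
    ext i j
    rw [qstar_apply, qstar_apply, pow_card_sq, hkE]
  -- `k` need not be unitary; the hermitian matrix `k^* k` commutes with `s`
  have hdet : IsUnit (qstar F k.1 * k.1).det := by
    have h1 : (qstar F k.1).det = k.1.det ^ Fintype.card F := by
      rw [qstar, det_transpose]
      exact ((FiniteField.frobeniusAlgHom F K : K →+* K).map_det k.1).symm
    have h2 : IsUnit k.1.det := (isUnit_iff_isUnit_det _).1 k.isUnit
    rw [det_mul, h1]
    exact (h2.pow _).mul h2
  obtain ⟨c, hc, hcomm⟩ := exists_qstar_mul_self_eq hq (GeneralLinearGroup.mk'' _ hdet)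
    (by change qstar F (qstar F k.1 * k.1) = qstar F k.1 * k.1; rw [qstar_mul, hkk])
  have hcs : Commute s.1 c.1 := by
    apply hcomm
    change s.1 * (qstar F k.1 * k.1) = qstar F k.1 * k.1 * s.1
    have h1 : s.1 * qstar F k.1 = qstar F k.1 * s'.1 := by
      have h2 : k * s⁻¹ = s'⁻¹ * k := by
        rw [mul_inv_eq_iff_eq_mul, mul_assoc, hk, inv_mul_cancel_left]
      have h3 := congrArg (fun g : GL (Fin n) K => qstar F g.1) h2
      simp only [Units.val_mul, qstar_mul] at h3
      rwa [qstar_eq_inv ((U F K n).inv_mem hs), qstar_eq_inv ((U F K n).inv_mem hs'), inv_inv,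
        inv_inv] at h3
    rw [← mul_assoc, h1, mul_assoc, mul_assoc]
    exact congrArg (qstar F k.1 * ·) (congrArg Units.val hk).symm
  have hcinv : qstar F c⁻¹.1 * qstar F c.1 = 1 := by
    rw [← qstar_mul, Units.mul_inv, qstar_one]
  refine ⟨k * c⁻¹, mem_U_iff.2 ?_, ?_⟩
  · have h1 : qstar F k.1 * k.1 = qstar F c.1 * c.1 := hc.symm
    rw [Units.val_mul, qstar_mul, mul_assoc, ← mul_assoc (qstar F k.1), h1, mul_assoc,
      Units.mul_inv, mul_one, hcinv]
  · have h1 : c⁻¹ * s = s * c⁻¹ := by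
      rw [inv_mul_eq_iff_eq_mul, ← mul_assoc, eq_mul_inv_iff_mul_eq]
      exact Units.ext hcs.eq
    rw [mul_assoc, h1, ← mul_assoc, hk, mul_assoc]

end Conjugacy

/-! ### Block embeddings of general linear groups -/

section Block

variable {K : Type*} [Field K] {ι κ ι' : Type*} [Fintype ι] [DecidableEq ι] [Fintype κ]
  [DecidableEq κ] [Fintype ι'] [DecidableEq ι']

/-- The block matrix `(m, 1)`, indexed by `ι'` through the bijection `σ`. -/
def blockMatrix (σ : ι ⊕ κ ≃ ι') : Matrix ι ι K →* Matrix ι' ι' K where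
  toFun m := (fromBlocks m 0 0 1).submatrix σ.symm σ.symm
  map_one' := by rw [fromBlocks_one, submatrix_one_equiv]
  map_mul' m m' := by
    rw [submatrix_mul_equiv, fromBlocks_multiply]
    simp

/-- The embedding `g ↦ (g, 1)` of general linear groups. -/
def block (σ : ι ⊕ κ ≃ ι') : GL ι K →* GL ι' K := Units.map (blockMatrix σ)

variable (σ : ι ⊕ κ ≃ ι')

lemma val_block (g : GL ι K) : (block σ g).1 = blockMatrix σ g.1 := rfl

@[simp] lemma blockMatrix_inl_inl (m : Matrix ι ι K) (i j : ι) :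
    blockMatrix σ m (σ (.inl i)) (σ (.inl j)) = m i j := by
  simp [blockMatrix]

@[simp] lemma blockMatrix_inl_inr (m : Matrix ι ι K) (i : ι) (j : κ) :
    blockMatrix σ m (σ (.inl i)) (σ (.inr j)) = 0 := by
  simp [blockMatrix]

@[simp] lemma blockMatrix_inr_inl (m : Matrix ι ι K) (i : κ) (j : ι) :
    blockMatrix σ m (σ (.inr i)) (σ (.inl j)) = 0 := by
  simp [blockMatrix]

@[simp] lemma blockMatrix_inr_inr (m : Matrix ι ι K) (i j : κ) :
    blockMatrix σ m (σ (.inr i)) (σ (.inr j)) = (1 : Matrix κ κ K) i j := by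
  simp [blockMatrix]

lemma matrix_ext_sum {K ι κ ι' : Type*} (σ : ι ⊕ κ ≃ ι') {A B : Matrix ι' ι' K}
    (h₁ : ∀ i j, A (σ (.inl i)) (σ (.inl j)) = B (σ (.inl i)) (σ (.inl j)))
    (h₂ : ∀ i j, A (σ (.inl i)) (σ (.inr j)) = B (σ (.inl i)) (σ (.inr j)))
    (h₃ : ∀ i j, A (σ (.inr i)) (σ (.inl j)) = B (σ (.inr i)) (σ (.inl j)))
    (h₄ : ∀ i j, A (σ (.inr i)) (σ (.inr j)) = B (σ (.inr i)) (σ (.inr j))) : A = B := by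
  ext a b
  obtain ⟨a, rfl⟩ := σ.surjective a
  obtain ⟨b, rfl⟩ := σ.surjective b
  rcases a with a | a <;> rcases b with b | b
  exacts [h₁ a b, h₂ a b, h₃ a b, h₄ a b]

lemma blockMatrix_injective : Function.Injective (blockMatrix (K := K) σ) := by
  intro m m' h
  ext i j
  simpa using congrFun (congrFun h (σ (.inl i))) (σ (.inl j))

lemma block_injective : Function.Injective (block (K := K) σ) := fun _ _ h =>
  Units.ext (blockMatrix_injective σ (congrArg Units.val h))

lemma det_blockMatrix (m : Matrix ι ι K) : (blockMatrix σ m).det = m.det := by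
  change ((fromBlocks m 0 0 1).submatrix σ.symm σ.symm).det = m.det
  rw [det_submatrix_equiv_self, det_fromBlocks_zero₁₂, det_one, mul_one]

lemma mem_range_block_iff {G : GL ι' K} : G ∈ (block σ).range ↔
    ∀ j a, G.1 a (σ (.inr j)) = (1 : Matrix ι' ι' K) a (σ (.inr j)) ∧
      G.1 (σ (.inr j)) a = (1 : Matrix ι' ι' K) (σ (.inr j)) a := by
  constructor
  · rintro ⟨g, rfl⟩ j a
    obtain ⟨a, rfl⟩ := σ.surjective a
    rcases a with a | a <;> simp [val_block, Matrix.one_apply]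
  · intro h
    let m : Matrix ι ι K := fun i j => G.1 (σ (.inl i)) (σ (.inl j))
    have hm : blockMatrix σ m = G.1 := by
      refine matrix_ext_sum σ (fun i j => blockMatrix_inl_inl σ m i j) (fun i j => ?_)
        (fun i j => ?_) fun i j => ?_
      · rw [(h j _).1]; simp
      · rw [(h i _).2]; simp
      · rw [(h j _).1]; simp [Matrix.one_apply]
    have hdet : IsUnit m.det := by
      rw [← det_blockMatrix σ, hm]
      exact (isUnit_iff_isUnit_det _).1 G.isUnit
    exact ⟨(isUnit_iff_isUnit_det m).2 hdet |>.unit, Units.ext hm⟩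

variable {F : Type*} [Field F] [Fintype F] [Algebra F K]

lemma qstar_blockMatrix (m : Matrix ι ι K) :
    qstar F (blockMatrix σ m) = blockMatrix σ (qstar F m) := by
  refine matrix_ext_sum σ (fun i j => ?_) (fun i j => ?_) (fun i j => ?_) fun i j => ?_
  · simp
  · simp [Fintype.card_ne_zero]
  · simp [Fintype.card_ne_zero]
  · by_cases h : i = j
    · simp [h]
    · simp [h, Ne.symm h, Fintype.card_ne_zero]

lemma block_mem_U_iff {n m : ℕ} {κ : Type*} [Fintype κ] [DecidableEq κ] (σ : Fin n ⊕ κ ≃ Fin m)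
    {g : GL (Fin n) K} : block σ g ∈ U F K m ↔ g ∈ U F K n := by
  rw [mem_U_iff, mem_U_iff, val_block, qstar_blockMatrix, ← map_mul]
  exact ⟨fun h => blockMatrix_injective σ (h.trans (map_one _).symm), fun h => by rw [h, map_one]⟩

lemma unitaryFrob_block {n m : ℕ} {κ : Type*} [Fintype κ] [DecidableEq κ] (σ : Fin n ⊕ κ ≃ Fin m)
    (g : GL (Fin n) K) : unitaryFrob F K m (block σ g) = block σ (unitaryFrob F K n g) := by
  rw [← _root_.inv_inj, ← map_inv (block σ)]
  exact Units.ext (qstar_blockMatrix σ g.1)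

end Block

/-! ### The part of the centralizer away from the eigenvalue one -/

section Sharp

variable {F : Type*} [Field F] [Fintype F] {K : Type*} [Field K] [Algebra F K]

lemma conj_mem_centralizerFactor {n : ℕ} {s s' u g : GL (Fin n) K} (hu : u * s = s' * u)
    {c : Set K} (hg : g ∈ centralizerFactor s c) : u * g * u⁻¹ ∈ centralizerFactor s' c := by
  obtain ⟨h1, h2⟩ := hg
  have hs' : s' = u * s * u⁻¹ := by rw [hu]; group
  refine ⟨?_, fun x hx v hv => ?_⟩
  · rw [hs']
    calc u * g * u⁻¹ * (u * s * u⁻¹) = u * (g * s) * u⁻¹ := by group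
      _ = u * s * u⁻¹ * (u * g * u⁻¹) := by rw [h1]; group
  · have h3 : s.1 *ᵥ (u⁻¹.1 *ᵥ v) = x • (u⁻¹.1 *ᵥ v) := by
      have h4 : s * u⁻¹ = u⁻¹ * s' := by rw [hs']; group
      rw [mulVec_mulVec, ← Units.val_mul, h4, Units.val_mul, ← mulVec_mulVec, hv, mulVec_smul]
    rw [Units.val_mul, Units.val_mul, ← mulVec_mulVec, ← mulVec_mulVec, h2 x hx _ h3,
      mulVec_mulVec, Units.mul_inv, one_mulVec]

/-- Conjugation by a rational element identifies the rational points of centralizer factors. -/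
lemma nonempty_centralizerFactor_equiv_of_conj {n : ℕ} {s s' u : GL (Fin n) K} (hu : u * s = s' * u)
    (huU : u ∈ U F K n) (c : Set K) :
    Nonempty (rationalPoints (unitaryFrob F K n) (centralizerFactor s c) ≃*
      rationalPoints (unitaryFrob F K n) (centralizerFactor s' c)) := by
  have key {s s' u : GL (Fin n) K} (hu : u * s = s' * u) (huU : u ∈ U F K n) (g : GL (Fin n) K)
      (hg : g ∈ rationalPoints (unitaryFrob F K n) (centralizerFactor s c)) :
      MulAut.conj u g ∈ rationalPoints (unitaryFrob F K n) (centralizerFactor s' c) := by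
    refine ⟨conj_mem_centralizerFactor hu hg.1, ?_⟩
    rw [MulAut.conj_apply, map_mul, map_mul, map_inv, hg.2, huU.2]
  have hu' : u⁻¹ * s' = s * u⁻¹ := by
    rw [inv_mul_eq_iff_eq_mul, ← mul_assoc, hu, mul_inv_cancel_right]
  refine ⟨((MulAut.conj u).subgroupMap _).trans (MulEquiv.subgroupCongr (le_antisymm ?_ ?_))⟩
  · rintro _ ⟨g, hg, rfl⟩
    exact key hu huU g hg
  · intro g hg
    refine ⟨u⁻¹ * g * u, ?_, by simp [mul_assoc]⟩
    have := key hu' ((U F K n).inv_mem huU) g hg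
    rwa [MulAut.conj_apply, inv_inv] at this

/-- Adding a block `1` to `s` does not change the rational points of the centralizer factors away
from the eigenvalue `1`. -/
lemma nonempty_centralizerFactor_equiv_block {n m k : ℕ} (σ : Fin n ⊕ Fin m ≃ Fin k)
    (s : GL (Fin n) K) {c : Set K} (hc : (1 : K) ∉ c) :
    Nonempty (rationalPoints (unitaryFrob F K n) (centralizerFactor s c) ≃*
      rationalPoints (unitaryFrob F K k) (centralizerFactor (block σ s) c)) := by
  -- the two components of a vector under a block matrix
  have hinl (A : Matrix (Fin n) (Fin n) K) (v : Fin k → K) (i : Fin n) :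
      (blockMatrix σ A *ᵥ v) (σ (.inl i)) = (A *ᵥ fun j => v (σ (.inl j))) i := by
    simp [mulVec, dotProduct, ← σ.sum_comp]
  have hinr (A : Matrix (Fin n) (Fin n) K) (v : Fin k → K) (i : Fin m) :
      (blockMatrix σ A *ᵥ v) (σ (.inr i)) = v (σ (.inr i)) := by
    simp [mulVec, dotProduct, ← σ.sum_comp, Matrix.one_apply]
  have hmem (g : GL (Fin n) K) (hg : g ∈ rationalPoints (unitaryFrob F K n) (centralizerFactor s c)) :
      block σ g ∈ rationalPoints (unitaryFrob F K k) (centralizerFactor (block σ s) c) := by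
    refine ⟨⟨by rw [← map_mul, hg.1.1, map_mul], fun x hx v hv => ?_⟩, ?_⟩
    · funext a
      obtain ⟨a, rfl⟩ := σ.surjective a
      rcases a with a | a
      · rw [val_block, hinl, hg.1.2 x hx]
        funext j
        have := congrFun hv (σ (.inl j))
        rwa [val_block, hinl] at this
      · rw [val_block, hinr]
    · rw [unitaryFrob_block, hg.2]
  refine ⟨MulEquiv.ofBijective
    (((block σ).comp (rationalPoints _ (centralizerFactor s c)).subtype).codRestrict
      (rationalPoints (unitaryFrob F K k) (centralizerFactor (block σ s) c)) fun g => hmem g.1 g.2)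
    ⟨fun g g' h => Subtype.ext (block_injective σ (congrArg Subtype.val h)), ?_⟩⟩
  rintro ⟨G, hG, hGF⟩
  have hGU : G ∈ U F K k := ⟨trivial, hGF⟩
  have hcol {G : GL (Fin k) K} (hG : G ∈ centralizerFactor (block σ s) c) (j : Fin m) (a : Fin k) :
      G.1 a (σ (.inr j)) = (1 : Matrix (Fin k) (Fin k) K) a (σ (.inr j)) := by
    have h1 := hG.2 1 hc (Pi.single (σ (.inr j)) 1) (by
      funext b
      obtain ⟨b, rfl⟩ := σ.surjective b
      rcases b with b | b <;> simp [val_block, mulVec_single, Pi.single_apply, Matrix.one_apply])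
    have h2 := congrFun h1 a
    simp only [mulVec_single_one, Pi.single_apply] at h2
    rw [Matrix.one_apply]
    exact h2
  have hrange : G ∈ (block σ).range := by
    refine (mem_range_block_iff σ).2 fun j a => ⟨hcol hG j a, ?_⟩
    have h1 := hcol ((centralizerFactor (block σ s) c).inv_mem hG) j a
    rw [← qstar_eq_inv hGU, qstar_apply] at h1
    refine (FiniteField.frobeniusAlgHom F K).injective (h1.trans ?_)
    rw [Matrix.one_apply, Matrix.one_apply]
    by_cases h : a = σ (.inr j)
    · simp [h]
    · simp [h, Ne.symm h]
  obtain ⟨g, rfl⟩ := hrange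
  refine ⟨⟨g, ⟨block_injective σ ?_, fun x hx v hv => ?_⟩, block_injective σ ?_⟩, rfl⟩
  · rw [map_mul, map_mul, hG.1]
  · let w : Fin k → K := fun a => Sum.elim v (fun _ => 0) (σ.symm a)
    have hw : (block σ s).1 *ᵥ w = x • w := by
      funext a
      obtain ⟨a, rfl⟩ := σ.surjective a
      rcases a with a | a
      · rw [val_block, hinl]
        simpa [w] using congrFun hv a
      · rw [val_block, hinr]
        simp [w]
    funext i
    have := congrFun (hG.2 x hx w hw) (σ (.inl i))
    rw [val_block, hinl] at this
    simpa [w] using this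
  · rw [← unitaryFrob_block, hGF]

lemma eigenvalueSet_eq_of_isConj {n : ℕ} {s s' : GL (Fin n) K} (h : IsConj s s') :
    eigenvalueSet s = eigenvalueSet s' := by
  have key {s s' : GL (Fin n) K} (h : IsConj s s') : eigenvalueSet s ⊆ eigenvalueSet s' := by
    intro x hx
    obtain ⟨v, hv⟩ := Module.End.HasEigenvalue.exists_hasEigenvector hx
    obtain ⟨u, rfl⟩ := isConj_iff.1 h
    refine Module.End.hasEigenvalue_of_hasEigenvector (x := u.1 *ᵥ v) ⟨?_, fun h0 => hv.2 ?_⟩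
    · have h1 : s.1 *ᵥ v = x • v := hv.apply_eq_smul
      rw [Module.End.mem_eigenspace_iff, toLin'_apply, mulVec_mulVec, ← Units.val_mul,
        inv_mul_cancel_right, Units.val_mul, ← mulVec_mulVec, h1, mulVec_smul]
    · rw [← one_mulVec v, ← Units.inv_mul u, ← mulVec_mulVec, h0, mulVec_zero]
  exact (key h).antisymm (key h.symm)

lemma mem_eigenvalueSet_iff_of_isConj_torusElement {n l : ℕ} (hl : l ≤ n) {t : Fin l → Kˣ}
    {s : GL (Fin n) K} (h : IsConj s (torusElement n t)) {x : K} (hx : x ≠ 1) :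
    x ∈ eigenvalueSet s ↔ ∃ i, (t i : K) = x := by
  rw [eigenvalueSet_eq_of_isConj h]
  refine (hasEigenvalue_toLin'_diagonal_iff _).trans ⟨?_, ?_⟩
  · rintro ⟨i, hi⟩
    by_cases h : (i : ℕ) < l
    · exact ⟨⟨i, h⟩, by simpa [h] using hi⟩
    · simp [h, hx.symm] at hi
  · rintro ⟨i, rfl⟩
    exact ⟨⟨i, i.2.trans_le hl⟩, by simp⟩

lemma one_notMem_frobClass {n : ℕ} (s : GL (Fin n) K) {x : K} (hx : x ≠ 1) :
    (1 : K) ∉ frobClass F s x := by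
  rintro ⟨-, i, hi⟩
  have hinj : Function.Injective fun z : K => (z ^ Fintype.card F)⁻¹ := fun a b h =>
    (FiniteField.frobeniusAlgHom F K).injective (inv_injective h)
  have h1 : (fun z : K => (z ^ Fintype.card F)⁻¹)^[i] 1 = 1 := Function.iterate_fixed (by simp) i
  exact hx (hinj.iterate i (hi.trans h1.symm))

/-- Elements with the same eigenvalues other than `1` and pairwise isomorphic centralizer factors
away from `1` have isomorphic groups `G_#`. -/
lemma nonempty_GSharp_equiv {n n' : ℕ} {s : GL (Fin n) K} {s' : GL (Fin n') K}
    (heig : ∀ x ≠ 1, x ∈ eigenvalueSet s ↔ x ∈ eigenvalueSet s')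
    (hiso : ∀ c : Set K, 1 ∉ c →
      Nonempty (rationalPoints (unitaryFrob F K n) (centralizerFactor s c) ≃*
        rationalPoints (unitaryFrob F K n') (centralizerFactor s' c))) :
    Nonempty (GSharp F s ≃* GSharp F s') := by
  have hclass (x : K) (hx : x ≠ 1) : frobClass F s x = frobClass F s' x := by
    ext y
    have h1 (h : y = 1) : y ∉ frobClass F s x ∧ y ∉ frobClass F s' x := by
      subst h
      exact ⟨one_notMem_frobClass s hx, one_notMem_frobClass s' hx⟩
    by_cases hy : y = 1
    · exact iff_of_false (h1 hy).1 (h1 hy).2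
    · exact and_congr_left fun _ => heig y hy
  have hidx (c : Set K) : (∃ x ∈ eigenvalueSet s, x ≠ 1 ∧ c = frobClass F s x) ↔
      ∃ x ∈ eigenvalueSet s', x ≠ 1 ∧ c = frobClass F s' x := by
    constructor
    · rintro ⟨x, hx, hx1, rfl⟩
      exact ⟨x, (heig x hx1).1 hx, hx1, hclass x hx1⟩
    · rintro ⟨x, hx, hx1, rfl⟩
      exact ⟨x, (heig x hx1).2 hx, hx1, (hclass x hx1).symm⟩
  have hone (c : SharpIndex F s) : (1 : K) ∉ c.1 := by
    obtain ⟨c, x, -, hx1, rfl⟩ := c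
    exact one_notMem_frobClass s hx1
  let Φ (c : SharpIndex F s) := Classical.choice (hiso c.1 (hone c))
  exact ⟨{
    toFun f c := Φ ⟨c.1, (hidx c.1).2 c.2⟩ (f ⟨c.1, (hidx c.1).2 c.2⟩)
    invFun f c := (Φ c).symm (f ⟨c.1, (hidx c.1).1 c.2⟩)
    left_inv f := by funext c; simp
    right_inv f := by
      funext c
      exact (Φ ⟨c.1, (hidx c.1).2 c.2⟩).apply_symm_apply _
    map_mul' f g := by funext c; simp }⟩

/-- Finitely many elements of an algebraic extension of a finite field are fixed by a common power
of the Frobenius map. -/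
lemma exists_pow_eq_self [Algebra.IsAlgebraic F K] {l : ℕ} (t : Fin l → K) :
    ∃ N : ℕ, (N : K) = 0 ∧ ∀ i, t i ^ N = t i := by
  let L := IntermediateField.adjoin F (Set.range t)
  have : FiniteDimensional F L := IntermediateField.finiteDimensional_adjoin fun x _ =>
    Algebra.IsIntegral.isIntegral x
  have : Finite L := Module.finite_of_finite F
  let _ := Fintype.ofFinite L
  refine ⟨Fintype.card L, ?_, fun i => ?_⟩
  · rw [← map_natCast (algebraMap L K), FiniteField.cast_card_eq_zero, map_zero]
  · let x : L := ⟨t i, IntermediateField.subset_adjoin F _ ⟨i, rfl⟩⟩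
    exact congrArg (algebraMap L K) (FiniteField.pow_card x)

lemma torusElement_pow_eq {n l : ℕ} {t : Fin l → Kˣ} {N : ℕ} (ht : ∀ i, (t i : K) ^ N = t i) :
    (torusElement n t).1 ^ N = (torusElement n t).1 := by
  change diagonal _ ^ N = diagonal _
  rw [diagonal_pow]
  congr 1
  funext i
  by_cases h : (i : ℕ) < l
  · simp [h, ht]
  · simp [h]

lemma pow_eq_self_of_isConj {n : ℕ} {s s' : GL (Fin n) K} (h : IsConj s s') {N : ℕ}
    (hs : s'.1 ^ N = s'.1) : s.1 ^ N = s.1 := by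
  obtain ⟨u, rfl⟩ := isConj_iff.1 h.symm
  have h1 : s' ^ N = s' := Units.ext hs
  rw [← Units.val_pow_eq_pow_val, conj_pow, h1]

lemma block_torusElement {n m l : ℕ} (hl : l ≤ n) (t : Fin l → Kˣ) :
    block finSumFinEquiv (torusElement n t) = torusElement (n + m) t := by
  refine Units.ext (matrix_ext_sum finSumFinEquiv ?_ ?_ ?_ ?_)
  all_goals intro i j
  · rw [val_block, blockMatrix_inl_inl]
    simp [torusElement, diagonal_apply, Fin.ext_iff]
  · rw [val_block, blockMatrix_inl_inr]
    simp [torusElement, Fin.ext_iff, show ¬ i.1 = n + j.1 by omega]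
  · rw [val_block, blockMatrix_inr_inl]
    simp [torusElement, Fin.ext_iff, show ¬ n + i.1 = j.1 by omega]
  · rw [val_block, blockMatrix_inr_inr]
    simp [torusElement, diagonal_apply, Fin.ext_iff, Matrix.one_apply,
      show ¬ n + i.1 < l by omega]

/-- Howe-related rational semisimple elements have isomorphic groups `G_#`: after adding a block
`1` to the smaller one, the two elements are conjugate in a finite unitary group. -/
theorem nonempty_GSharp_equiv_of_howeRelated [IsAlgClosed K] [Algebra.IsAlgebraic F K]
    (hq : Odd (Fintype.card F)) {n n' : ℕ} {s : GL (Fin n) K} {s' : GL (Fin n') K}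
    (hs : s ∈ U F K n) (hs' : s' ∈ U F K n') (hrel : HoweRelated s s') :
    Nonempty (GSharp F s ≃* GSharp F s') := by
  wlog hnn : n ≤ n' generalizing n n'
  · obtain ⟨l, t, hl, ht, h, h'⟩ := hrel
    exact (this hs' hs ⟨l, t, by rwa [min_comm], ht, h', h⟩ (by omega)).map MulEquiv.symm
  obtain ⟨l, t, hl, ht, h, h'⟩ := hrel
  obtain ⟨m, rfl⟩ := Nat.exists_eq_add_of_le hnn
  obtain ⟨hln, hln'⟩ := le_min_iff.1 hl
  obtain ⟨N, hN, htN⟩ := exists_pow_eq_self (F := F) fun i => (t i : K)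
  refine nonempty_GSharp_equiv (fun x hx => ?_) fun c hc => ?_
  · rw [mem_eigenvalueSet_iff_of_isConj_torusElement hln h hx,
      mem_eigenvalueSet_iff_of_isConj_torusElement hln' h' hx]
  · let σ : Fin n ⊕ Fin m ≃ Fin (n + m) := finSumFinEquiv
    have hconj : IsConj (block σ s) s' := by
      have h1 := MonoidHom.map_isConj (block σ) h
      rw [block_torusElement hln] at h1
      exact h1.trans h'.symm
    obtain ⟨u, huU, hu⟩ := exists_mem_U_conj hq ((block_mem_U_iff σ).2 hs) hs' hconj hN
      (pow_eq_self_of_isConj (hconj.trans h') (torusElement_pow_eq htN))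
    obtain ⟨e₁⟩ := nonempty_centralizerFactor_equiv_block (F := F) σ s hc
    obtain ⟨e₂⟩ := nonempty_centralizerFactor_equiv_of_conj (F := F) hu huU c
    exact ⟨e₁.trans e₂⟩

end Sharp

/-! ### The part of the centralizer at the eigenvalue one -/

section One

variable {F : Type*} [Field F] [Fintype F] {K : Type*} [Field K] [Algebra F K]

lemma one_sub_inv_mul {n : ℕ} (s : GL (Fin n) K) : s⁻¹.1 - 1 = -(s⁻¹.1 * (s.1 - 1)) := by
  rw [mul_sub, Units.inv_mul, mul_one, neg_sub]

/-- The diagonal projector onto the first `l` coordinates. -/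
def coordProj (K : Type*) [Field K] (n l : ℕ) : Matrix (Fin n) (Fin n) K :=
  diagonal fun i => if (i : ℕ) < l then 1 else 0

/-- For a unitary element conjugate to `(t, 1)`, the projector `c` onto the sum of the eigenspaces
for the eigenvalues `≠ 1`, along the eigenspace of `1`, is self-adjoint. -/
lemma qstar_conj_coordProj {n l : ℕ} {t : Fin l → Kˣ} (ht : ∀ i, t i ≠ 1) {P s : GL (Fin n) K}
    (hs : s ∈ U F K n) (hP : P * torusElement n t * P⁻¹ = s) :
    (∃ x, P.1 * coordProj K n l * P⁻¹.1 = x * (s.1 - 1)) ∧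
    (s.1 - 1) * (P.1 * coordProj K n l * P⁻¹.1) = s.1 - 1 ∧
    (P.1 * coordProj K n l * P⁻¹.1) * (s.1 - 1) = s.1 - 1 ∧
    qstar F (P.1 * coordProj K n l * P⁻¹.1) = P.1 * coordProj K n l * P⁻¹.1 := by
  set D := (torusElement n t).1 with hD
  let y : Matrix (Fin n) (Fin n) K :=
    diagonal fun i => if h : (i : ℕ) < l then ((t ⟨i, h⟩ : K) - 1)⁻¹ else 0
  have hy : y * (D - 1) = coordProj K n l ∧ (D - 1) * y = coordProj K n l ∧
      (D - 1) * coordProj K n l = D - 1 ∧ coordProj K n l * (D - 1) = D - 1 := by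
    have h1 (i : Fin n) (h : (i : ℕ) < l) : (t ⟨i, h⟩ : K) - 1 ≠ 0 :=
      sub_ne_zero.2 fun h0 => ht _ (Units.ext h0)
    have h2 : D - 1 = diagonal fun i : Fin n => if h : (i : ℕ) < l then (t ⟨i, h⟩ : K) - 1 else 0 := by
      rw [hD, ← diagonal_one]
      change diagonal _ - _ = _
      rw [diagonal_sub]
      congr 1
      funext i
      by_cases h : (i : ℕ) < l <;> simp [h]
    rw [h2]
    simp only [y, coordProj, diagonal_mul_diagonal]
    refine ⟨?_, ?_, ?_, ?_⟩
    all_goals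
      congr 1
      funext i
      by_cases h : (i : ℕ) < l
      · simp [h, h1 i h]
      · simp [h]
  obtain ⟨hy₁, hy₂, hy₃, hy₄⟩ := hy
  have hconj (A B : Matrix (Fin n) (Fin n) K) :
      (P.1 * A * P⁻¹.1) * (P.1 * B * P⁻¹.1) = P.1 * (A * B) * P⁻¹.1 := by
    simp only [mul_assoc]
    rw [← mul_assoc P⁻¹.1 P.1, Units.inv_mul, one_mul]
  have hs1 : s.1 - 1 = P.1 * (D - 1) * P⁻¹.1 := by
    rw [mul_sub, sub_mul, mul_one, Units.mul_inv, ← hP]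
    rfl
  set c := P.1 * coordProj K n l * P⁻¹.1 with hc
  have hx : c = (P.1 * y * P⁻¹.1) * (s.1 - 1) := by rw [hs1, hconj, hy₁]
  have hx' : c = (s.1 - 1) * (P.1 * y * P⁻¹.1) := by rw [hs1, hconj, hy₂]
  obtain ⟨z, hz⟩ : ∃ z, z = P.1 * y * P⁻¹.1 := ⟨_, rfl⟩
  rw [← hz] at hx hx'
  have hc₁ : (s.1 - 1) * c = s.1 - 1 := by rw [hs1, hc, hconj, hy₃]
  have hc₂ : c * (s.1 - 1) = s.1 - 1 := by rw [hs1, hc, hconj, hy₄]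
  refine ⟨⟨_, hx⟩, hc₁, hc₂, ?_⟩
  -- both `c` and `c^*` are right and left multiples of `s - 1`
  have hstar : qstar F (s.1 - 1) = -(s⁻¹.1 * (s.1 - 1)) := by
    rw [qstar_sub, qstar_one, qstar_eq_inv hs, one_sub_inv_mul]
  have hcinv : s⁻¹.1 * (s.1 - 1) = (s.1 - 1) * s⁻¹.1 := by
    rw [mul_sub, sub_mul, Units.inv_mul, Units.mul_inv, mul_one, one_mul]
  have h1 : qstar F c * c = qstar F c := by
    have h2 : qstar F c = -(qstar F z * s⁻¹.1) * (s.1 - 1) := by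
      rw [hx', qstar_mul, hstar, mul_neg, neg_mul, mul_assoc]
    rw [h2, mul_assoc, hc₁]
  have h2 : qstar F c * (s.1 - 1) = s.1 - 1 := by
    have h3 := congrArg (qstar F) hc₁
    rw [qstar_mul, hstar, hcinv, mul_neg, neg_inj, ← mul_assoc] at h3
    exact (Units.mul_left_inj s⁻¹).1 h3
  calc qstar F c = qstar F c * c := h1.symm
    _ = qstar F c * ((s.1 - 1) * z) := by rw [← hx']
    _ = c := by rw [← mul_assoc, h2, ← hx']

/-- The centralizer factor `G_[1](s)` of a rational semisimple element is, up to conjugation by a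
rational element, a block `GL_a`. The element `1 - 2c`, for `c` the projector onto the
eigenspaces away from `1`, is unitary and conjugate to `(-1, …, -1, 1, …, 1)`. -/
theorem exists_centralizerFactor_one_eq [IsAlgClosed K] (hq : Odd (Fintype.card F)) {a l : ℕ}
    {t : Fin l → Kˣ} (ht : ∀ i, t i ≠ 1) {s : GL (Fin (l + a)) K} (hs : s ∈ U F K (l + a))
    (h : IsConj s (torusElement (l + a) t)) :
    ∃ u ∈ U F K (l + a), ∀ g, g ∈ centralizerFactor s (frobClass F s 1) ↔
      ∃ m : GL (Fin a) K,
        u * block ((Equiv.sumComm _ _).trans finSumFinEquiv) m * u⁻¹ = g := by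
  obtain ⟨P, hP⟩ := isConj_iff.1 h.symm
  obtain ⟨⟨x, hx⟩, hc₁, hc₂, hc⟩ := qstar_conj_coordProj ht hs hP
  set c₀ := coordProj K (l + a) l with hc₀
  set c := P.1 * c₀ * P⁻¹.1 with hcdef
  clear_value c c₀
  have h2 : (2 : K) ≠ 0 := two_ne_zero_of_odd_card hq
  have hc₀c₀ : c₀ * c₀ = c₀ := by
    rw [hc₀, coordProj, diagonal_mul_diagonal]
    congr 1; funext i; simp
  have hcc : c * c = c := by
    calc c * c = x * ((s.1 - 1) * c) := by rw [← mul_assoc, ← hx]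
      _ = c := by rw [hc₁, ← hx]
  have hstar₀ : qstar F c₀ = c₀ := by
    ext i j
    by_cases hij : i = j
    · by_cases hi : (i : ℕ) < l <;> simp [hc₀, coordProj, hij, Fintype.card_ne_zero]
    · simp [hc₀, coordProj, hij, Ne.symm hij, Fintype.card_ne_zero]
  have hU {r : GL (Fin (l + a)) K} {e : Matrix (Fin (l + a)) (Fin (l + a)) K}
      (hr : r.1 = 1 - (e + e)) (he : e * e = e) (he' : qstar F e = e) : r ∈ U F K (l + a) := by
    rw [mem_U_iff, hr, qstar_sub, qstar_one, qstar_add, he', sub_mul, one_mul, mul_sub, mul_one,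
      mul_add, add_mul, he]
    abel
  let r₀ := torusElement (l + a) (fun _ : Fin l => (-1 : Kˣ))
  have hr₀ : r₀.1 = 1 - (c₀ + c₀) := by
    change diagonal _ = _
    rw [hc₀, coordProj, diagonal_add, ← diagonal_one, diagonal_sub]
    congr 1
    funext i
    by_cases hi : (i : ℕ) < l
    · simp [hi]
    · simp [hi]
  -- the reflections `r₀ = 1 - 2c₀` and `r = 1 - 2c`
  let r := P * r₀ * P⁻¹
  have hr : r.1 = 1 - (c + c) := by
    change P.1 * r₀.1 * P⁻¹.1 = _
    rw [hr₀, mul_sub, sub_mul, mul_one, Units.mul_inv, mul_add, add_mul, hcdef]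
  obtain ⟨u, huU, hu⟩ := exists_mem_U_conj hq (hU hr₀ hc₀c₀ hstar₀) (hU hr hcc hc)
    (isConj_iff.2 ⟨P, rfl⟩) (N := Fintype.card F)
    (by rw [← map_natCast (algebraMap F K), FiniteField.cast_card_eq_zero, map_zero])
    (torusElement_pow_eq fun _ => by simp [hq.neg_one_pow])
  have huc : u.1 * c₀ = c * u.1 := by
    have h3 : u.1 * r₀.1 = r.1 * u.1 := congrArg Units.val hu
    rw [hr₀, hr, mul_sub, sub_mul, mul_one, one_mul, sub_right_inj, mul_add, add_mul,
      ← two_smul K, ← two_smul K] at h3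
    exact smul_right_injective _ h2 h3
  -- the centralizer factor consists of the `g` that act trivially on the image of `c` and
  -- preserve its kernel, the eigenspace for `1`
  have hmem (g : GL (Fin (l + a)) K) : g ∈ centralizerFactor s (frobClass F s 1) ↔
      g.1 * c = c ∧ c * g.1 = c := by
    constructor
    · rintro ⟨hg, hg'⟩
      have hgs : g.1 * (s.1 - 1) = (s.1 - 1) * g.1 := by
        rw [mul_sub, sub_mul, mul_one, one_mul]
        exact congrArg (· - g.1) (congrArg Units.val hg)
      -- the columns of `P c₀` are eigenvectors of `s` for eigenvalues `≠ 1`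
      have h3 : g.1 * (P.1 * c₀) = P.1 * c₀ := by
        ext i j
        by_cases hj : (j : ℕ) < l
        · have hcol (A : Matrix (Fin (l + a)) (Fin (l + a)) K) :
              (A * c₀) i j = (A *ᵥ Pi.single j 1) i := by
            rw [hc₀, coordProj, mul_diagonal]
            simp [hj]
          have h4 : s.1 *ᵥ (P.1 *ᵥ Pi.single j 1) = (t ⟨j, hj⟩ : K) • (P.1 *ᵥ Pi.single j 1) := by
            have h5 : s * P = P * torusElement (l + a) t := by rw [← hP]; group
            have h6 : (torusElement (l + a) t).1 *ᵥ Pi.single j 1 =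
                (t ⟨j, hj⟩ : K) • Pi.single j 1 := by
              change diagonal _ *ᵥ _ = _
              rw [diagonal_mulVec_single, ← Pi.single_smul]
              simp [hj]
            rw [mulVec_mulVec, ← Units.val_mul, h5, Units.val_mul, ← mulVec_mulVec, h6, mulVec_smul]
          -- `1` is fixed by `x ↦ x ^ (-q)`
          have h7 : (t ⟨j, hj⟩ : K) ∉ frobClass F s 1 := by
            rintro ⟨-, k, hk⟩
            rw [Function.iterate_fixed (by simp)] at hk
            exact ht _ (Units.ext hk.symm)
          rw [← mul_assoc, hcol, hcol, ← mulVec_mulVec, hg' _ h7 _ h4]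
        · have hcol (A : Matrix (Fin (l + a)) (Fin (l + a)) K) : (A * c₀) i j = 0 := by
            rw [hc₀, coordProj, mul_diagonal]
            simp [hj]
          rw [← mul_assoc, hcol, hcol]
      have h4 : g.1 * c = c := by rw [hcdef, ← mul_assoc, h3]
      refine ⟨h4, ?_⟩
      have h5 : (s.1 - 1) * g.1 * (1 - c) = 0 := by
        rw [← hgs, mul_assoc, mul_sub, mul_one, hc₁, sub_self, mul_zero]
      have h6 := congrArg (x * ·) h5
      simp only [← mul_assoc, mul_zero] at h6
      rw [← hx, mul_sub, mul_one, mul_assoc c, h4, hcc, sub_eq_zero] at h6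
      exact h6
    · rintro ⟨h3, h4⟩
      have h5 : g.1 * (s.1 - 1) = s.1 - 1 := by rw [← hc₂, ← mul_assoc, h3]
      have h6 : (s.1 - 1) * g.1 = s.1 - 1 := by rw [← hc₁, mul_assoc, h4]
      refine ⟨Units.ext ?_, fun y hy v hv => ?_⟩
      · have h7 := h5.trans h6.symm
        rwa [mul_sub, sub_mul, mul_one, one_mul, sub_left_inj] at h7
      · by_cases hy1 : y = 1
        · subst hy1
          have h7 : v = 0 := by
            by_contra h0
            refine hy ⟨Module.End.hasEigenvalue_of_hasEigenvector (x := v) ⟨?_, h0⟩, 0, rfl⟩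
            rw [Module.End.mem_eigenspace_iff, toLin'_apply, hv]
          rw [h7, mulVec_zero]
        · have h7 : (s.1 - 1) *ᵥ v = (y - 1) • v := by
            rw [sub_mulVec, one_mulVec, hv, sub_smul, one_smul]
          have h8 : (y - 1) • (g.1 *ᵥ v) = (y - 1) • v := by
            rw [← mulVec_smul, ← h7, mulVec_mulVec, h5]
          exact smul_right_injective _ (sub_ne_zero.2 hy1) h8
  refine ⟨u, huU, fun g => ?_⟩
  have hrange : (∃ m : GL (Fin a) K,
      u * block ((Equiv.sumComm _ _).trans finSumFinEquiv) m * u⁻¹ = g) ↔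
      u⁻¹ * g * u ∈ (block (K := K) ((Equiv.sumComm (Fin a) (Fin l)).trans finSumFinEquiv)).range := by
    refine exists_congr fun m => ?_
    rw [mul_inv_eq_iff_eq_mul, mul_assoc, eq_inv_mul_iff_mul_eq]
  rw [hrange, hmem, mem_range_block_iff]
  have h3 : (g.1 * c = c ∧ c * g.1 = c) ↔
      (u⁻¹ * g * u).1 * c₀ = c₀ ∧ c₀ * (u⁻¹ * g * u).1 = c₀ := by
    refine and_congr ?_ ?_
    · rw [Units.val_mul, Units.val_mul, mul_assoc, huc, mul_assoc, ← mul_assoc g.1,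
        Units.inv_mul_eq_iff_eq_mul, huc, Units.mul_left_inj]
    · have h4 : c₀ * u⁻¹.1 = u⁻¹.1 * c := by
        rw [Units.eq_inv_mul_iff_mul_eq, ← mul_assoc, huc, mul_assoc, Units.mul_inv, mul_one]
      rw [Units.val_mul, Units.val_mul, ← mul_assoc, ← mul_assoc, h4, mul_assoc, mul_assoc,
        Units.inv_mul_eq_iff_eq_mul, huc, ← mul_assoc, Units.mul_left_inj]
  rw [h3]
  set G := (u⁻¹ * g * u).1
  have hcol (i j : Fin (l + a)) : (G * c₀) i j = if (j : ℕ) < l then G i j else 0 := by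
    rw [hc₀, coordProj, mul_diagonal]
    simp
  have hrow (i j : Fin (l + a)) : (c₀ * G) i j = if (i : ℕ) < l then G i j else 0 := by
    rw [hc₀, coordProj, diagonal_mul]
    simp
  have hval (i j : Fin (l + a)) : c₀ i j = if (j : ℕ) < l then (1 : Matrix _ _ K) i j else 0 := by
    have := congrFun (congrFun (one_mul c₀) i) j
    rw [hc₀, coordProj, mul_diagonal] at this
    rw [hc₀, coordProj, ← this]
    simp
  have hval' (i j : Fin (l + a)) : c₀ i j = if (i : ℕ) < l then (1 : Matrix _ _ K) i j else 0 := by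
    have := congrFun (congrFun (mul_one c₀) i) j
    rw [hc₀, coordProj, diagonal_mul] at this
    rw [hc₀, coordProj, ← this]
    simp
  constructor
  · rintro ⟨h4, h5⟩ j b
    have h6 := congrFun (congrFun h4 b) (Fin.castAdd a j)
    have h7 := congrFun (congrFun h5 (Fin.castAdd a j)) b
    rw [hcol, hval] at h6
    rw [hrow, hval'] at h7
    simp only [Fin.val_castAdd, j.2, if_true] at h6 h7
    exact ⟨h6, h7⟩
  · intro h4
    refine ⟨?_, ?_⟩
    · ext i j
      rw [hcol, hval]
      by_cases hj : (j : ℕ) < l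
      · rw [if_pos hj, if_pos hj]
        exact (h4 ⟨j, hj⟩ i).1
      · simp [hj]
    · ext i j
      rw [hrow, hval']
      by_cases hi : (i : ℕ) < l
      · rw [if_pos hi, if_pos hi]
        exact (h4 ⟨i, hi⟩ j).2
      · simp [hi]

end One

/-! ### Characters and cocharacters of tori -/

section Characters

variable {K : Type*} [Field K]

lemma eval_mem_subalgebra {X ι : Type*} (A : Subalgebra K (X → K)) {y : ι → X → K}
    (hy : ∀ i, y i ∈ A) (P : MvPolynomial ι K) :
    (fun x => MvPolynomial.eval (fun i => y i x) P) ∈ A := by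
  induction P using MvPolynomial.induction_on with
  | C r =>
    simp only [MvPolynomial.eval_C]
    exact A.algebraMap_mem r
  | add P Q hP hQ =>
    simp only [map_add]
    exact A.add_mem hP hQ
  | mul_X P i hP =>
    simp only [map_mul, MvPolynomial.eval_X]
    exact A.mul_mem hP (hy i)

lemma exists_eval_eq_of_mem_adjoin {X ι : Type*} {y : ι → X → K} {f : X → K}
    (hf : f ∈ Algebra.adjoin K (Set.range y)) :
    ∃ P : MvPolynomial ι K, ∀ x, f x = MvPolynomial.eval (fun i => y i x) P := by
  induction hf using Algebra.adjoin_induction with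
  | mem f hf => obtain ⟨i, rfl⟩ := hf; exact ⟨.X i, fun x => by simp⟩
  | algebraMap r => exact ⟨.C r, fun x => by simp⟩
  | add f g _ _ hf hg =>
    obtain ⟨P, hP⟩ := hf
    obtain ⟨Q, hQ⟩ := hg
    exact ⟨P + Q, fun x => by simp [hP, hQ]⟩
  | mul f g _ _ hf hg =>
    obtain ⟨P, hP⟩ := hf
    obtain ⟨Q, hQ⟩ := hg
    exact ⟨P * Q, fun x => by simp [hP, hQ]⟩

lemma polynomial_eval_mem_subalgebra {X : Type*} (A : Subalgebra K (X → K)) {y : X → K}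
    (hy : y ∈ A) (P : K[X]) : (fun x => P.eval (y x)) ∈ A := by
  induction P using Polynomial.induction_on' with
  | add P Q hP hQ =>
    simp only [eval_add]
    exact A.add_mem hP hQ
  | monomial k c =>
    simp only [eval_monomial]
    exact A.mul_mem (A.algebraMap_mem c) (A.pow_mem hy k)

lemma exists_polynomial_eval_eq_of_mem_adjoin {X : Type*} {y : X → K} {f : X → K}
    (hf : f ∈ Algebra.adjoin K {y}) : ∃ P : K[X], ∀ x, f x = P.eval (y x) := by
  rw [Algebra.adjoin_singleton_eq_range_aeval] at hf
  obtain ⟨P, rfl⟩ := hf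
  refine ⟨P, fun x => ?_⟩
  rw [← coe_aeval_eq_eval]
  exact (aeval_algHom_apply (Pi.evalAlgHom K (fun _ : X => K) x) y P).symm

/-- By the linear independence of characters, a multiplicative function which is a polynomial in
some multiplicative functions is a monomial in them. -/
lemma mem_closure_of_mem_adjoin {G : Type*} [Monoid G] {S : Set (G →* K)} {f : G →* K}
    (hf : (f : G → K) ∈ Algebra.adjoin K ((fun g : G →* K => (g : G → K)) '' S)) :
    f ∈ Submonoid.closure S := by
  have h1 : Submonoid.closure ((fun g : G →* K => (g : G → K)) '' S) =
      (Submonoid.closure S).map (MonoidHom.coeFn G K) :=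
    (MonoidHom.map_mclosure (MonoidHom.coeFn G K) S).symm
  rw [← Subalgebra.mem_toSubmodule, Algebra.adjoin_eq_span, h1] at hf
  by_contra h
  exact (linearIndependent_monoidHom G K).notMem_span_image (s := Submonoid.closure S) h hf

/-- `z ↦ z ^ m` determines `m` over an infinite field. -/
lemma eq_of_forall_zpow_eq [Infinite K] {m m' : ℤ} (h : ∀ z : Kˣ, z ^ m = z ^ m') : m = m' := by
  by_contra hne
  have h1 (z : Kˣ) : z ^ (m - m').natAbs = 1 := by
    have h2 : z ^ (m - m') = 1 := by rw [_root_.zpow_sub, h z, mul_inv_cancel]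
    rcases Int.natAbs_eq (m - m') with h3 | h3
    · rw [h3, zpow_natCast] at h2; exact h2
    · rw [h3, _root_.zpow_neg, zpow_natCast, inv_eq_one] at h2; exact h2
  have h2 : (m - m').natAbs ≠ 0 := by omega
  refine Set.infinite_univ ((finite_pow_eq_self (K := K) (m := (m - m').natAbs + 1)
    (by omega)).subset fun x _ => ?_)
  change x ^ _ = x
  by_cases hx : x = 0
  · rw [hx, zero_pow (by omega)]
  · have := congrArg Units.val (h1 (Units.mk0 x hx))
    rw [Units.val_pow_eq_pow_val, Units.val_mk0, Units.val_one] at this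
    rw [pow_succ, this, one_mul]

variable {a : ℕ}

/-- The character `c ↦ ∏ cᵢ ^ mᵢ` of the standard torus. -/
def monomialChar (K : Type*) [Field K] {a : ℕ} (m : Fin a → ℤ) : (Fin a → Kˣ) →* Kˣ where
  toFun c := ∏ i, c i ^ m i
  map_one' := by simp
  map_mul' c d := by simp [mul_zpow, Finset.prod_mul_distrib]

/-- The cocharacter `z ↦ (z ^ mᵢ)ᵢ` of the standard torus. -/
def monomialCochar (K : Type*) [Field K] {a : ℕ} (m : Fin a → ℤ) : Kˣ →* (Fin a → Kˣ) where
  toFun z i := z ^ m i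
  map_one' := by funext; simp
  map_mul' c d := by funext; simp [mul_zpow]

lemma monomialChar_apply (m : Fin a → ℤ) (c : Fin a → Kˣ) :
    monomialChar K m c = ∏ i, c i ^ m i := rfl

@[simp] lemma monomialCochar_apply (m : Fin a → ℤ) (z : Kˣ) (i : Fin a) :
    monomialCochar K m z i = z ^ m i := rfl

lemma monomialChar_add (m m' : Fin a → ℤ) :
    monomialChar K (m + m') = monomialChar K m * monomialChar K m' := by
  refine MonoidHom.ext fun c => ?_
  simp [monomialChar_apply, _root_.zpow_add, Finset.prod_mul_distrib]

lemma monomialChar_mulSingle (m : Fin a → ℤ) (i : Fin a) (z : Kˣ) :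
    monomialChar K m (Pi.mulSingle i z) = z ^ m i := by
  rw [monomialChar_apply, Finset.prod_eq_single i]
  · simp
  · intro j _ hj; simp [hj]
  · simp

lemma monomialChar_single (i : Fin a) (k : ℤ) (c : Fin a → Kˣ) :
    monomialChar K (Pi.single i k) c = c i ^ k := by
  rw [monomialChar_apply, Finset.prod_eq_single i]
  · simp
  · intro j _ hj; simp [hj]
  · simp

lemma monomialChar_injective [Infinite K] :
    Function.Injective (monomialChar K : (Fin a → ℤ) → _) := by
  intro m m' h
  funext i
  refine eq_of_forall_zpow_eq fun z : Kˣ => ?_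
  rw [← monomialChar_mulSingle, h, monomialChar_mulSingle]

lemma monomialCochar_injective [Infinite K] :
    Function.Injective (monomialCochar K : (Fin a → ℤ) → _) := by
  intro m m' h
  funext i
  exact eq_of_forall_zpow_eq fun z : Kˣ => congrFun (DFunLike.congr_fun h z) i

/-- The algebra of polynomial functions on the standard torus. -/
def torusAlgebra (K : Type*) [Field K] (a : ℕ) : Subalgebra K ((Fin a → Kˣ) → K) :=
  Algebra.adjoin K (Set.range fun (i : Fin a) (c : Fin a → Kˣ) => (c i : K))

lemma coord_mem_torusAlgebra (i : Fin a) : (fun c : Fin a → Kˣ => (c i : K)) ∈ torusAlgebra K a :=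
  Algebra.subset_adjoin ⟨i, rfl⟩

/-- A character of the standard torus given by a Laurent polynomial is a monomial. -/
lemma exists_eq_monomialChar {f : (Fin a → Kˣ) →* Kˣ} {k : ℕ}
    (hf : (fun c => (f c : K) * (∏ i, (c i : K)) ^ k) ∈ torusAlgebra K a) :
    ∃ m, f = monomialChar K m := by
  let x (i : Fin a) : (Fin a → Kˣ) →* K := (Units.coeHom K).comp (Pi.evalMonoidHom _ i)
  let g : (Fin a → Kˣ) →* Kˣ := f * monomialChar K fun _ => (k : ℤ)
  have h1 : (Units.coeHom K).comp g ∈ Submonoid.closure (Set.range x) := by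
    refine mem_closure_of_mem_adjoin ?_
    rw [← Set.range_comp]
    convert! hf using 1
    funext c
    simp [g, monomialChar_apply, Finset.prod_pow]
  have h2 : ∀ h ∈ Submonoid.closure (Set.range x), ∃ m : Fin a → ℤ,
      h = (Units.coeHom K).comp (monomialChar K m) := by
    intro h hh
    induction hh using Submonoid.closure_induction with
    | mem h hh =>
      obtain ⟨i, rfl⟩ := hh
      refine ⟨Pi.single i 1, ?_⟩
      ext c
      simp [x, monomialChar_single]
    | one => exact ⟨0, by ext c; simp [monomialChar_apply]⟩
    | mul h h' _ _ ih ih' =>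
      obtain ⟨m, rfl⟩ := ih
      obtain ⟨m', rfl⟩ := ih'
      exact ⟨m + m', by ext c; simp [monomialChar_add]⟩
  obtain ⟨m, hm⟩ := h2 _ h1
  have h3 : g = monomialChar K m := by
    refine MonoidHom.ext fun c => Units.ext ?_
    exact DFunLike.congr_fun hm c
  refine ⟨m - fun _ => (k : ℤ), ?_⟩
  have h4 : f * monomialChar K (fun _ => (k : ℤ)) =
      monomialChar K (m - fun _ => (k : ℤ)) * monomialChar K (fun _ => (k : ℤ)) := by
    rw [← monomialChar_add, sub_add_cancel]
    exact h3
  exact mul_right_cancel h4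

lemma exists_monomialChar_mem_torusAlgebra (m : Fin a → ℤ) : ∃ k : ℕ,
    (fun c => (monomialChar K m c : K) * (∏ i, (c i : K)) ^ k) ∈ torusAlgebra K a := by
  refine ⟨∑ i, (m i).natAbs, ?_⟩
  have h1 (i : Fin a) : 0 ≤ m i + ((∑ j, (m j).natAbs : ℕ) : ℤ) := by
    have := Finset.single_le_sum (f := fun j => (m j).natAbs) (fun _ _ => Nat.zero_le _)
      (Finset.mem_univ i)
    omega
  have h2 : (fun c : Fin a → Kˣ => (monomialChar K m c : K) *
      (∏ i, (c i : K)) ^ (∑ i, (m i).natAbs)) =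
      ∏ i, (fun c : Fin a → Kˣ => (c i : K)) ^ (m i + ((∑ j, (m j).natAbs : ℕ) : ℤ)).toNat := by
    funext c
    rw [Finset.prod_apply, monomialChar_apply, Units.coe_prod, ← Finset.prod_pow,
      ← Finset.prod_mul_distrib]
    refine Finset.prod_congr rfl fun i _ => ?_
    rw [Pi.pow_apply, Units.val_zpow_eq_zpow_val, ← zpow_natCast, ← zpow_natCast,
      Int.toNat_of_nonneg (h1 i), zpow_add₀ (c i).ne_zero]
  rw [h2]
  exact Subalgebra.prod_mem _ fun i _ => Subalgebra.pow_mem _ (coord_mem_torusAlgebra i) _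

/-- An endomorphism of `Kˣ` given by a Laurent polynomial is a power map. -/
lemma exists_eq_zpow {f : Kˣ →* Kˣ} {k : ℕ}
    (hf : (fun z : Kˣ => (f z : K) * (z : K) ^ k) ∈ Algebra.adjoin K {(Units.val : Kˣ → K)}) :
    ∃ m : ℤ, ∀ z, f z = z ^ m := by
  have h1 : (Units.coeHom K).comp (f * powMonoidHom k) ∈ Submonoid.closure {Units.coeHom K} := by
    refine mem_closure_of_mem_adjoin ?_
    rw [Set.image_singleton]
    exact hf
  obtain ⟨e, he⟩ := Submonoid.mem_closure_singleton.1 h1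
  refine ⟨e - k, fun z => ?_⟩
  rw [_root_.zpow_sub, zpow_natCast, zpow_natCast, eq_mul_inv_iff_mul_eq]
  exact Units.ext (DFunLike.congr_fun he z).symm

lemma zpow_mul_pow_mem_adjoin {m : ℤ} {k : ℕ} (h : m.natAbs ≤ k) :
    (fun z : Kˣ => ((z ^ m : Kˣ) : K) * (z : K) ^ k) ∈
      Algebra.adjoin K {(Units.val : Kˣ → K)} := by
  have h1 : (fun z : Kˣ => ((z ^ m : Kˣ) : K) * (z : K) ^ k) =
      (Units.val : Kˣ → K) ^ (m + k).toNat := by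
    funext z
    rw [Pi.pow_apply, Units.val_zpow_eq_zpow_val, ← zpow_natCast, ← zpow_natCast,
      Int.toNat_of_nonneg (by omega), zpow_add₀ z.ne_zero]
  rw [h1]
  exact Subalgebra.pow_mem _ (Algebra.self_mem_adjoin_singleton K _) _

end Characters

/-! ### The maximal torus of a block general linear group -/

section Torus

variable {K : Type*} [Field K]

/-- The matrix-valued function `M` has its entries in the algebra `A` of functions. -/
def EntriesIn {X ι κ : Type*} (A : Subalgebra K (X → K)) (M : X → Matrix ι κ K) : Prop :=
  ∀ i j, (fun x => M x i j) ∈ A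

lemma EntriesIn.mul {X ι κ μ : Type*} [Fintype κ] {A : Subalgebra K (X → K)}
    {M : X → Matrix ι κ K} {N : X → Matrix κ μ K} (hM : EntriesIn A M) (hN : EntriesIn A N) :
    EntriesIn A fun x => M x * N x := by
  intro i j
  have h : (fun x => (M x * N x) i j) = ∑ k, (fun x => M x i k) * fun x => N x k j := by
    funext x
    simp [Matrix.mul_apply]
  rw [h]
  exact A.sum_mem fun k _ => A.mul_mem (hM i k) (hN k j)

lemma entriesIn_const {X ι κ : Type*} (A : Subalgebra K (X → K)) (M : Matrix ι κ K) :
    EntriesIn A fun _ => M := fun i j => A.algebraMap_mem (M i j)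

variable {a n : ℕ} {κ : Type*} [Fintype κ] [DecidableEq κ] (σ : Fin a ⊕ κ ≃ Fin n)
  (u : GL (Fin n) K)

/-- The embedding `g ↦ u (g, 1) u⁻¹` of `GL_a` into `GL_n`. -/
def conjBlock : GL (Fin a) K →* GL (Fin n) K := (MulAut.conj u).toMonoidHom.comp (block σ)

lemma conjBlock_apply (g : GL (Fin a) K) : conjBlock σ u g = u * block σ g * u⁻¹ := rfl

lemma val_conjBlock (g : GL (Fin a) K) :
    (conjBlock σ u g).1 = u.1 * blockMatrix σ g.1 * u⁻¹.1 := rfl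

lemma inv_mul_conjBlock_mul (g : GL (Fin a) K) :
    u⁻¹.1 * (conjBlock σ u g).1 * u.1 = blockMatrix σ g.1 := by
  rw [val_conjBlock, mul_assoc, mul_assoc, Units.inv_mul, mul_one, Units.inv_mul_cancel_left]

lemma conjBlock_injective : Function.Injective (conjBlock σ u) :=
  (MulAut.conj u).injective.comp (block_injective σ)

lemma det_conjBlock (g : GL (Fin a) K) : (conjBlock σ u g).1.det = g.1.det := by
  rw [val_conjBlock, det_mul, det_mul, mul_right_comm, ← det_mul, Units.mul_inv, det_one, one_mul,
    det_blockMatrix]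

lemma EntriesIn.conjBlock {X : Type*} {A : Subalgebra K (X → K)} {g : X → GL (Fin a) K}
    (hg : EntriesIn A fun x => (g x).1) : EntriesIn A fun x => (conjBlock σ u (g x)).1 := by
  refine ((entriesIn_const A u.1).mul ?_).mul (entriesIn_const A u⁻¹.1)
  intro b b'
  obtain ⟨b, rfl⟩ := σ.surjective b
  obtain ⟨b', rfl⟩ := σ.surjective b'
  rcases b with i | i <;> rcases b' with j | j
  all_goals change (fun x => blockMatrix σ (g x).1 _ _) ∈ A
  · simpa only [blockMatrix_inl_inl] using hg i j
  · simp only [blockMatrix_inl_inr]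
    exact A.zero_mem
  · simp only [blockMatrix_inr_inl]
    exact A.zero_mem
  · simp only [blockMatrix_inr_inr]
    exact A.algebraMap_mem _

lemma EntriesIn.of_conjBlock {X : Type*} {A : Subalgebra K (X → K)} {g : X → GL (Fin a) K}
    (hg : EntriesIn A fun x => (HowePan.conjBlock σ u (g x)).1) :
    EntriesIn A fun x => (g x).1 := by
  intro i j
  have h := ((entriesIn_const A u⁻¹.1).mul hg).mul (entriesIn_const A u.1)
    (σ (.inl i)) (σ (.inl j))
  simpa only [inv_mul_conjBlock_mul, blockMatrix_inl_inl] using h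

/-- The diagonal matrices, as a homomorphism from the standard torus. -/
def diagGL (K : Type*) [Field K] (a : ℕ) : (Fin a → Kˣ) →* GL (Fin a) K where
  toFun c := ⟨diagonal fun i => (c i : K), diagonal fun i => ((c i)⁻¹ : Kˣ),
    by simp [diagonal_mul_diagonal], by simp [diagonal_mul_diagonal]⟩
  map_one' := Units.ext diagonal_one
  map_mul' c d := Units.ext (diagonal_mul_diagonal _ _).symm

lemma val_diagGL (c : Fin a → Kˣ) : (diagGL K a c).1 = diagonal fun i => (c i : K) := rfl

lemma diagGL_injective : Function.Injective (diagGL K a) := by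
  intro c d h
  funext i
  refine Units.ext ?_
  simpa [val_diagGL] using congrArg (fun g : GL (Fin a) K => g.1 i i) h

/-- The maximal torus `u (diag(c), 1) u⁻¹` of the block `GL_a`. -/
def conjTorus : Subgroup (GL (Fin n) K) := ((conjBlock σ u).comp (diagGL K a)).range

/-- The coordinates of the maximal torus. -/
noncomputable def torusEquiv : (Fin a → Kˣ) ≃* conjTorus σ u :=
  MonoidHom.ofInjective ((conjBlock_injective σ u).comp diagGL_injective)

@[simp] lemma coe_torusEquiv (c : Fin a → Kˣ) :
    (torusEquiv σ u c).1 = conjBlock σ u (diagGL K a c) := rfl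

lemma entriesIn_diagGL : EntriesIn (torusAlgebra K a) fun c => (diagGL K a c).1 := by
  intro i j
  by_cases h : i = j
  · subst h
    simpa [val_diagGL] using coord_mem_torusAlgebra i
  · simp only [val_diagGL, diagonal_apply_ne _ h]
    exact (torusAlgebra K a).zero_mem

lemma isTorus_conjTorus : IsTorus (conjTorus σ u) := by
  have h (i j : Fin n) := exists_eval_eq_of_mem_adjoin
    ((entriesIn_diagGL (K := K) (a := a)).conjBlock σ u i j)
  choose P hP using h
  exact ⟨a, 0, _, P, fun c i j => by simpa using hP i j c, rfl⟩

lemma exists_ne_one [Infinite K] : ∃ z : Kˣ, z ≠ 1 := by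
  by_contra! h
  have := eq_of_forall_zpow_eq (K := K) (m := 0) (m' := 1) fun z => by simp [h z]
  exact zero_ne_one this

lemma isMaximalTorus_conjTorus [Infinite K] :
    IsMaximalTorus (conjBlock σ u).range (conjTorus σ u) := by
  refine ⟨?_, isTorus_conjTorus σ u, ?_⟩
  · rintro _ ⟨c, rfl⟩
    exact ⟨_, rfl⟩
  · rintro S ⟨r, k, f, -, -, rfl⟩ hSH hTS
    refine le_antisymm ?_ hTS
    intro x hx
    obtain ⟨g, rfl⟩ := hSH hx
    -- an element of the torus commutes with all diagonal matrices, hence is diagonal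
    have hcomm (c : Fin a → Kˣ) : g * diagGL K a c = diagGL K a c * g := by
      obtain ⟨y, hy⟩ := hx
      obtain ⟨y', hy'⟩ := hTS ⟨c, rfl⟩
      apply conjBlock_injective σ u
      have h1 : conjBlock σ u (diagGL K a c) = f y' := hy'.symm
      rw [map_mul, map_mul, ← hy, h1, ← map_mul, ← map_mul, mul_comm]
    have hoff (i j : Fin a) (hij : i ≠ j) : g.1 i j = 0 := by
      obtain ⟨z, hz⟩ := exists_ne_one (K := K)
      have h1 : (g.1 * (diagGL K a (Pi.mulSingle j z)).1) i j =
          ((diagGL K a (Pi.mulSingle j z)).1 * g.1) i j :=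
        congrArg (fun g : GL (Fin a) K => g.1 i j) (hcomm (Pi.mulSingle j z))
      rw [val_diagGL, mul_diagonal, diagonal_mul, Pi.mulSingle_eq_same,
        Pi.mulSingle_eq_of_ne hij, Units.val_one, one_mul] at h1
      by_contra h0
      exact hz (Units.ext (mul_left_cancel₀ h0 (h1.trans (mul_one _).symm)))
    have hdiag : g.1 = diagonal fun i => g.1 i i := by
      ext i j
      by_cases hij : i = j
      · simp [hij]
      · simp [hij, hoff]
    have hne (i : Fin a) : g.1 i i ≠ 0 := by
      have h1 := (isUnit_iff_isUnit_det _).1 g.isUnit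
      rw [hdiag, det_diagonal, isUnit_iff_ne_zero, Finset.prod_ne_zero_iff] at h1
      exact h1 i (Finset.mem_univ i)
    refine ⟨fun i => Units.mk0 _ (hne i), ?_⟩
    rw [MonoidHom.comp_apply]
    congr 1
    exact Units.ext hdiag.symm

/-- The characters of the maximal torus are the monomials. -/
lemma algChar_conjTorus : algChar (conjTorus σ u) =
    Set.range fun m : Fin a → ℤ => (monomialChar K m).comp (torusEquiv σ u).symm.toMonoidHom := by
  have hdet (c : Fin a → Kˣ) : (torusEquiv σ u c).1.1.det = ∏ i, (c i : K) := by
    rw [coe_torusEquiv, det_conjBlock, val_diagGL, det_diagonal]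
  have hentry := (entriesIn_diagGL (K := K) (a := a)).conjBlock σ u
  ext χ
  constructor
  · rintro ⟨k, P, hP⟩
    have h1 : (fun c => ((χ.comp (torusEquiv σ u).toMonoidHom c : Kˣ) : K) *
        (∏ i, (c i : K)) ^ k) ∈ torusAlgebra K a := by
      have h2 := eval_mem_subalgebra (torusAlgebra K a)
        (y := fun (m : Fin n × Fin n) c => (torusEquiv σ u c).1.1 m.1 m.2)
        (fun m => hentry m.1 m.2) P
      convert! h2 using 1
      funext c
      rw [← hP, hdet]
      rfl
    obtain ⟨m, hm⟩ := exists_eq_monomialChar h1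
    refine ⟨m, MonoidHom.ext fun t => ?_⟩
    change monomialChar K m ((torusEquiv σ u).symm t) = χ t
    rw [← hm]
    simp
  · rintro ⟨m, rfl⟩
    obtain ⟨k, hk⟩ := exists_monomialChar_mem_torusAlgebra (K := K) m
    -- the coordinates of the torus are polynomials in the matrix entries
    let y (m : Fin n × Fin n) (t : conjTorus σ u) : K := t.1.1 m.1 m.2
    let A := Algebra.adjoin K (Set.range y)
    have hy : EntriesIn A fun t : conjTorus σ u => (diagGL K a ((torusEquiv σ u).symm t)).1 := by
      refine EntriesIn.of_conjBlock σ u fun i j => ?_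
      have h2 : (fun t : conjTorus σ u =>
          (conjBlock σ u (diagGL K a ((torusEquiv σ u).symm t))).1 i j) = y (i, j) := by
        funext t
        rw [← coe_torusEquiv, MulEquiv.apply_symm_apply]
      rw [h2]
      exact Algebra.subset_adjoin ⟨_, rfl⟩
    obtain ⟨P, hP⟩ := exists_eval_eq_of_mem_adjoin hk
    have h3 := eval_mem_subalgebra A
      (y := fun (i : Fin a) t => ((torusEquiv σ u).symm t i : K))
      (fun i => by simpa [val_diagGL] using hy i i) P
    obtain ⟨Q, hQ⟩ := exists_eval_eq_of_mem_adjoin h3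
    refine ⟨k, Q, fun t => ?_⟩
    rw [← hQ, ← hP, ← hdet, MulEquiv.apply_symm_apply]
    rfl

/-- The cocharacters of the maximal torus are the power maps. -/
lemma algCochar_conjTorus : algCochar (conjTorus σ u) =
    Set.range fun m : Fin a → ℤ => (torusEquiv σ u).toMonoidHom.comp (monomialCochar K m) := by
  let A := Algebra.adjoin K {(Units.val : Kˣ → K)}
  ext γ
  constructor
  · rintro ⟨k, P, hP⟩
    let f (i : Fin a) : Kˣ →* Kˣ :=
      ((Pi.evalMonoidHom _ i).comp (torusEquiv σ u).symm.toMonoidHom).comp γ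
    have hf (i : Fin a) : (fun z : Kˣ => (f i z : K) * (z : K) ^ k) ∈ A := by
      have h1 : EntriesIn A fun z : Kˣ => (z : K) ^ k • (γ z).1.1 := fun i j => by
        have h2 := polynomial_eval_mem_subalgebra A (Algebra.self_mem_adjoin_singleton K _) (P i j)
        convert! h2 using 1
        funext z
        rw [← hP, mul_comm]
        rfl
      have h3 := ((entriesIn_const A u⁻¹.1).mul h1).mul (entriesIn_const A u.1)
        (σ (.inl i)) (σ (.inl i))
      convert! h3 using 1
      funext z
      have h4 : (γ z).1 = conjBlock σ u (diagGL K a ((torusEquiv σ u).symm (γ z))) := by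
        rw [← coe_torusEquiv, MulEquiv.apply_symm_apply]
      change _ = (u⁻¹.1 * ((z : K) ^ k • (γ z).1.1) * u.1) (σ (.inl i)) (σ (.inl i))
      rw [mul_smul_comm, smul_mul_assoc, h4, inv_mul_conjBlock_mul, Matrix.smul_apply,
        blockMatrix_inl_inl, val_diagGL, diagonal_apply_eq, smul_eq_mul, mul_comm]
      rfl
    choose m hm using fun i => exists_eq_zpow (hf i)
    refine ⟨m, MonoidHom.ext fun z => ?_⟩
    have h5 : monomialCochar K m z = (torusEquiv σ u).symm (γ z) := by
      funext i
      exact (hm i z).symm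
    simp [h5]
  · rintro ⟨m, rfl⟩
    let k := ∑ i, (m i).natAbs
    have hk (i : Fin a) : (m i).natAbs ≤ k :=
      Finset.single_le_sum (f := fun j => (m j).natAbs) (fun _ _ => Nat.zero_le _)
        (Finset.mem_univ i)
    have hzero : (fun _ : Kˣ => (0 : K)) ∈ A := A.zero_mem
    have hpow : (fun z : Kˣ => (z : K) ^ k) ∈ A :=
      A.pow_mem (Algebra.self_mem_adjoin_singleton K _) k
    have h1 : EntriesIn A fun z : Kˣ =>
        (z : K) ^ k • blockMatrix σ (diagGL K a (monomialCochar K m z)).1 := by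
      intro b b'
      obtain ⟨b, rfl⟩ := σ.surjective b
      obtain ⟨b', rfl⟩ := σ.surjective b'
      rcases b with i | i <;> rcases b' with j | j
      · by_cases hij : i = j
        · subst hij
          simpa [val_diagGL, mul_comm] using zpow_mul_pow_mem_adjoin (K := K) (hk i)
        · simpa [val_diagGL, hij] using hzero
      · simpa using hzero
      · simpa using hzero
      · by_cases hij : i = j
        · simpa [hij] using hpow
        · simpa [hij] using hzero
    have h2 := ((entriesIn_const A u.1).mul h1).mul (entriesIn_const A u⁻¹.1)
    have h3 (i j : Fin n) := exists_polynomial_eval_eq_of_mem_adjoin (h2 i j)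
    choose P hP using h3
    refine ⟨k, P, fun z i j => ?_⟩
    rw [← hP, mul_comm]
    change (z : K) ^ k * (u.1 * blockMatrix σ (diagGL K a (monomialCochar K m z)).1 * u⁻¹.1) i j =
      (u.1 * ((z : K) ^ k • blockMatrix σ (diagGL K a (monomialCochar K m z)).1) * u⁻¹.1) i j
    rw [mul_smul_comm, smul_mul_assoc, Matrix.smul_apply, smul_eq_mul]

/-- The characters of the maximal torus form `ℤ^a`. -/
noncomputable def charEquiv [Infinite K] : (Fin a → ℤ) ≃ algChar (conjTorus σ u) :=
  Equiv.ofBijective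
    (fun m => ⟨(monomialChar K m).comp (torusEquiv σ u).symm.toMonoidHom, by
      rw [algChar_conjTorus]; exact ⟨m, rfl⟩⟩)
    ⟨fun m m' h => monomialChar_injective (MonoidHom.ext fun c => by
        simpa using DFunLike.congr_fun (congrArg Subtype.val h) (torusEquiv σ u c)),
      fun χ => by
        obtain ⟨m, hm⟩ := (algChar_conjTorus σ u).le χ.2
        exact ⟨m, Subtype.ext hm⟩⟩

/-- The cocharacters of the maximal torus form `ℤ^a`. -/
noncomputable def cocharEquiv [Infinite K] : (Fin a → ℤ) ≃ algCochar (conjTorus σ u) :=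
  Equiv.ofBijective
    (fun m => ⟨(torusEquiv σ u).toMonoidHom.comp (monomialCochar K m), by
      rw [algCochar_conjTorus]; exact ⟨m, rfl⟩⟩)
    ⟨fun m m' h => monomialCochar_injective (MonoidHom.ext fun z => (torusEquiv σ u).injective
        (DFunLike.congr_fun (congrArg Subtype.val h) z)),
      fun γ => by
        obtain ⟨m, hm⟩ := (algCochar_conjTorus σ u).le γ.2
        exact ⟨m, Subtype.ext hm⟩⟩

lemma charEquiv_apply [Infinite K] (m : Fin a → ℤ) (c : Fin a → Kˣ) :
    (charEquiv σ u m).1 (torusEquiv σ u c) = monomialChar K m c := by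
  change monomialChar K m ((torusEquiv σ u).symm (torusEquiv σ u c)) = _
  rw [MulEquiv.symm_apply_apply]

lemma cocharEquiv_apply [Infinite K] (m : Fin a → ℤ) (z : Kˣ) :
    (cocharEquiv σ u m).1 z = torusEquiv σ u (monomialCochar K m z) := rfl

end Torus

/-! ### Roots and coroots of the general linear group -/

section Roots

variable {K : Type*} [Field K] {a : ℕ}

/-- The root `e_i - e_j`, both as a character and as a cocharacter of the standard torus. -/
def rootVec {a : ℕ} (i j : Fin a) : Fin a → ℤ := Pi.single i 1 - Pi.single j 1

lemma monomialChar_rootVec (i j : Fin a) (c : Fin a → Kˣ) :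
    monomialChar K (rootVec i j) c = c i * (c j)⁻¹ := by
  have h : rootVec i j = Pi.single i 1 + Pi.single j (-1) := by
    rw [rootVec, sub_eq_add_neg, ← Pi.single_neg]
  rw [h, monomialChar_add, MonoidHom.mul_apply, monomialChar_single, monomialChar_single, zpow_one,
    _root_.zpow_neg_one]

/-- An ordered pair of indices, followed by the other indices. -/
noncomputable def pairEquiv {i j : Fin a} (hij : i ≠ j) :
    Fin 2 ⊕ {k : Fin a // k ≠ i ∧ k ≠ j} ≃ Fin a :=
  Equiv.ofBijective (Sum.elim ![i, j] Subtype.val) (by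
    constructor
    · rintro (x | ⟨x, hx⟩) (y | ⟨y, hy⟩) h
      · fin_cases x <;> fin_cases y <;> simp_all [hij.symm]
      · fin_cases x
        · exact absurd h.symm hy.1
        · exact absurd h.symm hy.2
      · fin_cases y
        · exact absurd h hx.1
        · exact absurd h hx.2
      · exact congrArg Sum.inr (Subtype.ext h)
    · intro k
      by_cases hi : k = i
      · exact ⟨.inl 0, hi.symm⟩
      · by_cases hj : k = j
        · exact ⟨.inl 1, hj.symm⟩
        · exact ⟨.inr ⟨k, hi, hj⟩, rfl⟩)

@[simp] lemma pairEquiv_inl_zero {i j : Fin a} (hij : i ≠ j) : pairEquiv hij (.inl 0) = i := rfl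

@[simp] lemma pairEquiv_inl_one {i j : Fin a} (hij : i ≠ j) : pairEquiv hij (.inl 1) = j := rfl

@[simp] lemma pairEquiv_inr {i j : Fin a} (hij : i ≠ j) (k : {k : Fin a // k ≠ i ∧ k ≠ j}) :
    pairEquiv hij (.inr k) = k.1 := rfl

lemma blockMatrix_pairEquiv_upper {i j : Fin a} (hij : i ≠ j) (y : K) :
    blockMatrix (pairEquiv hij) !![1, y; 0, 1] = transvection i j y := by
  refine matrix_ext_sum (pairEquiv hij) ?_ ?_ ?_ ?_
  · intro x x'
    rw [blockMatrix_inl_inl]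
    fin_cases x <;> fin_cases x' <;>
      simp [transvection, hij, hij.symm]
  · rintro x ⟨k, hk⟩
    rw [blockMatrix_inl_inr]
    fin_cases x <;>
      simp [transvection, hij, hk.1.symm, hk.2.symm]
  · rintro ⟨k, hk⟩ x
    rw [blockMatrix_inr_inl]
    fin_cases x <;>
      simp [transvection, hij.symm, hk.1, hk.2, hk.1.symm]
  · rintro ⟨k, hk⟩ ⟨k', hk'⟩
    rw [blockMatrix_inr_inr]
    simp [transvection, hk.1.symm, Matrix.one_apply]

lemma blockMatrix_pairEquiv_lower {i j : Fin a} (hij : i ≠ j) (y : K) :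
    blockMatrix (pairEquiv hij) !![1, 0; y, 1] = transvection j i y := by
  refine matrix_ext_sum (pairEquiv hij) ?_ ?_ ?_ ?_
  · intro x x'
    rw [blockMatrix_inl_inl]
    fin_cases x <;> fin_cases x' <;>
      simp [transvection, hij, hij.symm]
  · rintro x ⟨k, hk⟩
    rw [blockMatrix_inl_inr]
    fin_cases x <;>
      simp [transvection, hij.symm, hk.1.symm, hk.2.symm]
  · rintro ⟨k, hk⟩ x
    rw [blockMatrix_inr_inl]
    fin_cases x <;>
      simp [transvection, hij, hk.1, hk.2, hk.2.symm]
  · rintro ⟨k, hk⟩ ⟨k', hk'⟩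
    rw [blockMatrix_inr_inr]
    simp [transvection, hk.2.symm, Matrix.one_apply]

lemma blockMatrix_pairEquiv_diag {i j : Fin a} (hij : i ≠ j) (z : Kˣ) :
    blockMatrix (pairEquiv hij) !![(z : K), 0; 0, ((z⁻¹ : Kˣ) : K)] =
      (diagGL K a (monomialCochar K (rootVec i j) z)).1 := by
  rw [val_diagGL]
  refine matrix_ext_sum (pairEquiv hij) ?_ ?_ ?_ ?_
  · intro x x'
    rw [blockMatrix_inl_inl]
    fin_cases x <;> fin_cases x' <;> simp [rootVec, hij, hij.symm]
  · rintro x ⟨k, hk⟩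
    rw [blockMatrix_inl_inr]
    fin_cases x <;> simp [hk.1.symm, hk.2.symm]
  · rintro ⟨k, hk⟩ x
    rw [blockMatrix_inr_inl]
    fin_cases x <;> simp [hk.1, hk.2]
  · rintro ⟨k, hk⟩ ⟨k', hk'⟩
    rw [blockMatrix_inr_inr]
    by_cases h : k = k'
    · subst h
      simp [rootVec, hk.1, hk.2]
    · simp [h]

lemma diagGL_mul_transvection_mul_inv (i j : Fin a) (c : Fin a → Kˣ) (y : K) :
    (diagGL K a c).1 * transvection i j y * (diagGL K a c)⁻¹.1 =
      transvection i j (((c i * (c j)⁻¹ : Kˣ) : K) * y) := by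
  rw [transvection, mul_add, add_mul, mul_one, Units.mul_inv, transvection]
  congr 1
  have h : (diagGL K a c)⁻¹.1 = diagonal fun k => (((c k)⁻¹ : Kˣ) : K) := rfl
  rw [h, val_diagGL]
  ext k l
  rw [mul_diagonal, diagonal_mul, single_apply, single_apply]
  by_cases hkl : i = k ∧ j = l
  · obtain ⟨rfl, rfl⟩ := hkl
    simp
    ring
  · simp [hkl]

/-- Weights of the coefficients of a polynomial map into matrices that is equivariant under the
diagonal torus. -/
lemma coeff_of_equivariant [Infinite K] {M : K → Matrix (Fin a) (Fin a) K}
    {Q : Fin a → Fin a → K[X]}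
    (hQ : ∀ x k l, M x k l = (Q k l).eval x) {c : Fin a → Kˣ} {w : K}
    (h : ∀ x, (diagGL K a c).1 * M x * (diagGL K a c)⁻¹.1 = M (w * x)) (k l : Fin a) (d : ℕ) :
    ((c k * (c l)⁻¹ : Kˣ) : K) * (Q k l).coeff d = w ^ d * (Q k l).coeff d := by
  have h1 : C ((c k * (c l)⁻¹ : Kˣ) : K) * Q k l = (Q k l).comp (C w * X) := by
    refine Polynomial.funext fun x => ?_
    have h2 := congrFun (congrFun (h x) k) l
    have h3 : (diagGL K a c)⁻¹.1 = diagonal fun k => (((c k)⁻¹ : Kˣ) : K) := rfl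
    rw [h3, val_diagGL, mul_diagonal, diagonal_mul, hQ, hQ] at h2
    rw [eval_mul, eval_C, eval_comp, eval_mul, eval_C, eval_X, ← h2, Units.val_mul]
    ring
  have h4 := congrArg (fun P => P.coeff d) h1
  simp only [coeff_C_mul, comp_C_mul_X_coeff] at h4
  rw [h4, mul_comm]

/-- A polynomial map equivariant with respect to the root `e_i - e_j` is a one-parameter group of
transvections. -/
lemma eq_transvection_of_equivariant [Infinite K] {M : K → Matrix (Fin a) (Fin a) K}
    {Q : Fin a → Fin a → K[X]} (hQ : ∀ x k l, M x k l = (Q k l).eval x) (hM : M 0 = 1)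
    {i j : Fin a} (hij : i ≠ j)
    (h : ∀ c x, (diagGL K a c).1 * M x * (diagGL K a c)⁻¹.1 = M ((c i * (c j)⁻¹ : Kˣ) * x))
    (x : K) : M x = transvection i j ((Q i j).coeff 1 * x) := by
  -- a coefficient of degree `d` at `(k, l)` forces `e_k - e_l = d (e_i - e_j)`
  have h1 (k l : Fin a) (d : ℕ) (hd : d ≠ 0) (hc : (Q k l).coeff d ≠ 0) :
      k = i ∧ l = j ∧ d = 1 := by
    have h2 : monomialChar K (rootVec k l) = monomialChar K (d • rootVec i j) := by
      refine MonoidHom.ext fun c => ?_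
      have h3 : monomialChar K (d • rootVec i j) c = monomialChar K (rootVec i j) c ^ d := by
        simp [monomialChar_apply, ← Finset.prod_pow, mul_comm (d : ℤ), _root_.zpow_mul, zpow_natCast]
      rw [h3, monomialChar_rootVec, monomialChar_rootVec]
      refine Units.ext (mul_right_cancel₀ hc ?_)
      rw [coeff_of_equivariant hQ (h c), Units.val_pow_eq_pow_val]
    have h4 := monomialChar_injective h2
    have hi := congrFun h4 i
    have hj := congrFun h4 j
    simp only [rootVec, Pi.sub_apply, Pi.smul_apply, Pi.single_apply, hij, hij.symm, if_true,
      if_false, nsmul_eq_mul] at hi hj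
    grind
  ext k l
  rw [hQ, transvection, Matrix.add_apply, ← hM, hQ, single_apply]
  have h5 : Q k l = C ((Q k l).eval 0) + C (if i = k ∧ j = l then (Q i j).coeff 1 else 0) * X := by
    ext d
    rw [coeff_add, coeff_C, coeff_C_mul, coeff_X, ← coeff_zero_eq_eval_zero]
    by_cases hd : d = 0
    · simp [hd]
    · by_cases hc : (Q k l).coeff d = 0
      · by_cases h6 : i = k ∧ j = l ∧ d = 1
        · obtain ⟨rfl, rfl, rfl⟩ := h6
          simp
        · rw [hc]
          grind
      · obtain ⟨rfl, rfl, rfl⟩ := h1 k l d hd hc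
        simp
  rw [h5]
  by_cases h6 : i = k ∧ j = l
  · simp [h6]
  · simp [h6]

/-- The torus of `SL₂` acts on the upper root subgroup by the square character. -/
lemma diagSL_mul_upperSL (z : Kˣ) (x : K) :
    diagSL z * upperSL x = upperSL ((z : K) ^ 2 * x) * diagSL z := by
  refine Subtype.ext ?_
  change !![(z : K), 0; 0, ((z⁻¹ : Kˣ) : K)] * !![1, x; 0, 1] =
    !![1, (z : K) ^ 2 * x; 0, 1] * !![(z : K), 0; 0, ((z⁻¹ : Kˣ) : K)]
  have hz : (z : K) * ((z⁻¹ : Kˣ) : K) = 1 := z.mul_inv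
  have h1 : (z : K) ^ 2 * x * ((z⁻¹ : Kˣ) : K) = z * x := by
    linear_combination (z : K) * x * hz
  rw [mul_fin_two, mul_fin_two]
  simp only [h1, mul_zero, zero_mul, mul_one, one_mul, add_zero, zero_add]

/-- A representative of the nontrivial element of the Weyl group as a product of unipotents. -/
lemma weyl_relation (b d : K) (h : b * d = 1) :
    (!![1, b; 0, 1] * !![1, 0; -d, 1] * !![1, b; 0, 1] : Matrix (Fin 2) (Fin 2) K) =
      !![0, b; -d, 0] := by
  have h1 : 1 + b * -d = 0 := by linear_combination -h
  have h2 : -d * b + 1 = 0 := by linear_combination -h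
  rw [mul_fin_two, mul_fin_two]
  simp only [mul_zero, zero_mul, mul_one, one_mul, add_zero, zero_add, h1, h2]

lemma upperSL_mul_lowerSL_mul_upperSL (z : Kˣ) :
    (upperSL (z : K) * lowerSL (-((z⁻¹ : Kˣ) : K)) * upperSL (z : K)).1 =
      !![0, (z : K); -((z⁻¹ : Kˣ) : K), 0] :=
  weyl_relation (z : K) ((z⁻¹ : Kˣ) : K) z.mul_inv

/-- A homomorphism from `SL₂` whose restriction to the unipotent and diagonal subgroups is
equivariant for `α` is, up to scaling, the standard one for some root `e_i - e_j`. The images of the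
unipotent matrices are transvections with parameters `b x` and `d x`, and the two expressions
for the Weyl element in terms of these force `b d = 1`. -/
theorem root_of_equivariant [Infinite K] {φ : SpecialLinearGroup (Fin 2) K →* GL (Fin a) K}
    {Q R : Fin a → Fin a → K[X]}
    (hQ : ∀ x k l, (φ (upperSL x)).1 k l = (Q k l).eval x)
    (hR : ∀ x k l, (φ (lowerSL x)).1 k l = (R k l).eval x)
    {i j : Fin a} (hb : (Q i j).coeff 1 ≠ 0)
    {α : (Fin a → Kˣ) →* Kˣ} {γ : Kˣ →* (Fin a → Kˣ)}
    (hu : ∀ c x, diagGL K a c * φ (upperSL x) * (diagGL K a c)⁻¹ = φ (upperSL (α c * x)))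
    (hl : ∀ c x, diagGL K a c * φ (lowerSL x) * (diagGL K a c)⁻¹ =
      φ (lowerSL (((α c)⁻¹ : Kˣ) * x)))
    (hγ : ∀ z, diagGL K a (γ z) = φ (diagSL z)) :
    i ≠ j ∧ α = monomialChar K (rootVec i j) ∧ γ = monomialCochar K (rootVec i j) := by
  have hu' (c : Fin a → Kˣ) (x : K) : (diagGL K a c).1 * (φ (upperSL x)).1 * (diagGL K a c)⁻¹.1 =
      (φ (upperSL (α c * x))).1 := congrArg Units.val (hu c x)
  have hl' (c : Fin a → Kˣ) (x : K) : (diagGL K a c).1 * (φ (lowerSL x)).1 * (diagGL K a c)⁻¹.1 =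
      (φ (lowerSL (((α c)⁻¹ : Kˣ) * x))).1 := congrArg Units.val (hl c x)
  have hαc (c : Fin a → Kˣ) : α c = c i * (c j)⁻¹ := by
    have h1 := coeff_of_equivariant (M := fun x => (φ (upperSL x)).1) hQ (hu' c) i j 1
    rw [pow_one] at h1
    exact Units.ext (mul_right_cancel₀ hb h1).symm
  have hij : i ≠ j := by
    rintro rfl
    -- `diag(z, z⁻¹)` scales the root subgroup by `z²`, so the root is not trivial
    have h1 (z : Kˣ) : z ^ (2 : ℤ) = z ^ (0 : ℤ) := by
      have h2 (x : K) : (diagGL K a (γ z)).1 * (φ (upperSL x)).1 * (diagGL K a (γ z))⁻¹.1 =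
          (φ (upperSL ((z : K) ^ 2 * x))).1 := by
        rw [← Units.val_mul, ← Units.val_mul, hγ, ← map_mul, diagSL_mul_upperSL, map_mul,
          mul_inv_cancel_right]
      have h3 := coeff_of_equivariant (M := fun x => (φ (upperSL x)).1) hQ h2 i i 1
      rw [pow_one, mul_inv_cancel, ← Units.val_pow_eq_pow_val] at h3
      have h4 := Units.ext (mul_right_cancel₀ hb h3)
      rw [zpow_zero, h4]
      exact zpow_ofNat z 2
    exact two_ne_zero (eq_of_forall_zpow_eq h1)
  refine ⟨hij, MonoidHom.ext fun c => by rw [monomialChar_rootVec, hαc], ?_⟩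
  have hone : φ (upperSL 0) = 1 ∧ φ (lowerSL 0) = 1 := by
    have h1 : upperSL (0 : K) = 1 := by
      ext k l
      fin_cases k <;> fin_cases l <;> simp [upperSL]
    have h2 : lowerSL (0 : K) = 1 := by
      ext k l
      fin_cases k <;> fin_cases l <;> simp [lowerSL]
    rw [h1, h2, map_one]
    exact ⟨rfl, rfl⟩
  set b := (Q i j).coeff 1
  set d := (R j i).coeff 1
  have hup (x : K) : (φ (upperSL x)).1 = blockMatrix (pairEquiv hij) !![1, b * x; 0, 1] := by
    rw [blockMatrix_pairEquiv_upper]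
    refine eq_transvection_of_equivariant (M := fun x => (φ (upperSL x)).1) hQ ?_ hij ?_ x
    · rw [hone.1]; rfl
    · intro c x
      rw [hu', hαc]
  have hlo (x : K) : (φ (lowerSL x)).1 = blockMatrix (pairEquiv hij) !![1, 0; d * x, 1] := by
    rw [blockMatrix_pairEquiv_lower]
    refine eq_transvection_of_equivariant (M := fun x => (φ (lowerSL x)).1) hR ?_ hij.symm ?_ x
    · rw [hone.2]; rfl
    · intro c x
      rw [hl', hαc, _root_.mul_inv_rev, inv_inv]
  have hbd : b * d = 1 := by
    have h1 : upperSL (1 : K) * lowerSL (-1) * upperSL 1 =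
        lowerSL (-1) * upperSL 1 * lowerSL (-1) := by
      refine Subtype.ext ?_
      change (!![1, (1 : K); 0, 1] * !![1, 0; -1, 1] * !![1, 1; 0, 1] : Matrix _ _ K) =
        !![1, 0; -1, 1] * !![1, 1; 0, 1] * !![1, 0; -1, 1]
      simp
    have h2 := congrArg (fun x => (φ x).1) h1
    simp only [MonoidHom.map_mul, Units.val_mul, hup, hlo] at h2
    rw [← (blockMatrix (pairEquiv hij)).map_mul, ← (blockMatrix (pairEquiv hij)).map_mul,
      ← (blockMatrix (pairEquiv hij)).map_mul, ← (blockMatrix (pairEquiv hij)).map_mul] at h2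
    have h3 := congrFun (congrFun (blockMatrix_injective _ h2) 0) 1
    simp at h3
    rcases h3 with h3 | h3
    · linear_combination -h3
    · exact absurd h3 hb
  have hw (z : Kˣ) : (φ (upperSL (z : K) * lowerSL (-((z⁻¹ : Kˣ) : K)) * upperSL (z : K))).1 =
      blockMatrix (pairEquiv hij) !![0, b * z; -(d * ((z⁻¹ : Kˣ) : K)), 0] := by
    have hz : b * (z : K) * (d * ((z⁻¹ : Kˣ) : K)) = 1 := by
      rw [mul_mul_mul_comm, hbd, z.mul_inv, one_mul]
    rw [← weyl_relation _ _ hz, MonoidHom.map_mul, MonoidHom.map_mul, Units.val_mul, Units.val_mul,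
      hup, hlo, mul_neg, MonoidHom.map_mul, MonoidHom.map_mul]
  refine MonoidHom.ext fun z => diagGL_injective (Units.ext ?_)
  rw [hγ, ← blockMatrix_pairEquiv_diag hij]
  -- `diag(z, z⁻¹)` is the quotient of the Weyl elements with parameters `z` and `1`
  have h1 : diagSL z * (upperSL ((1 : Kˣ) : K) * lowerSL (-(((1 : Kˣ)⁻¹ : Kˣ) : K)) *
      upperSL ((1 : Kˣ) : K)) =
      upperSL (z : K) * lowerSL (-((z⁻¹ : Kˣ) : K)) * upperSL (z : K) := by
    refine Subtype.ext ?_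
    rw [upperSL_mul_lowerSL_mul_upperSL]
    change !![(z : K), 0; 0, ((z⁻¹ : Kˣ) : K)] * (upperSL ((1 : Kˣ) : K) *
      lowerSL (-(((1 : Kˣ)⁻¹ : Kˣ) : K)) * upperSL ((1 : Kˣ) : K)).1 = _
    rw [upperSL_mul_lowerSL_mul_upperSL, mul_fin_two]
    simp
  have h2 := congrArg (fun x => (φ x).1) h1
  beta_reduce at h2
  rw [MonoidHom.map_mul, Units.val_mul, hw, hw] at h2
  have h3 : blockMatrix (pairEquiv hij) !![(z : K), 0; 0, ((z⁻¹ : Kˣ) : K)] *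
      blockMatrix (pairEquiv hij) !![0, b * ((1 : Kˣ) : K); -(d * (((1 : Kˣ)⁻¹ : Kˣ) : K)), 0] =
      blockMatrix (pairEquiv hij) !![0, b * z; -(d * ((z⁻¹ : Kˣ) : K)), 0] := by
    rw [← MonoidHom.map_mul, mul_fin_two]
    simp [mul_comm]
  refine IsUnit.mul_right_cancel ?_ (h2.trans h3.symm)
  rw [← hw 1]
  exact (φ _).isUnit

end Roots

section RootsOfBlock

variable {K : Type*} [Field K]

/-- The polynomial functions on the affine line with vanishing differential at the origin. -/
def flatPolynomialFunctions (K : Type*) [Field K] : Subalgebra K (K → K) where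
  carrier := {f | ∃ P : K[X], P.coeff 1 = 0 ∧ ∀ x, f x = P.eval x}
  mul_mem' := by
    rintro f g ⟨P, hP, hf⟩ ⟨Q, hQ, hg⟩
    exact ⟨P * Q, by rw [mul_coeff_one, hP, hQ, mul_zero, zero_mul, add_zero],
      fun x => by rw [Pi.mul_apply, hf, hg, eval_mul]⟩
  add_mem' := by
    rintro f g ⟨P, hP, hf⟩ ⟨Q, hQ, hg⟩
    exact ⟨P + Q, by rw [coeff_add, hP, hQ, add_zero],
      fun x => by rw [Pi.add_apply, hf, hg, eval_add]⟩
  algebraMap_mem' r := ⟨C r, coeff_C_succ, fun x => by simp⟩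

lemma eval_mem_flatPolynomialFunctions_iff [Infinite K] {P : K[X]} :
    (fun x => P.eval x) ∈ flatPolynomialFunctions K ↔ P.coeff 1 = 0 := by
  refine ⟨?_, fun h => ⟨P, h, fun _ => rfl⟩⟩
  rintro ⟨Q, hQ, h⟩
  rw [Polynomial.funext h, hQ]

variable {a n : ℕ} {κ : Type*} [Fintype κ] [DecidableEq κ] (σ : Fin a ⊕ κ ≃ Fin n)
  (u : GL (Fin n) K)

lemma entriesIn_upperSL (A : Subalgebra K (K → K)) (h : (fun x => x) ∈ A) :
    EntriesIn A fun x : K => (upperSL x).1 := by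
  intro i j
  fin_cases i <;> fin_cases j
  exacts [A.one_mem, h, A.zero_mem, A.one_mem]

lemma entriesIn_lowerSL (A : Subalgebra K (K → K)) (h : (fun x => x) ∈ A) :
    EntriesIn A fun x : K => (lowerSL x).1 := by
  intro i j
  fin_cases i <;> fin_cases j
  exacts [A.one_mem, A.zero_mem, h, A.one_mem]

/-- The embedding of `SL₂` in `GL_n` through the rows and columns `i` and `j` of the block. -/
noncomputable def rootSL {i j : Fin a} (hij : i ≠ j) :
    SpecialLinearGroup (Fin 2) K →* GL (Fin n) K :=
  ((conjBlock σ u).comp (conjBlock (pairEquiv hij) 1)).comp SpecialLinearGroup.toGL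

lemma rootSL_apply {i j : Fin a} (hij : i ≠ j) (x : SpecialLinearGroup (Fin 2) K) :
    rootSL σ u hij x = conjBlock σ u (block (pairEquiv hij) (SpecialLinearGroup.toGL x)) := by
  rw [rootSL, MonoidHom.comp_apply, MonoidHom.comp_apply, conjBlock_apply (pairEquiv hij), one_mul,
    inv_one, mul_one]

lemma conjTorus_conj_conjBlock {x y : GL (Fin a) K} {c : Fin a → Kˣ}
    (h : (diagGL K a c).1 * x.1 * (diagGL K a c)⁻¹.1 = y.1) :
    (torusEquiv σ u c).1 * conjBlock σ u x * (torusEquiv σ u c).1⁻¹ = conjBlock σ u y := by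
  rw [coe_torusEquiv, ← map_inv, ← map_mul, ← map_mul]
  exact congrArg _ (Units.ext h)

lemma isRootWithCoroot_rootVec [Infinite K] {i j : Fin a} (hij : i ≠ j) :
    IsRootWithCoroot (conjBlock σ u).range (conjTorus σ u) (charEquiv σ u (rootVec i j)).1
      (cocharEquiv σ u (rootVec i j)).1 := by
  refine ⟨(charEquiv σ u _).2, (cocharEquiv σ u _).2, rootSL σ u hij, ?_, ?_, ?_, ?_, ?_, ?_⟩
  · intro x
    exact ⟨_, rfl⟩
  · let y (m : Fin 2 × Fin 2) (x : SpecialLinearGroup (Fin 2) K) : K := x.1 m.1 m.2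
    have h : EntriesIn (Algebra.adjoin K (Set.range y)) fun x => (SpecialLinearGroup.toGL x).1 :=
      fun k l => Algebra.subset_adjoin ⟨(k, l), rfl⟩
    choose P hP using fun k l =>
      exists_eval_eq_of_mem_adjoin ((h.conjBlock (pairEquiv hij) 1).conjBlock σ u k l)
    exact ⟨P, fun x k l => hP k l x⟩
  · have h : EntriesIn (Algebra.adjoin K {fun x : K => x})
        fun x => (SpecialLinearGroup.toGL (upperSL x)).1 :=
      entriesIn_upperSL _ (Algebra.self_mem_adjoin_singleton K _)
    choose Q hQ using fun k l =>
      exists_polynomial_eval_eq_of_mem_adjoin ((h.conjBlock (pairEquiv hij) 1).conjBlock σ u k l)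
    refine ⟨Q, fun x k l => hQ k l x, ?_⟩
    -- otherwise the coordinate of the affine line would have vanishing differential
    by_contra! h0
    have h1 : EntriesIn (flatPolynomialFunctions K) fun x => (rootSL σ u hij (upperSL x)).1 :=
      fun k l => ⟨Q k l, h0 k l, hQ k l⟩
    have h2 := ((h1.of_conjBlock σ u).of_conjBlock (pairEquiv hij) 1) 0 1
    have h3 : (fun x : K => (X : K[X]).eval x) ∈ flatPolynomialFunctions K := by
      simp only [eval_X]
      exact h2
    rw [eval_mem_flatPolynomialFunctions_iff, coeff_X_one] at h3
    exact one_ne_zero h3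
  · intro t x
    obtain ⟨c, rfl⟩ := (torusEquiv σ u).surjective t
    rw [rootSL_apply, rootSL_apply]
    refine conjTorus_conj_conjBlock σ u ?_
    change _ * blockMatrix (pairEquiv hij) !![1, x; 0, 1] * _ =
      blockMatrix (pairEquiv hij) !![1, _ * x; 0, 1]
    rw [blockMatrix_pairEquiv_upper, blockMatrix_pairEquiv_upper, charEquiv_apply,
      monomialChar_rootVec, diagGL_mul_transvection_mul_inv]
  · intro t x
    obtain ⟨c, rfl⟩ := (torusEquiv σ u).surjective t
    rw [rootSL_apply, rootSL_apply]
    refine conjTorus_conj_conjBlock σ u ?_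
    change _ * blockMatrix (pairEquiv hij) !![1, 0; x, 1] * _ =
      blockMatrix (pairEquiv hij) !![1, 0; _ * x, 1]
    rw [blockMatrix_pairEquiv_lower, blockMatrix_pairEquiv_lower, charEquiv_apply,
      monomialChar_rootVec, diagGL_mul_transvection_mul_inv, _root_.mul_inv_rev, inv_inv]
  · intro z
    rw [rootSL_apply, cocharEquiv_apply, coe_torusEquiv]
    exact congrArg _ (Units.ext (blockMatrix_pairEquiv_diag hij z).symm)

/-- The roots and coroots of the block `GL_a` are the standard ones. -/
theorem isRootWithCoroot_iff [Infinite K] {α : conjTorus σ u →* Kˣ} {αv : Kˣ →* conjTorus σ u} :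
    IsRootWithCoroot (conjBlock σ u).range (conjTorus σ u) α αv ↔ ∃ i j, i ≠ j ∧
      α = (charEquiv σ u (rootVec i j)).1 ∧ αv = (cocharEquiv σ u (rootVec i j)).1 := by
  constructor
  swap
  · rintro ⟨i, j, hij, rfl, rfl⟩
    exact isRootWithCoroot_rootVec σ u hij
  rintro ⟨-, -, φ, hφ, ⟨P, hP⟩, ⟨Q, hQ, b, b', hne⟩, hu, hl, hc⟩
  -- transport the homomorphism to `GL_a`
  let ψ : SpecialLinearGroup (Fin 2) K →* GL (Fin a) K :=
    (MonoidHom.ofInjective (conjBlock_injective σ u)).symm.toMonoidHom.comp (φ.codRestrict _ hφ)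
  have hψ (x : SpecialLinearGroup (Fin 2) K) : conjBlock σ u (ψ x) = φ x :=
    congrArg Subtype.val
      ((MonoidHom.ofInjective (conjBlock_injective σ u)).apply_symm_apply ⟨φ x, hφ x⟩)
  have hup : EntriesIn (Algebra.adjoin K {fun x : K => x}) fun x => (ψ (upperSL x)).1 := by
    refine EntriesIn.of_conjBlock σ u fun k l => ?_
    simp only [hψ, hQ]
    exact polynomial_eval_mem_subalgebra _ (Algebra.self_mem_adjoin_singleton K _) _
  have hlo : EntriesIn (Algebra.adjoin K {fun x : K => x}) fun x => (ψ (lowerSL x)).1 := by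
    refine EntriesIn.of_conjBlock σ u fun k l => ?_
    simp only [hψ, hP]
    exact eval_mem_subalgebra _ (y := fun (m : Fin 2 × Fin 2) x => (lowerSL x).1 m.1 m.2)
      (fun m => entriesIn_lowerSL _ (Algebra.self_mem_adjoin_singleton K _) m.1 m.2) _
  choose Q' hQ' using fun k l => exists_polynomial_eval_eq_of_mem_adjoin (hup k l)
  choose R hR using fun k l => exists_polynomial_eval_eq_of_mem_adjoin (hlo k l)
  -- the differential of `ψ` is not zero, since that of `φ` is not
  have hflat : ∃ i j, (Q' i j).coeff 1 ≠ 0 := by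
    by_contra! h0
    have h1 : EntriesIn (flatPolynomialFunctions K) fun x => (ψ (upperSL x)).1 :=
      fun k l => ⟨Q' k l, h0 k l, hQ' k l⟩
    have h2 := h1.conjBlock σ u b b'
    simp only [hψ, hQ] at h2
    exact hne (eval_mem_flatPolynomialFunctions_iff.1 h2)
  obtain ⟨i, j, hb⟩ := hflat
  have key := root_of_equivariant (φ := ψ) (fun x k l => hQ' k l x) (fun x k l => hR k l x) hb
    (α := α.comp (torusEquiv σ u).toMonoidHom)
    (γ := (torusEquiv σ u).symm.toMonoidHom.comp αv) ?_ ?_ ?_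
  · obtain ⟨hij, h1, h2⟩ := key
    refine ⟨i, j, hij, MonoidHom.ext fun t => ?_, MonoidHom.ext fun z => ?_⟩
    · obtain ⟨c, rfl⟩ := (torusEquiv σ u).surjective t
      rw [charEquiv_apply, ← h1]
      rfl
    · rw [cocharEquiv_apply, ← h2]
      exact ((torusEquiv σ u).apply_symm_apply (αv z)).symm
  · intro c x
    apply conjBlock_injective σ u
    rw [map_mul, map_mul, map_inv, hψ, hψ, ← coe_torusEquiv, hu]
    rfl
  · intro c x
    apply conjBlock_injective σ u
    rw [map_mul, map_mul, map_inv, hψ, hψ, ← coe_torusEquiv, hl]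
    rfl
  · intro z
    apply conjBlock_injective σ u
    rw [hψ, ← hc, ← coe_torusEquiv]
    exact congrArg Subtype.val ((torusEquiv σ u).apply_symm_apply (αv z))

end RootsOfBlock

/-! ### Langlands duality of block general linear groups -/

section Langlands

variable {F : Type*} [Field F] [Fintype F] {K : Type*} [Field K] [Algebra F K]

/-- The unitary Frobenius acts on the diagonal torus by the power `-q`. -/
lemma unitaryFrob_diagGL {a : ℕ} (c : Fin a → Kˣ) :
    unitaryFrob F K a (diagGL K a c) = diagGL K a (c ^ (-(Fintype.card F : ℤ))) := by
  rw [← _root_.inv_inj, ← map_inv (diagGL K a), ← _root_.zpow_neg, neg_neg, zpow_natCast]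
  refine Units.ext ?_
  change qstar F (diagonal fun i => (c i : K)) = diagonal _
  ext i j
  by_cases h : i = j
  · subst h; simp
  · simp [h, Ne.symm h, Fintype.card_ne_zero]

lemma monomialChar_smul {a : ℕ} (k : ℤ) (m : Fin a → ℤ) (c : Fin a → Kˣ) :
    monomialChar K (k • m) c = monomialChar K m (c ^ k) := by
  simp [monomialChar_apply, _root_.zpow_mul]

lemma monomialCochar_smul {a : ℕ} (k : ℤ) (m : Fin a → ℤ) (z : Kˣ) :
    monomialCochar K (k • m) z = monomialCochar K m z ^ k := by
  funext i
  simp [mul_comm k, _root_.zpow_mul]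

lemma monomialCochar_add {a : ℕ} (m m' : Fin a → ℤ) (z : Kˣ) :
    monomialCochar K (m + m') z = monomialCochar K m z * monomialCochar K m' z := by
  funext i
  simp [_root_.zpow_add]

/-- The pairing of characters and cocharacters is symmetric. -/
lemma monomialChar_monomialCochar {a : ℕ} (m m' : Fin a → ℤ) (z : Kˣ) :
    monomialChar K m (monomialCochar K m' z) = monomialChar K m' (monomialCochar K m z) := by
  simp [monomialChar_apply, ← _root_.zpow_mul, mul_comm]

variable {a n n' : ℕ} {κ κ' : Type*} [Fintype κ] [DecidableEq κ] [Fintype κ'] [DecidableEq κ']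
  (σ : Fin a ⊕ κ ≃ Fin n) (σ' : Fin a ⊕ κ' ≃ Fin n') {u : GL (Fin n) K} {u' : GL (Fin n') K}

lemma unitaryFrob_conjBlock (hu : u ∈ U F K n) (g : GL (Fin a) K) :
    unitaryFrob F K n (conjBlock σ u g) = conjBlock σ u (unitaryFrob F K a g) := by
  rw [conjBlock_apply, conjBlock_apply, map_mul, map_mul, map_inv, hu.2, unitaryFrob_block]

lemma unitaryFrob_torusEquiv (hu : u ∈ U F K n) (c : Fin a → Kˣ) :
    unitaryFrob F K n (torusEquiv σ u c).1 = (torusEquiv σ u (c ^ (-(Fintype.card F : ℤ)))).1 := by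
  rw [coe_torusEquiv, coe_torusEquiv, unitaryFrob_conjBlock σ hu, unitaryFrob_diagGL]

lemma unitaryFrob_mem_conjTorus (hu : u ∈ U F K n) (t : conjTorus σ u) :
    unitaryFrob F K n t.1 ∈ conjTorus σ u := by
  obtain ⟨c, rfl⟩ := (torusEquiv σ u).surjective t
  rw [unitaryFrob_torusEquiv σ hu]
  exact Subtype.property _

lemma unitaryFrob_mem_range_conjBlock (hu : u ∈ U F K n) {g : GL (Fin n) K}
    (hg : g ∈ (conjBlock σ u).range) : unitaryFrob F K n g ∈ (conjBlock σ u).range := by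
  obtain ⟨g, rfl⟩ := hg
  exact ⟨_, (unitaryFrob_conjBlock σ hu g).symm⟩

/-- Two copies of `GL_a` embedded as blocks, compatibly with the Frobenius endomorphisms, are
Langlands dual: with respect to the diagonal tori, both root data are the self-dual root datum
of `GL_a`, on which Frobenius acts by multiplication by `-q`. -/
theorem isLanglandsDual_range_conjBlock [Infinite K] (hu : u ∈ U F K n) (hu' : u' ∈ U F K n') :
    IsLanglandsDual (conjBlock σ u).range (unitaryFrob F K n)
      (conjBlock σ' u').range (unitaryFrob F K n') := by
  refine ⟨fun g => unitaryFrob_mem_range_conjBlock σ hu,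
    fun g => unitaryFrob_mem_range_conjBlock σ' hu', conjTorus σ u, conjTorus σ' u',
    unitaryFrob_mem_conjTorus σ hu, unitaryFrob_mem_conjTorus σ' hu',
    (charEquiv σ u).symm.trans (cocharEquiv σ' u'), isMaximalTorus_conjTorus σ u,
    isMaximalTorus_conjTorus σ' u', ?_, ?_, ?_, ?_⟩
  · intro χ₁ χ₂ χ₃ h z
    obtain ⟨m₁, rfl⟩ := (charEquiv σ u).surjective χ₁
    obtain ⟨m₂, rfl⟩ := (charEquiv σ u).surjective χ₂
    obtain ⟨m₃, rfl⟩ := (charEquiv σ u).surjective χ₃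
    have h1 : m₃ = m₁ + m₂ := by
      refine monomialChar_injective (K := K) (MonoidHom.ext fun c => ?_)
      rw [monomialChar_add, MonoidHom.mul_apply, ← charEquiv_apply σ u, h, MonoidHom.mul_apply,
        charEquiv_apply, charEquiv_apply]
    simp only [Equiv.trans_apply, Equiv.symm_apply_apply, cocharEquiv_apply]
    rw [h1, monomialCochar_add, map_mul]
  · intro χ ψ h z
    obtain ⟨m, rfl⟩ := (charEquiv σ u).surjective χ
    obtain ⟨m', rfl⟩ := (charEquiv σ u).surjective ψ
    have h1 : m' = (-(Fintype.card F : ℤ)) • m := by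
      refine monomialChar_injective (K := K) (MonoidHom.ext fun c => ?_)
      rw [monomialChar_smul, ← charEquiv_apply σ u, ← charEquiv_apply σ u, h, MonoidHom.comp_apply]
      exact congrArg _ (Subtype.ext (unitaryFrob_torusEquiv σ hu c))
    simp only [Equiv.trans_apply, Equiv.symm_apply_apply, cocharEquiv_apply]
    rw [h1, unitaryFrob_torusEquiv σ' hu', monomialCochar_smul]
  · intro α αv h
    obtain ⟨i, j, hij, hα, rfl⟩ := (isRootWithCoroot_iff σ u).1 h
    obtain rfl := Subtype.ext hα
    refine ⟨(charEquiv σ' u' (rootVec i j)).1, ?_, fun χ z => ?_⟩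
    · rw [Equiv.trans_apply, Equiv.symm_apply_apply]
      exact isRootWithCoroot_rootVec σ' u' hij
    · obtain ⟨m, rfl⟩ := (charEquiv σ u).surjective χ
      simp only [Equiv.trans_apply, Equiv.symm_apply_apply, cocharEquiv_apply, charEquiv_apply]
      exact monomialChar_monomialCochar _ _ _
  · intro β βv h
    obtain ⟨i, j, hij, rfl, hβ⟩ := (isRootWithCoroot_iff σ' u').1 h
    obtain rfl := Subtype.ext hβ
    refine ⟨(cocharEquiv σ u (rootVec i j)).1, ?_, fun χ z => ?_⟩
    · rw [Equiv.symm_trans_apply, Equiv.symm_apply_apply, Equiv.symm_symm]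
      exact isRootWithCoroot_rootVec σ u hij
    · obtain ⟨m, rfl⟩ := (charEquiv σ u).surjective χ
      simp only [Equiv.trans_apply, Equiv.symm_apply_apply, cocharEquiv_apply, charEquiv_apply]
      exact monomialChar_monomialCochar _ _ _

lemma range_conjBlock_sumEmpty (a : ℕ) :
    (conjBlock (Equiv.sumEmpty (Fin a) (Fin 0)) (1 : GL (Fin a) K)).range = ⊤ := by
  refine eq_top_iff.2 fun g _ => ⟨g, ?_⟩
  rw [conjBlock_apply, one_mul, inv_one, mul_one]
  ext i j
  exact blockMatrix_inl_inl (Equiv.sumEmpty (Fin a) (Fin 0)) g.1 i j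

theorem isLanglandsDual_range_conjBlock_top [Infinite K] (hu : u ∈ U F K n) :
    IsLanglandsDual (conjBlock σ u).range (unitaryFrob F K n) ⊤ (unitaryFrob F K a) := by
  rw [← range_conjBlock_sumEmpty]
  exact isLanglandsDual_range_conjBlock σ _ hu (one_mem _)

end Langlands

/-! ### The unitary dual pair -/

section QuadMatrix

variable (F : Type*) [Field F] [Fintype F] (K : Type*) [Field K] [Algebra F K]

/-- The matrices with entries in the quadratic extension `{x | x ^ q² = x}` of `F`. -/
def quadMatrix (ι κ : Type*) : Submodule F (Matrix ι κ K) where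
  carrier := {X | qstar F (qstar F X) = X}
  add_mem' {X Y} (hX : _ = _) (hY : _ = _) := by
    change qstar F (qstar F (X + Y)) = X + Y
    rw [qstar_add, qstar_add, hX, hY]
  zero_mem' := by
    ext
    simp [Fintype.card_ne_zero]
  smul_mem' c {X} (hX : _ = _) := by
    have h : algebraMap F K c ^ Fintype.card F = algebraMap F K c := by
      rw [← map_pow, FiniteField.pow_card]
    change qstar F (qstar F (c • X)) = c • X
    rw [← algebraMap_smul K c X, qstar_smul, qstar_smul, hX, h, h]

variable {F K} {ι κ μ : Type*}

lemma mem_quadMatrix {X : Matrix ι κ K} : X ∈ quadMatrix F K ι κ ↔ qstar F (qstar F X) = X :=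
  Iff.rfl

lemma mem_quadMatrix_iff {X : Matrix ι κ K} :
    X ∈ quadMatrix F K ι κ ↔ ∀ i k, X i k ^ (Fintype.card F ^ 2) = X i k := by
  rw [mem_quadMatrix, ← Matrix.ext_iff]
  simp only [qstar_apply, pow_card_sq]

lemma mul_mem_quadMatrix [Fintype κ] {X : Matrix ι κ K} {Y : Matrix κ μ K}
    (hX : X ∈ quadMatrix F K ι κ) (hY : Y ∈ quadMatrix F K κ μ) : X * Y ∈ quadMatrix F K ι μ := by
  rw [mem_quadMatrix] at *
  rw [qstar_mul, qstar_mul, hX, hY]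

lemma transpose_mem_quadMatrix {X : Matrix ι κ K} (hX : X ∈ quadMatrix F K ι κ) :
    Xᵀ ∈ quadMatrix F K κ ι := by
  rw [mem_quadMatrix_iff] at *
  exact fun i k => hX k i

lemma mem_quadMatrix_of_qstar_mul_self [Fintype ι] [DecidableEq ι] {m : Matrix ι ι K}
    (h : qstar F m * m = 1) : m ∈ quadMatrix F K ι ι := by
  rw [mem_quadMatrix]
  have h1 : qstar F m * qstar F (qstar F m) = 1 := by
    rw [← qstar_mul, h, qstar_one]
  exact (left_inv_eq_right_inv (mul_eq_one_comm.1 h) h1).symm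

lemma smul_mem_quadMatrix {c : K} (hc : c ^ (Fintype.card F ^ 2) = c) {X : Matrix ι κ K}
    (hX : X ∈ quadMatrix F K ι κ) : c • X ∈ quadMatrix F K ι κ := by
  rw [mem_quadMatrix_iff] at *
  intro i k
  rw [Matrix.smul_apply, smul_eq_mul, mul_pow, hc, hX]

lemma single_mem_quadMatrix [DecidableEq ι] [DecidableEq κ] (i : ι) (k : κ) :
    single i k (1 : K) ∈ quadMatrix F K ι κ := by
  rw [mem_quadMatrix_iff]
  intro i' k'
  rw [single_apply]
  split_ifs
  · exact one_pow _
  · exact zero_pow (pow_ne_zero _ Fintype.card_ne_zero)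

lemma exists_mem_U_of_qstar_mul_self {n : ℕ} {m : Matrix (Fin n) (Fin n) K}
    (h : qstar F m * m = 1) : ∃ g ∈ U F K n, g.1 = m :=
  ⟨⟨m, qstar F m, mul_eq_one_comm.1 h, h⟩, mem_U_iff.2 h, rfl⟩

variable [Fintype ι] [Fintype κ]

/-- The standard hermitian form on matrices: the tensor product of the standard hermitian forms. -/
def hermForm (F : Type*) [Field F] [Fintype F] [Algebra F K] (X Y : Matrix ι κ K) : K :=
  trace (qstar F Y * X)

/-- The symplectic form `H - H ^ q` obtained from the standard hermitian form `H` on matrices.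
Its values on matrices over the quadratic extension of `F` lie on the line `x ^ q = -x`. -/
def symplForm (F : Type*) [Field F] [Fintype F] [Algebra F K] (X Y : Matrix ι κ K) : K :=
  hermForm F X Y - hermForm F X Y ^ Fintype.card F

lemma hermForm_mul_left [DecidableEq ι] {g : Matrix ι ι K} (hg : qstar F g * g = 1)
    (X Y : Matrix ι κ K) : hermForm F (g * X) (g * Y) = hermForm F X Y := by
  rw [hermForm, qstar_mul, Matrix.mul_assoc, ← Matrix.mul_assoc (qstar F g), hg, Matrix.one_mul,
    hermForm]

lemma hermForm_transpose (X Y : Matrix ι κ K) : hermForm F Xᵀ Yᵀ = hermForm F X Y := by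
  have h : qstar F Yᵀ = (qstar F Y)ᵀ := rfl
  rw [hermForm, h, ← transpose_mul, trace_transpose, trace_mul_comm, hermForm]

lemma hermForm_mul_right [DecidableEq κ] {h : Matrix κ κ K} (hh : qstar F h * h = 1)
    (X Y : Matrix ι κ K) : hermForm F (X * hᵀ) (Y * hᵀ) = hermForm F X Y := by
  rw [← hermForm_transpose, transpose_mul, transpose_mul, transpose_transpose,
    hermForm_mul_left hh, hermForm_transpose]

lemma hermForm_smul (c : K) (X Y : Matrix ι κ K) :
    hermForm F (c • X) Y = c * hermForm F X Y := by
  rw [hermForm, Matrix.mul_smul, trace_smul, smul_eq_mul, hermForm]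

/-- The hermitian form is determined by the symplectic form. -/
lemma two_mul_hermForm {η : K} (hη0 : η ≠ 0) (hη : η ^ Fintype.card F = -η) (X Y : Matrix ι κ K) :
    2 * hermForm F X Y = symplForm F X Y + η⁻¹ * symplForm F (η • X) Y := by
  rw [symplForm, symplForm, hermForm_smul, mul_pow, hη]
  field_simp
  ring

end QuadMatrix

section Commutant

variable {F : Type*} [Field F] [Fintype F] {K : Type*} [Field K] [Algebra F K]

lemma add_pow_card (F : Type*) [Field F] [Fintype F] [Algebra F K] (x y : K) :
    (x + y) ^ Fintype.card F = x ^ Fintype.card F + y ^ Fintype.card F :=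
  map_add (FiniteField.frobeniusAlgHom F K) x y

lemma sub_pow_card (F : Type*) [Field F] [Fintype F] [Algebra F K] (x y : K) :
    (x - y) ^ Fintype.card F = x ^ Fintype.card F - y ^ Fintype.card F :=
  map_sub (FiniteField.frobeniusAlgHom F K) x y

/-- The elements of the quadratic extension are `x + y η` with `x, y ∈ F`. -/
lemma exists_eq_add_mul (hq : Odd (Fintype.card F)) {η : K} (hη0 : η ≠ 0)
    (hη : η ^ Fintype.card F = -η) {c : K} (hc : c ^ (Fintype.card F ^ 2) = c) :
    ∃ x y : F, c = algebraMap F K x + algebraMap F K y * η := by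
  have h2 : (2 : K) ≠ 0 := two_ne_zero_of_odd_card hq
  have h2' : (2 : K) ^ Fintype.card F = 2 := by
    have := congrArg (algebraMap F K) (FiniteField.pow_card (2 : F))
    rwa [map_pow, map_ofNat] at this
  obtain ⟨x, hx⟩ : ∃ x : F, algebraMap F K x = (c + c ^ Fintype.card F) / 2 := by
    refine exists_algebraMap_eq_of_pow_card_eq ?_
    rw [div_pow, add_pow_card F, pow_card_sq, hc, h2', add_comm]
  obtain ⟨y, hy⟩ : ∃ y : F, algebraMap F K y = (c - c ^ Fintype.card F) / (2 * η) := by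
    refine exists_algebraMap_eq_of_pow_card_eq ?_
    rw [div_pow, sub_pow_card F, pow_card_sq, hc, mul_pow, h2', hη, mul_neg, div_neg, ← neg_div, neg_sub]
  refine ⟨x, y, ?_⟩
  rw [hx, hy]
  field_simp
  ring

/-- The unitary group generates all matrices over the quadratic extension of `F`: an algebra which
contains it also contains the scalars of that field and the matrix units. -/
lemma scalar_mem_and_single_mem_of_U_subset (hq : Odd (Fintype.card F)) {η : K} (hη0 : η ≠ 0)
    (hη : η ^ Fintype.card F = -η) {a : ℕ} (R : Subalgebra F (Matrix (Fin a) (Fin a) K))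
    (hR : ∀ g ∈ U F K a, g.1 ∈ R) :
    (∀ c : K, c ^ (Fintype.card F ^ 2) = c → c • (1 : Matrix (Fin a) (Fin a) K) ∈ R) ∧
      ∀ i j, single i j (1 : K) ∈ R := by
  have hR' (m : Matrix (Fin a) (Fin a) K) (hm : qstar F m * m = 1) : m ∈ R := by
    obtain ⟨g, hg, rfl⟩ := exists_mem_U_of_qstar_mul_self hm
    exact hR g hg
  have h2 : (2 : F) ≠ 0 := two_ne_zero_of_odd_card hq
  have h2K : (2 : K) ≠ 0 := two_ne_zero_of_odd_card hq
  constructor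
  · obtain ⟨d, hd⟩ : ∃ d : F, algebraMap F K d = η ^ 2 :=
      exists_algebraMap_eq_of_pow_card_eq (by rw [← pow_mul, mul_comm, pow_mul, hη, neg_sq])
    have hadd : (1 + η) ^ Fintype.card F = 1 - η := by
      rw [add_pow_card F, one_pow, hη, sub_eq_add_neg]
    have hsub : (1 - η) ^ Fintype.card F = 1 + η := by
      rw [sub_pow_card F, one_pow, hη, sub_neg_eq_add]
    have hp : 1 + η ≠ 0 := by
      intro h
      rw [h, zero_pow Fintype.card_ne_zero] at hadd
      exact h2K (by linear_combination h - hadd)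
    have hm : 1 - η ≠ 0 := by
      intro h
      rw [h, zero_pow Fintype.card_ne_zero] at hsub
      exact hp hsub.symm
    -- `ζ` has norm one, so the scalar matrix `ζ` is unitary, and `η` is in the span of `1, ζ`
    set ζ : K := (1 - η) / (1 + η)
    have hζ : ζ • (1 : Matrix (Fin a) (Fin a) K) ∈ R := by
      refine hR' _ ?_
      rw [qstar_smul, qstar_one, smul_mul_smul_comm, div_pow, hadd, hsub, one_mul,
        div_mul_div_comm, mul_comm, div_self (mul_ne_zero hm hp), one_smul]
    have hηR : η • (1 : Matrix (Fin a) (Fin a) K) ∈ R := by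
      have h : η • (1 : Matrix (Fin a) (Fin a) K) = (2⁻¹ * (1 + d)) • (1 : Matrix (Fin a) (Fin a) K)
          - (2⁻¹ * (1 - d)) • ζ • (1 : Matrix (Fin a) (Fin a) K) := by
        rw [← algebraMap_smul K (2⁻¹ * (1 + d)), ← algebraMap_smul K (2⁻¹ * (1 - d)), smul_smul, ← sub_smul]
        congr 1
        rw [map_mul, map_mul, map_add, map_sub, map_inv₀, hd, map_one, map_ofNat]
        simp only [ζ]
        field_simp
        ring
      rw [h]
      exact R.sub_mem (R.smul_mem R.one_mem _) (R.smul_mem hζ _)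
    intro c hc
    obtain ⟨x, y, rfl⟩ := exists_eq_add_mul hq hη0 hη hc
    rw [add_smul, mul_smul, algebraMap_smul, algebraMap_smul]
    exact R.add_mem (R.smul_mem R.one_mem _) (R.smul_mem hηR _)
  · intro i j
    have hdiag : single i i (1 : K) ∈ R := by
      -- the diagonal matrix with one entry `-1` is unitary
      let ε : Fin a → K := fun k => if k = i then -1 else 1
      have hε (k : Fin a) : ε k ^ Fintype.card F = ε k := by
        simp only [ε]
        split_ifs
        · exact hq.neg_one_pow
        · exact one_pow _
      have hε' (k : Fin a) : ε k * ε k = 1 := by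
        simp only [ε]
        split_ifs <;> simp
      have h1 : diagonal ε ∈ R := by
        refine hR' _ ?_
        have h2 : qstar F (diagonal ε) = diagonal ε := by
          ext k l
          by_cases hkl : k = l
          · subst hkl; simp [hε]
          · simp [hkl, Ne.symm hkl, Fintype.card_ne_zero]
        rw [h2, diagonal_mul_diagonal]
        simp only [hε', diagonal_one]
      have h3 : single i i (1 : K) = (2⁻¹ : F) • (1 - diagonal ε) := by
        rw [← algebraMap_smul K, map_inv₀, map_ofNat, eq_inv_smul_iff₀ h2K]
        ext k l
        by_cases hkl : k = l
        · subst hkl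
          by_cases hk : k = i
          · subst hk; simp [ε]; norm_num
          · simp [ε, hk, Ne.symm hk]
        · have : ¬ (i = k ∧ i = l) := fun h => hkl (h.1.symm.trans h.2)
          simp [hkl, this]
      rw [h3]
      exact R.smul_mem (R.sub_mem R.one_mem h1) _
    -- permutation matrices are unitary
    let P : Matrix (Fin a) (Fin a) K := (1 : Matrix (Fin a) (Fin a) K).submatrix (Equiv.swap i j) id
    have hP : P ∈ R := by
      refine hR' _ ?_
      have h1 : qstar F P = (1 : Matrix (Fin a) (Fin a) K).submatrix id (Equiv.swap i j) := by
        ext k l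
        simp only [qstar_apply, P, submatrix_apply, id, Matrix.one_apply]
        by_cases h : Equiv.swap i j l = k
        · simp [h]
        · simp [h, Ne.symm h, Fintype.card_ne_zero]
      rw [h1, submatrix_mul_equiv, one_mul, submatrix_id_id]
    have h1 : single i j (1 : K) = single i i 1 * P := by
      ext k l
      by_cases hk : i = k
      · subst hk
        simp [P, single_apply, Matrix.one_apply]
      · rw [single_mul_apply_of_ne _ _ _ _ _ (Ne.symm hk)]
        simp [hk]
    rw [h1]
    exact R.mul_mem hdiag hP

/-- A linear map commuting with the left action of the unitary group `U_a` and preserving the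
symplectic form is the right action of an element of `U_b`. -/
lemma exists_mem_U_of_commute (hq : Odd (Fintype.card F)) {η : K} (hη0 : η ≠ 0)
    (hη : η ^ Fintype.card F = -η) {a b : ℕ} (i₀ : Fin a)
    (T : Matrix (Fin a) (Fin b) K →ₗ[F] Matrix (Fin a) (Fin b) K)
    (hcomm : ∀ g ∈ U F K a, ∀ X ∈ quadMatrix F K (Fin a) (Fin b), T (g.1 * X) = g.1 * T X)
    (hT : ∀ X ∈ quadMatrix F K (Fin a) (Fin b), ∀ Y ∈ quadMatrix F K (Fin a) (Fin b),
      symplForm F (T X) (T Y) = symplForm F X Y) :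
    ∃ h ∈ U F K b, ∀ X ∈ quadMatrix F K (Fin a) (Fin b), T X = X * h.1ᵀ := by
  -- the matrices whose left action commutes with `T`
  let R : Subalgebra F (Matrix (Fin a) (Fin a) K) :=
    { carrier := {m | m ∈ quadMatrix F K (Fin a) (Fin a) ∧
        ∀ X ∈ quadMatrix F K (Fin a) (Fin b), T (m * X) = m * T X}
      mul_mem' := by
        rintro m m' ⟨hm, h⟩ ⟨hm', h'⟩
        refine ⟨mul_mem_quadMatrix hm hm', fun X hX => ?_⟩
        rw [Matrix.mul_assoc, h _ (mul_mem_quadMatrix hm' hX), h' X hX, Matrix.mul_assoc]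
      add_mem' := by
        rintro m m' ⟨hm, h⟩ ⟨hm', h'⟩
        refine ⟨add_mem hm hm', fun X hX => ?_⟩
        rw [Matrix.add_mul, map_add, h X hX, h' X hX, Matrix.add_mul]
      algebraMap_mem' := by
        intro r
        rw [Algebra.algebraMap_eq_smul_one]
        refine ⟨Submodule.smul_mem _ _ (mem_quadMatrix_of_qstar_mul_self (by simp)), fun X _ => ?_⟩
        rw [Matrix.smul_mul, Matrix.one_mul, map_smul, Matrix.smul_mul, Matrix.one_mul] }
  obtain ⟨hsc, hsi⟩ := scalar_mem_and_single_mem_of_U_subset hq hη0 hη R fun g hg =>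
    ⟨mem_quadMatrix_of_qstar_mul_self (mem_U_iff.1 hg), hcomm g hg⟩
  have hsmul {c : K} (hc : c ^ (Fintype.card F ^ 2) = c) {X : Matrix (Fin a) (Fin b) K}
      (hX : X ∈ quadMatrix F K (Fin a) (Fin b)) : T (c • X) = c • T X := by
    simpa using (hsc c hc).2 X hX
  -- `T` is determined on matrices with a single nonzero row, which may be moved to row `i₀`
  let h : Matrix (Fin b) (Fin b) K := fun l k => T (single i₀ k 1) i₀ l
  have key (X : Matrix (Fin a) (Fin b) K) (hX : X ∈ quadMatrix F K (Fin a) (Fin b)) :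
      T X = X * hᵀ := by
    ext i l
    have h1 : T X i l = T (single i₀ i (1 : K) * X) i₀ l := by
      rw [(hsi i₀ i).2 X hX, single_mul_apply_same, one_mul]
    have h2 : single i₀ i (1 : K) * X = ∑ k, X i k • single i₀ k (1 : K) := by
      ext i' k'
      by_cases hi : i₀ = i'
      · subst hi
        simp [Matrix.sum_apply, single_apply]
      · rw [single_mul_apply_of_ne _ _ _ _ _ (Ne.symm hi)]
        simp [Matrix.sum_apply, hi]
    rw [h1, h2, map_sum, Matrix.sum_apply, Matrix.mul_apply]
    refine Finset.sum_congr rfl fun k _ => ?_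
    rw [hsmul (mem_quadMatrix_iff.1 hX i k) (single_mem_quadMatrix i₀ k)]
    rfl
  have hη2 : η ^ (Fintype.card F ^ 2) = η := by
    rw [← pow_card_sq, hη, hq.neg_pow, hη, neg_neg]
  -- `T` is linear over the quadratic extension, so it also preserves the hermitian form
  have hherm (X : Matrix (Fin a) (Fin b) K) (hX : X ∈ quadMatrix F K (Fin a) (Fin b))
      (Y : Matrix (Fin a) (Fin b) K) (hY : Y ∈ quadMatrix F K (Fin a) (Fin b)) :
      hermForm F (T X) (T Y) = hermForm F X Y := by
    refine mul_left_cancel₀ (two_ne_zero_of_odd_card (F := F) hq) ?_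
    rw [two_mul_hermForm hη0 hη, two_mul_hermForm hη0 hη, hT X hX Y hY, ← hsmul hη2 hX,
      hT _ (smul_mem_quadMatrix hη2 hX) Y hY]
  have hsingle (m m' : Matrix (Fin b) (Fin b) K) (k l : Fin b) :
      hermForm F (single i₀ k (1 : K) * m) (single i₀ l (1 : K) * m') = (m * qstar F m') k l := by
    have h1 : qstar F (single i₀ l (1 : K)) = single l i₀ 1 := by
      ext x y
      simp only [qstar_apply, single_apply, and_comm (a := i₀ = y)]
      split_ifs
      · exact one_pow _
      · exact zero_pow Fintype.card_ne_zero
    rw [hermForm, qstar_mul, h1, trace_mul_comm, Matrix.mul_assoc, ← Matrix.mul_assoc m,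
      ← Matrix.mul_assoc, trace_mul_comm, ← Matrix.mul_assoc, single_mul_single_same, mul_one,
      trace_single_mul]
    simp
  have hu : qstar F h * h = 1 := by
    ext l k
    have h1 := hherm _ (single_mem_quadMatrix i₀ k) _ (single_mem_quadMatrix i₀ l)
    rw [key _ (single_mem_quadMatrix i₀ k), key _ (single_mem_quadMatrix i₀ l), hsingle] at h1
    have h2 : hermForm F (single i₀ k (1 : K)) (single i₀ l 1) = (1 : Matrix _ _ K) k l := by
      have := hsingle 1 1 k l
      rwa [Matrix.mul_one, Matrix.mul_one, qstar_one, Matrix.mul_one] at this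
    have h3 : qstar F hᵀ = (qstar F h)ᵀ := rfl
    rw [h2, h3, ← transpose_mul, transpose_apply] at h1
    rw [h1, Matrix.one_apply, Matrix.one_apply]
    simp only [eq_comm]
  obtain ⟨g, hg, hgh⟩ := exists_mem_U_of_qstar_mul_self hu
  exact ⟨g, hg, fun X hX => by rw [hgh, key X hX]⟩

end Commutant

section DualPair

variable {F : Type*} [Field F] {K : Type*} [Field K] [Algebra F K]

/-- The coordinates `X = v + w η` on the space of `a × b` matrices over the quadratic
extension of `F`. If `η ^ q = -η`, then the symplectic form is `2 η` times the standard one. -/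
def quadCoord (F : Type*) [Field F] [Algebra F K] (η : K) (a b : ℕ) :
    (Fin (a * b) ⊕ Fin (a * b) → F) →ₗ[F] Matrix (Fin a) (Fin b) K where
  toFun v := Matrix.of fun i k => algebraMap F K (v (.inl (finProdFinEquiv (i, k)))) +
    algebraMap F K (v (.inr (finProdFinEquiv (i, k)))) * η
  map_add' v w := by
    ext i k
    simp only [of_apply, Matrix.add_apply, Pi.add_apply, map_add]
    ring
  map_smul' c v := by
    ext i k
    simp only [of_apply, Matrix.smul_apply, Pi.smul_apply, smul_eq_mul, map_mul, Algebra.smul_def,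
      RingHom.id_apply]
    ring

lemma quadCoord_apply (η : K) {a b : ℕ} (v : Fin (a * b) ⊕ Fin (a * b) → F) (i : Fin a)
    (k : Fin b) : quadCoord F η a b v i k = algebraMap F K (v (.inl (finProdFinEquiv (i, k)))) +
      algebraMap F K (v (.inr (finProdFinEquiv (i, k)))) * η := rfl

variable [Fintype F]

lemma quadCoord_pow_card {η : K} (hη : η ^ Fintype.card F = -η) {a b : ℕ}
    (v : Fin (a * b) ⊕ Fin (a * b) → F) (i : Fin a) (k : Fin b) :
    quadCoord F η a b v i k ^ Fintype.card F =
      algebraMap F K (v (.inl (finProdFinEquiv (i, k)))) -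
        algebraMap F K (v (.inr (finProdFinEquiv (i, k)))) * η := by
  rw [quadCoord_apply, add_pow_card F, mul_pow, ← map_pow, ← map_pow, FiniteField.pow_card,
    FiniteField.pow_card, hη, mul_neg, sub_eq_add_neg]

lemma quadCoord_injective (hq : Odd (Fintype.card F)) {η : K} (hη0 : η ≠ 0)
    (hη : η ^ Fintype.card F = -η) (a b : ℕ) : Function.Injective (quadCoord F η a b) := by
  have h2 : (2 : K) ≠ 0 := two_ne_zero_of_odd_card hq
  rw [injective_iff_map_eq_zero]
  intro v hv
  have h (m : Fin (a * b)) : v (.inl m) = 0 ∧ v (.inr m) = 0 := by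
    obtain ⟨⟨i, k⟩, rfl⟩ := finProdFinEquiv.surjective m
    have h1 : quadCoord F η a b v i k = 0 := by rw [hv]; rfl
    have h3 := quadCoord_pow_card hη v i k
    rw [h1, zero_pow Fintype.card_ne_zero] at h3
    rw [quadCoord_apply] at h1
    constructor <;> refine (map_eq_zero (algebraMap F K)).1 (mul_left_cancel₀ h2 ?_)
    · linear_combination h1 - h3
    · refine mul_right_cancel₀ hη0 ?_
      linear_combination h1 + h3
  funext m
  rcases m with m | m
  exacts [(h m).1, (h m).2]

lemma range_quadCoord (hq : Odd (Fintype.card F)) {η : K} (hη0 : η ≠ 0)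
    (hη : η ^ Fintype.card F = -η) (a b : ℕ) :
    LinearMap.range (quadCoord F η a b) = quadMatrix F K (Fin a) (Fin b) := by
  ext X
  rw [mem_quadMatrix_iff]
  constructor
  · rintro ⟨v, rfl⟩ i k
    rw [← pow_card_sq, quadCoord_pow_card hη, sub_pow_card F, mul_pow, ← map_pow, ← map_pow,
      FiniteField.pow_card, FiniteField.pow_card, hη, mul_neg, sub_neg_eq_add, quadCoord_apply]
  · intro hX
    choose x y hxy using fun i k => exists_eq_add_mul hq hη0 hη (hX i k)
    refine ⟨Sum.elim (fun m => x (finProdFinEquiv.symm m).1 (finProdFinEquiv.symm m).2)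
      fun m => y (finProdFinEquiv.symm m).1 (finProdFinEquiv.symm m).2, ?_⟩
    ext i k
    rw [quadCoord_apply, Sum.elim_inl, Sum.elim_inr, Equiv.symm_apply_apply, hxy]

lemma symplForm_quadCoord {η : K} (hη : η ^ Fintype.card F = -η) {a b : ℕ}
    (v w : Fin (a * b) ⊕ Fin (a * b) → F) :
    symplForm F (quadCoord F η a b v) (quadCoord F η a b w) =
      2 * η * algebraMap F K (v ⬝ᵥ J (Fin (a * b)) F *ᵥ w) := by
  have h1 : hermForm F (quadCoord F η a b v) (quadCoord F η a b w) =
      ∑ m : Fin (a * b), (algebraMap F K (v (.inl m)) + algebraMap F K (v (.inr m)) * η) *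
        (algebraMap F K (w (.inl m)) - algebraMap F K (w (.inr m)) * η) := by
    rw [← finProdFinEquiv.sum_comp, Fintype.sum_prod_type, Finset.sum_comm, hermForm, trace]
    refine Finset.sum_congr rfl fun k _ => ?_
    rw [diag_apply, Matrix.mul_apply]
    refine Finset.sum_congr rfl fun i _ => ?_
    rw [qstar_apply, quadCoord_pow_card hη, quadCoord_apply, mul_comm]
  have h2 : v ⬝ᵥ J (Fin (a * b)) F *ᵥ w =
      ∑ m : Fin (a * b), (v (.inr m) * w (.inl m) - v (.inl m) * w (.inr m)) := by
    have h3 : J (Fin (a * b)) F *ᵥ w = Sum.elim (fun m => -w (.inr m)) fun m => w (.inl m) := by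
      rw [J, fromBlocks_mulVec]
      simp [neg_mulVec, Function.comp_def, Pi.neg_def]
    rw [h3, dotProduct, Fintype.sum_sum_type, ← Finset.sum_add_distrib]
    refine Finset.sum_congr rfl fun m _ => ?_
    rw [Sum.elim_inl, Sum.elim_inr]
    ring
  rw [symplForm, h1, h2, map_sum, Finset.mul_sum]
  have h4 := map_sum (FiniteField.frobeniusAlgHom F K)
    (fun m : Fin (a * b) => (algebraMap F K (v (.inl m)) + algebraMap F K (v (.inr m)) * η) *
        (algebraMap F K (w (.inl m)) - algebraMap F K (w (.inr m)) * η)) Finset.univ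
  refine (congrArg _ h4).trans ?_
  rw [← Finset.sum_sub_distrib]
  refine Finset.sum_congr rfl fun m _ => ?_
  have h5 : FiniteField.frobeniusAlgHom F K η = -η := hη
  rw [map_mul, map_add, map_sub, map_mul, map_mul, AlgHom.commutes, AlgHom.commutes,
    AlgHom.commutes, AlgHom.commutes, h5, map_sub, map_mul, map_mul]
  ring

/-- Symplectic matrices are the coordinate matrices of the isometries of the symplectic form. -/
lemma mem_symplecticGroup_iff (hq : Odd (Fintype.card F)) {η : K} (hη0 : η ≠ 0)
    (hη : η ^ Fintype.card F = -η) {a b : ℕ}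
    {A : Matrix (Fin (a * b) ⊕ Fin (a * b)) (Fin (a * b) ⊕ Fin (a * b)) F} :
    A ∈ symplecticGroup (Fin (a * b)) F ↔ ∀ v w,
      symplForm F (quadCoord F η a b (A *ᵥ v)) (quadCoord F η a b (A *ᵥ w)) =
        symplForm F (quadCoord F η a b v) (quadCoord F η a b w) := by
  have h2 : 2 * η ≠ 0 := mul_ne_zero (two_ne_zero_of_odd_card (F := F) hq) hη0
  rw [SymplecticGroup.mem_iff']
  have h3 (v w : Fin (a * b) ⊕ Fin (a * b) → F) : (A *ᵥ v) ⬝ᵥ J (Fin (a * b)) F *ᵥ (A *ᵥ w) =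
      v ⬝ᵥ (Aᵀ * J (Fin (a * b)) F * A) *ᵥ w := by
    rw [← mulVec_mulVec, ← mulVec_mulVec, dotProduct_mulVec v Aᵀ, vecMul_transpose]
  simp only [symplForm_quadCoord hη, mul_right_inj' h2, (algebraMap F K).injective.eq_iff, h3]
  constructor
  · intro h v w
    rw [h]
  · intro h
    ext x y
    simpa using h (Pi.single x 1) (Pi.single y 1)

/-- A linear action on matrices preserving the symplectic space is given by symplectic matrices. -/
lemma exists_symplectic_of_isometric (hq : Odd (Fintype.card F)) {η : K} (hη0 : η ≠ 0)
    (hη : η ^ Fintype.card F = -η) {a b : ℕ} {G : Type*} [Group G]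
    (ρ : G →* Module.End F (Matrix (Fin a) (Fin b) K))
    (hρ : ∀ g, ∀ X ∈ quadMatrix F K (Fin a) (Fin b), ρ g X ∈ quadMatrix F K (Fin a) (Fin b))
    (hω : ∀ g X Y, symplForm F (ρ g X) (ρ g Y) = symplForm F X Y) :
    ∃ ι : G →* symplecticGroup (Fin (a * b)) F,
      ∀ g v, quadCoord F η a b ((ι g).1 *ᵥ v) = ρ g (quadCoord F η a b v) := by
  have hinj := quadCoord_injective hq hη0 hη a b
  have hran := range_quadCoord hq hη0 hη a b
  obtain ⟨p, hp⟩ := LinearMap.exists_leftInverse_of_injective _ (LinearMap.ker_eq_bot.2 hinj)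
  have hp' (v) : p (quadCoord F η a b v) = v := LinearMap.congr_fun hp v
  let M (g : G) := LinearMap.toMatrix' (p ∘ₗ ρ g ∘ₗ quadCoord F η a b)
  have hM (g : G) (v) : quadCoord F η a b (M g *ᵥ v) = ρ g (quadCoord F η a b v) := by
    have h1 : M g *ᵥ v = p (ρ g (quadCoord F η a b v)) := by
      rw [← toLin'_apply, toLin'_toMatrix']
      rfl
    obtain ⟨w, hw⟩ : ρ g (quadCoord F η a b v) ∈ LinearMap.range (quadCoord F η a b) := by
      rw [hran]
      exact hρ g _ (hran ▸ ⟨v, rfl⟩)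
    rw [h1, ← hw, hp']
  have hext {A B : Matrix (Fin (a * b) ⊕ Fin (a * b)) (Fin (a * b) ⊕ Fin (a * b)) F}
      (h : ∀ v, quadCoord F η a b (A *ᵥ v) = quadCoord F η a b (B *ᵥ v)) : A = B :=
    ext_of_mulVec_single fun i => hinj (h _)
  refine ⟨{ toFun := fun g => ⟨M g, (mem_symplecticGroup_iff hq hη0 hη).2 fun v w => ?_⟩
            map_one' := Subtype.ext (hext fun v => ?_)
            map_mul' := fun g h => Subtype.ext (hext fun v => ?_) }, hM⟩
  · rw [hM, hM, hω]
  · rw [hM, map_one, Module.End.one_apply]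
    exact congrArg _ (one_mulVec v).symm
  · rw [hM, map_mul, Module.End.mul_apply]
    change _ = quadCoord F η a b ((M g * M h) *ᵥ v)
    rw [← mulVec_mulVec, hM, hM]

/-- The left action of the unitary group on matrices. -/
def leftAction (F : Type*) [Field F] [Fintype F] [Algebra F K] (a b : ℕ) :
    U F K a →* Module.End F (Matrix (Fin a) (Fin b) K) where
  toFun g :=
    { toFun := fun X => g.1.1 * X
      map_add' := Matrix.mul_add _
      map_smul' := fun c X => Matrix.mul_smul _ c X }
  map_one' := LinearMap.ext Matrix.one_mul
  map_mul' g h := LinearMap.ext fun X => Matrix.mul_assoc g.1.1 h.1.1 X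

/-- The action `X ↦ X hᵀ` of the unitary group on matrices. -/
def rightAction (F : Type*) [Field F] [Fintype F] [Algebra F K] (a b : ℕ) :
    U F K b →* Module.End F (Matrix (Fin a) (Fin b) K) where
  toFun h :=
    { toFun := fun X => X * h.1.1ᵀ
      map_add' := fun X Y => Matrix.add_mul X Y _
      map_smul' := fun c X => Matrix.smul_mul c X _ }
  map_one' := LinearMap.ext fun X => by
    change X * (1 : Matrix (Fin b) (Fin b) K)ᵀ = X
    rw [transpose_one, Matrix.mul_one]
  map_mul' g h := LinearMap.ext fun X => by
    change X * (g.1.1 * h.1.1)ᵀ = X * h.1.1ᵀ * g.1.1ᵀ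
    rw [transpose_mul, Matrix.mul_assoc]

lemma leftAction_apply {a b : ℕ} (g : U F K a) (X : Matrix (Fin a) (Fin b) K) :
    leftAction F a b g X = g.1.1 * X := rfl

lemma rightAction_apply {a b : ℕ} (h : U F K b) (X : Matrix (Fin a) (Fin b) K) :
    rightAction F a b h X = X * h.1.1ᵀ := rfl

lemma symplForm_mul_left {a b : ℕ} {g : GL (Fin a) K} (hg : g ∈ U F K a)
    (X Y : Matrix (Fin a) (Fin b) K) : symplForm F (g.1 * X) (g.1 * Y) = symplForm F X Y := by
  rw [symplForm, hermForm_mul_left (mem_U_iff.1 hg), symplForm]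

lemma symplForm_transpose {a b : ℕ} (X Y : Matrix (Fin a) (Fin b) K) :
    symplForm F Xᵀ Yᵀ = symplForm F X Y := by
  rw [symplForm, hermForm_transpose, symplForm]

lemma symplForm_mul_right {a b : ℕ} {h : GL (Fin b) K} (hh : h ∈ U F K b)
    (X Y : Matrix (Fin a) (Fin b) K) : symplForm F (X * h.1ᵀ) (Y * h.1ᵀ) = symplForm F X Y := by
  rw [symplForm, hermForm_mul_right (mem_U_iff.1 hh), symplForm]

/-- A linear map commuting with the right action of the unitary group `U_b` and preserving the
symplectic form is the left action of an element of `U_a`. -/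
lemma exists_mem_U_of_commute_right (hq : Odd (Fintype.card F)) {η : K} (hη0 : η ≠ 0)
    (hη : η ^ Fintype.card F = -η) {a b : ℕ} (k₀ : Fin b)
    (T : Matrix (Fin a) (Fin b) K →ₗ[F] Matrix (Fin a) (Fin b) K)
    (hcomm : ∀ h ∈ U F K b, ∀ X ∈ quadMatrix F K (Fin a) (Fin b), T (X * h.1ᵀ) = T X * h.1ᵀ)
    (hT : ∀ X ∈ quadMatrix F K (Fin a) (Fin b), ∀ Y ∈ quadMatrix F K (Fin a) (Fin b),
      symplForm F (T X) (T Y) = symplForm F X Y) :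
    ∃ g ∈ U F K a, ∀ X ∈ quadMatrix F K (Fin a) (Fin b), T X = g.1 * X := by
  let τ (a b : ℕ) := (transposeLinearEquiv (Fin a) (Fin b) F K).toLinearMap
  have h1 (h) (hh : h ∈ U F K b) (X) (hX : X ∈ quadMatrix F K (Fin b) (Fin a)) :
      (τ a b ∘ₗ T ∘ₗ τ b a) (h.1 * X) = h.1 * (τ a b ∘ₗ T ∘ₗ τ b a) X := by
    change (T (h.1 * X)ᵀ)ᵀ = h.1 * (T Xᵀ)ᵀ
    rw [transpose_mul, hcomm h hh _ (transpose_mem_quadMatrix hX), transpose_mul,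
      transpose_transpose]
  have h2 (X) (hX : X ∈ quadMatrix F K (Fin b) (Fin a)) (Y)
      (hY : Y ∈ quadMatrix F K (Fin b) (Fin a)) : symplForm F ((τ a b ∘ₗ T ∘ₗ τ b a) X)
        ((τ a b ∘ₗ T ∘ₗ τ b a) Y) = symplForm F X Y := by
    change symplForm F (T Xᵀ)ᵀ (T Yᵀ)ᵀ = _
    rw [symplForm_transpose, hT _ (transpose_mem_quadMatrix hX) _ (transpose_mem_quadMatrix hY),
      symplForm_transpose]
  obtain ⟨g, hg, h⟩ := exists_mem_U_of_commute hq hη0 hη k₀ _ h1 h2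
  refine ⟨g, hg, fun X hX => transpose_injective ?_⟩
  rw [transpose_mul]
  exact h Xᵀ (transpose_mem_quadMatrix hX)

/-- The groups `U_a(q)` and `U_b(q)` form a dual pair: the elements of `U_a(q)` span all matrices
over the quadratic extension of `F`, so that the commutant of `U_a(q)` consists of the right
multiplications by matrices, and those preserving the symplectic form are unitary. -/
theorem isUnitaryDualPair_U [IsAlgClosed K] (hq : Odd (Fintype.card F)) (a b : ℕ) :
    IsUnitaryDualPair F K (U F K a) (U F K b) := by
  obtain ⟨η, hη0, hη⟩ := exists_pow_card_eq_neg F K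
  have hinj := quadCoord_injective hq hη0 hη a b
  have hran := range_quadCoord hq hη0 hη a b
  have hmem (v) : quadCoord F η a b v ∈ quadMatrix F K (Fin a) (Fin b) := hran ▸ ⟨v, rfl⟩
  obtain ⟨ι, hι⟩ := exists_symplectic_of_isometric hq hη0 hη (leftAction (K := K) F a b)
    (fun g X hX => by
      rw [leftAction_apply]
      exact mul_mem_quadMatrix (mem_quadMatrix_of_qstar_mul_self (mem_U_iff.1 g.2)) hX)
    fun g X Y => by rw [leftAction_apply, leftAction_apply, symplForm_mul_left g.2]
  obtain ⟨ι', hι'⟩ := exists_symplectic_of_isometric hq hη0 hη (rightAction (K := K) F a b)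
    (fun g X hX => by
      rw [rightAction_apply]
      exact mul_mem_quadMatrix hX
        (transpose_mem_quadMatrix (mem_quadMatrix_of_qstar_mul_self (mem_U_iff.1 g.2))))
    fun g X Y => by rw [rightAction_apply, rightAction_apply, symplForm_mul_right g.2]
  simp only [leftAction_apply] at hι
  simp only [rightAction_apply] at hι'
  have hext {A B : symplecticGroup (Fin (a * b)) F}
      (h : ∀ v, quadCoord F η a b (A.1 *ᵥ v) = quadCoord F η a b (B.1 *ᵥ v)) : A = B :=
    Subtype.ext (ext_of_mulVec_single fun i => hinj (h _))
  -- a symplectic matrix extends to a linear map on all matrices over `K`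
  have hlin (A : symplecticGroup (Fin (a * b)) F) :
      ∃ T : Matrix (Fin a) (Fin b) K →ₗ[F] Matrix (Fin a) (Fin b) K,
        (∀ v, T (quadCoord F η a b v) = quadCoord F η a b (A.1 *ᵥ v)) ∧
        ∀ X ∈ quadMatrix F K (Fin a) (Fin b), ∀ Y ∈ quadMatrix F K (Fin a) (Fin b),
          symplForm F (T X) (T Y) = symplForm F X Y := by
    obtain ⟨p, hp⟩ := LinearMap.exists_leftInverse_of_injective _ (LinearMap.ker_eq_bot.2 hinj)
    have hT (v) : (quadCoord F η a b ∘ₗ A.1.mulVecLin ∘ₗ p) (quadCoord F η a b v) =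
        quadCoord F η a b (A.1 *ᵥ v) :=
      congrArg (fun w => quadCoord F η a b (A.1 *ᵥ w)) (LinearMap.congr_fun hp v)
    refine ⟨_, hT, fun X hX Y hY => ?_⟩
    rw [← hran] at hX hY
    obtain ⟨v, rfl⟩ := hX
    obtain ⟨w, rfl⟩ := hY
    rw [hT, hT, (mem_symplecticGroup_iff hq hη0 hη).1 A.2]
  have hcomm (g h) : ι g * ι' h = ι' h * ι g := by
    refine hext fun v => ?_
    change quadCoord F η a b (((ι g).1 * (ι' h).1) *ᵥ v) =
      quadCoord F η a b (((ι' h).1 * (ι g).1) *ᵥ v)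
    rw [← mulVec_mulVec, ← mulVec_mulVec, hι, hι', hι', hι, Matrix.mul_assoc]
  refine ⟨a, b, a * b, .refl _, .refl _, quadCoord F η a b, ι, ι', hinj, ?_, hι, hι', ?_, ?_⟩
  · ext X
    exact (SetLike.ext_iff.1 hran X).trans mem_quadMatrix_iff
  · -- for `a = 0` or `b = 0` the symplectic group is trivial
    by_cases h0 : a * b = 0
    · have : IsEmpty (Fin (a * b)) := by rw [h0]; infer_instance
      have : Subsingleton (symplecticGroup (Fin (a * b)) F) := inferInstance
      ext A
      rw [Subsingleton.elim A 1]
      exact iff_of_true (one_mem _) (one_mem _)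
    refine le_antisymm (fun A hA => ?_) ?_
    · obtain ⟨T, hT, hω⟩ := hlin A
      have hTg (g) (hg : g ∈ U F K a) (X) (hX : X ∈ quadMatrix F K (Fin a) (Fin b)) :
          T (g.1 * X) = g.1 * T X := by
        rw [← hran] at hX
        obtain ⟨v, rfl⟩ := hX
        have h1 := congrArg Subtype.val (Subgroup.mem_centralizer_iff.1 hA _ ⟨⟨g, hg⟩, rfl⟩)
        have h2 : (ι ⟨g, hg⟩).1 * A.1 = A.1 * (ι ⟨g, hg⟩).1 := h1
        rw [← hι ⟨g, hg⟩, hT, hT, mulVec_mulVec, ← h2, ← mulVec_mulVec, hι]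
      obtain ⟨h, hh, hX⟩ := exists_mem_U_of_commute hq hη0 hη
        ⟨0, Nat.pos_of_ne_zero (left_ne_zero_of_mul h0)⟩ T hTg hω
      refine ⟨⟨h, hh⟩, hext fun v => ?_⟩
      rw [hι', ← hT, hX _ (hmem v)]
    · rintro _ ⟨h, rfl⟩
      rw [Subgroup.mem_centralizer_iff]
      rintro _ ⟨g, rfl⟩
      exact hcomm g h
  · by_cases h0 : a * b = 0
    · have : IsEmpty (Fin (a * b)) := by rw [h0]; infer_instance
      have : Subsingleton (symplecticGroup (Fin (a * b)) F) := inferInstance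
      ext A
      rw [Subsingleton.elim A 1]
      exact iff_of_true (one_mem _) (one_mem _)
    refine le_antisymm (fun A hA => ?_) ?_
    · obtain ⟨T, hT, hω⟩ := hlin A
      have hTh (h) (hh : h ∈ U F K b) (X) (hX : X ∈ quadMatrix F K (Fin a) (Fin b)) :
          T (X * h.1ᵀ) = T X * h.1ᵀ := by
        rw [← hran] at hX
        obtain ⟨v, rfl⟩ := hX
        have h1 := congrArg Subtype.val (Subgroup.mem_centralizer_iff.1 hA _ ⟨⟨h, hh⟩, rfl⟩)
        have h2 : (ι' ⟨h, hh⟩).1 * A.1 = A.1 * (ι' ⟨h, hh⟩).1 := h1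
        rw [← hι' ⟨h, hh⟩, hT, hT, mulVec_mulVec, ← h2, ← mulVec_mulVec, hι']
      obtain ⟨g, hg, hX⟩ := exists_mem_U_of_commute_right hq hη0 hη
        ⟨0, Nat.pos_of_ne_zero (right_ne_zero_of_mul h0)⟩ T hTh hω
      refine ⟨⟨g, hg⟩, hext fun v => ?_⟩
      rw [hι, ← hT, hX _ (hmem v)]
    · rintro _ ⟨g, rfl⟩
      rw [Subgroup.mem_centralizer_iff]
      rintro _ ⟨h, rfl⟩
      exact (hcomm g h).symm

end DualPair

/-! ### The factor of the centralizer at the eigenvalue one -/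

section One

variable {F : Type*} [Field F] [Fintype F] {K : Type*} [Field K] [Algebra F K]

/-- The factor `G_[1](s)` is Langlands dual to the unitary group `U_a`, where `a` is the multiplicity
of the eigenvalue `1`. -/
theorem isLanglandsDual_centralizerFactor_one [IsAlgClosed K] (hq : Odd (Fintype.card F)) {a l : ℕ}
    {t : Fin l → Kˣ} (ht : ∀ i, t i ≠ 1) {s : GL (Fin (l + a)) K} (hs : s ∈ U F K (l + a))
    (h : IsConj s (torusElement (l + a) t)) :
    IsLanglandsDual (centralizerFactor s (frobClass F s 1)) (unitaryFrob F K (l + a))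
      ⊤ (unitaryFrob F K a) := by
  obtain ⟨u, hu, hmem⟩ := exists_centralizerFactor_one_eq hq ht hs h
  have h1 : centralizerFactor s (frobClass F s 1) =
      (conjBlock ((Equiv.sumComm _ _).trans finSumFinEquiv) u).range :=
    Subgroup.ext fun g => hmem g
  rw [h1]
  exact isLanglandsDual_range_conjBlock_top _ hu

end One

end HowePan

theorem mainTheorem5 {F : Type*} [Field F] [Fintype F] (hq : Odd (Fintype.card F))
    {K : Type*} [Field K] [Algebra F K] [IsAlgClosure F K] (n n' : ℕ)
    (s : Matrix.GeneralLinearGroup (Fin n) K) (s' : Matrix.GeneralLinearGroup (Fin n') K)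
    (hs : s ∈ HowePan.U F K n) (hs' : s' ∈ HowePan.U F K n')
    (hss : Module.End.IsSemisimple (Matrix.toLin' s.1))
    (hss' : Module.End.IsSemisimple (Matrix.toLin' s'.1))
    (hrel : HowePan.HoweRelated s s') :
    Nonempty (HowePan.GSharp F s ≃* HowePan.GSharp F s') ∧
    ∃ a b : ℕ,
      HowePan.IsLanglandsDual
        (HowePan.centralizerFactor s (HowePan.frobClass F s 1)) (HowePan.unitaryFrob F K n)
        (⊤ : Subgroup (Matrix.GeneralLinearGroup (Fin a) K)) (HowePan.unitaryFrob F K a) ∧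
      HowePan.IsLanglandsDual
        (HowePan.centralizerFactor s' (HowePan.frobClass F s' 1)) (HowePan.unitaryFrob F K n')
        (⊤ : Subgroup (Matrix.GeneralLinearGroup (Fin b) K)) (HowePan.unitaryFrob F K b) ∧
      HowePan.IsUnitaryDualPair F K (HowePan.U F K a) (HowePan.U F K b) := by
  have : IsAlgClosed K := IsAlgClosure.isAlgClosed F
  have : Algebra.IsAlgebraic F K := IsAlgClosure.isAlgebraic
  refine ⟨HowePan.nonempty_GSharp_equiv_of_howeRelated hq hs hs' hrel, ?_⟩
  obtain ⟨l, t, hl, ht, hst, hst'⟩ := hrel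
  obtain ⟨a, rfl⟩ := Nat.exists_eq_add_of_le (hl.trans (min_le_left _ _))
  obtain ⟨b, rfl⟩ := Nat.exists_eq_add_of_le (hl.trans (min_le_right _ _))
  exact ⟨a, b, HowePan.isLanglandsDual_centralizerFactor_one hq ht hs hst,
    HowePan.isLanglandsDual_centralizerFactor_one hq ht hs' hst', HowePan.isUnitaryDualPair_U hq a b⟩
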